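/- Let $\lambda>0$ and $t\in(0,\pi/2)$, put $t_1=t$, $t_2=-t$, and let $$w_j(x)=\frac1{2\pi}e^{2t_jx}\,|\Gamma(\lambda+ix)|^2,\qquad x\in\mathbb R,\ j=1,2 .$$ For integers $k_1,k_2\ge 0$, the multiple Meixner–Pollaczek polynomial $P_{k_1,k_2}$ is the monic polynomial of degree $k_1+k_2$ with $\int_{\mathbb R}P_{k_1,k_2}(x)x^m w_j(x)\,dx=0$ for $0\le m\le k_j-1$, $j=1,2$. Put $Q_k=P_{k/2,k/2}$ for even $k$, $Q_k=P_{(k+1)/2,(k-1)/2}$ for odd $k$, and $Q_{k,n}(x)=n^{-k}Q_k(nx)$. For $s>0$ put $a_s=\frac{s}{2}\tan t$ and $b_s=\frac{s^2}{4}(1+\tan^2t)$. For $x\in\mathbb C$ let $z_1(x,s),z_2(x,s),z_3(x,s)$ be the solutions $z$, counted with multiplicity, of $$x^2=\frac{(1+b_sz)^2(1+a_s^2z)}{z},$$ labelled so that $0<|z_1(x,s)|\le|z_2(x,s)|\le|z_3(x,s)|$ (arbitrarily in case of equal moduli), and let $\Gamma_1(s)=\{x\in\mathbb C:\ |z_1(x,s)|=|z_2(x,s)|\}$.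 Let $\mu_1^s$ be the measure on $\Gamma_1(s)\cap\mathbb R$ with density $$\frac{d\mu_1^s}{dx}(x)=\frac12\,\frac1{2\pi i}\left(\frac{z_{1+}'(x,s)}{z_{1+}(x,s)}-\frac{z_{1-}'(x,s)}{z_{1-}(x,s)}\right),$$ where $'$ is the derivative with respect to $x$, and $+$ and $-$ denote boundary values on the real line from the upper and the lower half plane. Let $\nu_1=\int_0^1\mu_1^s\,ds$, that is, $\nu_1(B)=\int_0^1\mu_1^s(B)\,ds$ for Borel sets $B\subset\mathbb R$. Then all these objects are well defined: for every $k\ge0$ the polynomial $Q_k$ exists and is unique, and for every $n$ the polynomial $Q_{n,n}$ has $n$ distinct real zeros $x_1,\dots,x_n$; for every $s>0$ one has $\Gamma_1(s)\subset\mathbb R$, the boundary values of $z_1$ (which are nonzero) and of $z_1'$ exist at all but finitely many points of $\Gamma_1(s)$, the density is real and nonnegative there, and $\mu_1^s$ is a probability measure; the map $s\mapsto\mu_1^s$ is Lebesgue almost everywhere measurable on $(0,1]$, and $\nu_1$ is a probability measure. Moreover, as $n\to\infty$, the normalized zero counting measures of $Q_{n,n}$ converge weakly to $\nu_1$: $$\rho_n:=\frac1n\sum_{j=1}^n\delta_{x_j}\longrightarrow\nu_1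 ,$$ that is, $\int f\,d\rho_n\to\int f\,d\nu_1$ for every bounded continuous $f:\mathbb R\to\mathbb R$. -/

import Mathlib

open MeasureTheory Filter Topology Set Polynomial
open scoped ENNReal BoundedContinuousFunction

noncomputable section

namespace MeixnerPollaczek

/-! ### Multiple Meixner-Pollaczek polynomials -/

/-- The Meixner-Pollaczek weight `w(x) = (1/2π) e^{2tx} |Γ(lam + ix)|²`. -/
def weight (lam t x : ℝ) : ℝ :=
  1 / (2 * Real.pi) * Real.exp (2 * t * x)
    * ‖Complex.Gamma ((lam : ℂ) + Complex.I * (x : ℂ))‖ ^ 2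

/-- `P` is a monic polynomial of degree `k₁ + k₂` that is orthogonal to `x ^ m`, `m < k₁`, for the
weight with parameter `t₁` and to `x ^ m`, `m < k₂`, for the weight with parameter `t₂`. -/
structure IsMultipleMP (lam t₁ t₂ : ℝ) (k₁ k₂ : ℕ) (P : ℝ[X]) : Prop where
  monic : P.Monic
  natDegree_eq : P.natDegree = k₁ + k₂
  orthogonal₁ : ∀ m < k₁, ∫ x : ℝ, P.eval x * x ^ m * weight lam t₁ x = 0
  orthogonal₂ : ∀ m < k₂, ∫ x : ℝ, P.eval x * x ^ m * weight lam t₂ x = 0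

open Classical in
/-- The multiple Meixner-Pollaczek polynomial `P_{k₁,k₂}` (`0` if there were none). -/
def multipleMP (lam t₁ t₂ : ℝ) (k₁ k₂ : ℕ) : ℝ[X] :=
  if h : ∃ P, IsMultipleMP lam t₁ t₂ k₁ k₂ P then h.choose else 0

/-- `Q_k`, which is `P_{k/2,k/2}` for even `k` and `P_{(k+1)/2,(k-1)/2}` for odd `k`
(natural number division rounds down). -/
def stepMP (lam t₁ t₂ : ℝ) (k : ℕ) : ℝ[X] :=
  multipleMP lam t₁ t₂ ((k + 1) / 2) (k / 2)

/-- The rescaled polynomial `Q_{k,n}(x) = n^{-k} Q_k(n x)`. -/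
def scaledMP (lam t₁ t₂ : ℝ) (k n : ℕ) : ℝ[X] :=
  C (((n : ℝ) ^ k)⁻¹) * (stepMP lam t₁ t₂ k).comp (C (n : ℝ) * X)

/-- The normalized zero counting measure `(1/n) ∑ δ_x` over the real zeros of `P`, counted with
multiplicity. -/
def zeroCounting (n : ℕ) (P : ℝ[X]) : Measure ℝ :=
  (n : ℝ≥0∞)⁻¹ • (P.roots.map (fun x => Measure.dirac x)).sum

/-! ### The measures `μ₁ˢ` and their average -/

/-- `a_s = (tan t) s / 2`. -/
def coeffA (t s : ℝ) : ℝ := Real.tan t * s / 2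

/-- `b_s = (1 + tan² t) s² / 4`. -/
def coeffB (t s : ℝ) : ℝ := (1 + Real.tan t ^ 2) * s ^ 2 / 4

/-- The polynomial `(1 + b_s z)² (1 + a_s² z) - x² z` in `z`. It does not vanish at `z = 0`, so its
roots are the solutions of `x² = (1 + b_s z)² (1 + a_s² z) / z`. -/
def cubic (t s : ℝ) (x : ℂ) : ℂ[X] :=
  (1 + C (coeffB t s : ℂ) * X) ^ 2 * (1 + C ((coeffA t s : ℂ) ^ 2) * X) - C (x ^ 2) * X

/-- `z 0, z 1, z 2` are the three roots, with multiplicity, in the order of increasing modulus. -/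
def IsLabeling (t s : ℝ) (x : ℂ) (z : Fin 3 → ℂ) : Prop :=
  (cubic t s x).roots = {z 0, z 1, z 2} ∧ ‖z 0‖ ≤ ‖z 1‖ ∧ ‖z 1‖ ≤ ‖z 2‖

open Classical in
/-- The roots `z₁(x,s), z₂(x,s), z₃(x,s)` (with indices `0, 1, 2`), where roots of equal modulus
are labelled arbitrarily. For `s ≠ 0` and `0 < t < π/2` the cubic has degree `3`, so that a
labelling exists. -/
def rootZ (t s : ℝ) (x : ℂ) : Fin 3 → ℂ :=
  if h : ∃ z, IsLabeling t s x z then h.choose else 0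

/-- `Γ₁(s) = {x ∈ ℂ : |z₁(x,s)| = |z₂(x,s)|}`. -/
def gammaOne (t s : ℝ) : Set ℂ :=
  {x | ‖rootZ t s x 0‖ = ‖rootZ t s x 1‖}

/-- The function `x ↦ z₁(x,s)` on the complex plane. -/
def zOne (t s : ℝ) (x : ℂ) : ℂ := rootZ t s x 0

/-- Approach of the real point `x` from the open upper half plane. -/
def fromAbove (x : ℝ) : Filter ℂ := 𝓝[{w : ℂ | 0 < w.im}] (x : ℂ)

/-- Approach of the real point `x` from the open lower half plane. -/
def fromBelow (x : ℝ) : Filter ℂ := 𝓝[{w : ℂ | w.im < 0}] (x : ℂ)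

/-- The density `(1/2) (1/(2πi)) (z₁₊'/z₁₊ - z₁₋'/z₁₋)` at the real point `x`, as a complex
number. -/
def densityOne (t s x : ℝ) : ℂ :=
  1 / 2 * (1 / (2 * (Real.pi : ℂ) * Complex.I)) *
    (limUnder (fromAbove x) (deriv (zOne t s)) / limUnder (fromAbove x) (zOne t s)
      - limUnder (fromBelow x) (deriv (zOne t s)) / limUnder (fromBelow x) (zOne t s))

/-- At the real point `x` the function `z₁(·,s)` and its derivative have boundary values from both
sides, and the resulting density is a nonnegative real number. -/
structure DensityOneExists (t s x : ℝ) : Prop where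
  above : ∃ v : ℂ, v ≠ 0 ∧ Tendsto (zOne t s) (fromAbove x) (𝓝 v)
  below : ∃ v : ℂ, v ≠ 0 ∧ Tendsto (zOne t s) (fromBelow x) (𝓝 v)
  deriv_above : ∃ v : ℂ, Tendsto (deriv (zOne t s)) (fromAbove x) (𝓝 v)
  deriv_below : ∃ v : ℂ, Tendsto (deriv (zOne t s)) (fromBelow x) (𝓝 v)
  im_eq_zero : (densityOne t s x).im = 0
  re_nonneg : 0 ≤ (densityOne t s x).re

/-- The measure `μ₁ˢ` on the real part of `Γ₁(s)` with density `densityOne`. -/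
def muOne (t s : ℝ) : Measure ℝ :=
  (volume.restrict {x : ℝ | (x : ℂ) ∈ gammaOne t s}).withDensity
    (fun x => ENNReal.ofReal (densityOne t s x).re)

/-- The average `ν₁ = ∫₀¹ μ₁ˢ ds`, that is `ν₁(B) = ∫₀¹ μ₁ˢ(B) ds`. -/
def nuOne (t : ℝ) : Measure ℝ :=
  (volume.restrict (Ioc (0 : ℝ) 1)).bind (fun s => muOne t s)

end MeixnerPollaczek

end

namespace MeixnerPollaczek

/-! ### The Gamma function on vertical lines -/

lemma norm_cpow_mul_exp (s r : ℂ) {t : ℝ} (ht : 0 < t) :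
    ‖(t : ℂ) ^ (s - 1) * Complex.exp (-(r * t))‖ = t ^ (s.re - 1) * Real.exp (-(r.re * t)) := by
  rw [norm_mul, Complex.norm_cpow_eq_rpow_re_of_pos ht, Complex.norm_exp]
  simp

lemma integrableOn_rpow_mul_exp {a c : ℝ} (ha : 0 < a) (hc : 0 < c) :
    IntegrableOn (fun t : ℝ => t ^ (a - 1) * Real.exp (-(c * t))) (Ioi 0) := by
  have := integrableOn_rpow_mul_exp_neg_mul_rpow (p := 1) (s := a - 1) (b := c) (by linarith)
    one_pos hc
  simpa using this

lemma aestronglyMeasurable_cpow_mul_exp (s r : ℂ) :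
    AEStronglyMeasurable (fun t : ℝ => (t : ℂ) ^ (s - 1) * Complex.exp (-(r * t)))
      (volume.restrict (Ioi 0)) := by
  refine ContinuousOn.aestronglyMeasurable (fun t ht => ?_) measurableSet_Ioi
  refine ContinuousAt.continuousWithinAt ?_
  have : ContinuousAt (fun t : ℝ => (t : ℂ) ^ (s - 1)) t :=
    (Complex.continuous_ofReal.continuousAt).cpow continuousAt_const
      (Or.inl (by simpa using ht))
  exact this.mul (by fun_prop)

lemma integrableOn_cpow_mul_exp {s r : ℂ} (hs : 0 < s.re) (hr : 0 < r.re) :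
    IntegrableOn (fun t : ℝ => (t : ℂ) ^ (s - 1) * Complex.exp (-(r * t))) (Ioi 0) := by
  refine Integrable.mono' (integrableOn_rpow_mul_exp hs hr) (aestronglyMeasurable_cpow_mul_exp s r) ?_
  filter_upwards [ae_restrict_mem measurableSet_Ioi] with t ht
  exact (norm_cpow_mul_exp s r ht).le

lemma hasDerivAt_integral_cpow_mul_exp {s r : ℂ} (hs : 0 < s.re) (hr : 0 < r.re) :
    DifferentiableAt ℂ
      (fun r : ℂ => ∫ t : ℝ in Ioi 0, (t : ℂ) ^ (s - 1) * Complex.exp (-(r * t))) r := by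
  have hopen : {w : ℂ | r.re / 2 < w.re} ∈ 𝓝 r :=
    (isOpen_lt continuous_const Complex.continuous_re).mem_nhds (by simp; linarith)
  have key := hasDerivAt_integral_of_dominated_loc_of_deriv_le
    (μ := volume.restrict (Ioi (0 : ℝ))) (x₀ := r)
    (F := fun w (t : ℝ) => (t : ℂ) ^ (s - 1) * Complex.exp (-(w * t)))
    (F' := fun w (t : ℝ) => (t : ℂ) ^ (s - 1) * (Complex.exp (-(w * t)) * (-t)))
    (bound := fun t => t ^ ((s.re + 1) - 1) * Real.exp (-(r.re / 2 * t)))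
    hopen (Eventually.of_forall fun w => aestronglyMeasurable_cpow_mul_exp s w)
    (integrableOn_cpow_mul_exp hs hr) ?_ ?_ (integrableOn_rpow_mul_exp (by linarith) (by linarith)) ?_
  · exact key.2.differentiableAt
  · have := (aestronglyMeasurable_cpow_mul_exp s r).mul
      (g := fun t : ℝ => (-t : ℂ)) (by fun_prop)
    simpa only [mul_assoc, Pi.mul_def] using this
  · filter_upwards [ae_restrict_mem measurableSet_Ioi] with t ht w hw
    have ht' : (0 : ℝ) < t := ht
    rw [← mul_assoc, norm_mul, norm_cpow_mul_exp s w ht', norm_neg, Complex.norm_real,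
      Real.norm_of_nonneg ht'.le, add_sub_right_comm, Real.rpow_add_one ht'.ne']
    have : Real.exp (-(w.re * t)) ≤ Real.exp (-(r.re / 2 * t)) := by
      apply Real.exp_le_exp.2
      have : r.re / 2 < w.re := hw
      nlinarith
    have h2 : 0 ≤ t ^ (s.re - 1) := Real.rpow_nonneg ht'.le _
    nlinarith [mul_le_mul_of_nonneg_left this (mul_nonneg h2 ht'.le)]
  · filter_upwards with t w _
    have h : HasDerivAt (fun w : ℂ => -(w * t)) (-(t : ℂ)) w :=
      (((hasDerivAt_id w).mul_const (t : ℂ)).neg).congr_deriv (by simp)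
    exact (h.cexp).const_mul _

/-- `∫ t^(s-1) e^{-rt} dt = r^{-s} Γ(s)` for complex `r` in the right half plane. -/
lemma integral_cpow_mul_exp_neg_mul_complex {s r : ℂ} (hs : 0 < s.re) (hr : 0 < r.re) :
    ∫ t : ℝ in Ioi 0, (t : ℂ) ^ (s - 1) * Complex.exp (-(r * t)) =
      r ^ (-s) * Complex.Gamma s := by
  let U : Set ℂ := {w | 0 < w.re}
  have hU : IsOpen U := isOpen_lt continuous_const Complex.continuous_re
  have h1 : AnalyticOnNhd ℂ
      (fun r : ℂ => ∫ t : ℝ in Ioi 0, (t : ℂ) ^ (s - 1) * Complex.exp (-(r * t))) U :=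
    DifferentiableOn.analyticOnNhd
      (fun w hw => (hasDerivAt_integral_cpow_mul_exp hs hw).differentiableWithinAt) hU
  have h2 : AnalyticOnNhd ℂ (fun r : ℂ => r ^ (-s) * Complex.Gamma s) U := by
    refine DifferentiableOn.analyticOnNhd (fun w hw => ?_) hU
    have : DifferentiableAt ℂ (fun r : ℂ => r ^ (-s)) w :=
      differentiableAt_id.cpow (differentiableAt_const _) (Or.inl hw)
    exact (this.mul_const _).differentiableWithinAt
  have hconn : IsPreconnected U := (convex_halfSpace_re_gt 0).isPreconnected
  refine h1.eqOn_of_preconnected_of_frequently_eq h2 hconn (z₀ := 1) (by simp [U]) ?_ hr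
  have hlim : Tendsto (fun n : ℕ => ((1 + 1 / ((n : ℝ) + 1) : ℝ) : ℂ)) atTop (𝓝[≠] 1) := by
    refine tendsto_nhdsWithin_iff.2 ⟨?_, Eventually.of_forall fun n => ?_⟩
    · have : Tendsto (fun n : ℕ => 1 + 1 / ((n : ℝ) + 1)) atTop (𝓝 (1 + 0)) :=
        tendsto_const_nhds.add tendsto_one_div_add_atTop_nhds_zero_nat
      simpa [Function.comp_def] using (Complex.continuous_ofReal.tendsto _).comp this
    · have : (0 : ℝ) < 1 / ((n : ℝ) + 1) := by positivity
      simp only [mem_compl_iff, mem_singleton_iff]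
      rw [Complex.ofReal_eq_one]
      linarith
  refine hlim.frequently (Frequently.of_forall fun n => ?_)
  have hpos : (0 : ℝ) < 1 + 1 / ((n : ℝ) + 1) := by positivity
  rw [Complex.integral_cpow_mul_exp_neg_mul_Ioi hs hpos, one_div, Complex.inv_cpow _ _
    (by rw [Complex.arg_ofReal_of_nonneg hpos.le]; exact Real.pi_pos.ne), Complex.cpow_neg]

lemma exp_I_mul_re (α : ℝ) : (Complex.exp (α * Complex.I)).re = Real.cos α := by
  rw [Complex.exp_ofReal_mul_I_re]

lemma cos_pos_of_abs_lt {α : ℝ} (hα : |α| < Real.pi / 2) : 0 < Real.cos α :=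
  Real.cos_pos_of_mem_Ioo ⟨by linarith [neg_abs_le α], by linarith [le_abs_self α]⟩

/-- The Mellin transform of `exp (-e^{iα} t)`. -/
lemma integral_cpow_mul_exp_rotated {s : ℂ} (hs : 0 < s.re) {α : ℝ} (hα : |α| < Real.pi / 2) :
    ∫ t : ℝ in Ioi 0, (t : ℂ) ^ (s - 1) * Complex.exp (-(Complex.exp (α * Complex.I) * t)) =
      Complex.exp (-(α * Complex.I) * s) * Complex.Gamma s := by
  rw [integral_cpow_mul_exp_neg_mul_complex hs (by
    rw [exp_I_mul_re]; exact cos_pos_of_abs_lt hα), Complex.cpow_def_of_ne_zero (Complex.exp_ne_zero _),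
    Complex.log_exp]
  · ring_nf
  · simp; linarith [neg_abs_le α, Real.pi_pos]
  · simp; linarith [le_abs_self α, Real.pi_pos]

lemma norm_exp_rotated (α lam x : ℝ) :
    ‖Complex.exp (-(α * Complex.I) * ((lam : ℂ) + Complex.I * x))‖ = Real.exp (α * x) := by
  rw [Complex.norm_exp]
  simp

/-- Exponential decay of the Gamma function on vertical lines. -/
lemma exists_gamma_bound {lam α : ℝ} (hlam : 0 < lam) (hα : |α| < Real.pi / 2) :
    ∃ C : ℝ, ∀ x : ℝ, ‖Complex.Gamma ((lam : ℂ) + Complex.I * x)‖ * Real.exp (α * x) ≤ C := by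
  refine ⟨∫ t : ℝ in Ioi 0, t ^ (lam - 1) * Real.exp (-(Real.cos α * t)), fun x => ?_⟩
  have hs : 0 < ((lam : ℂ) + Complex.I * x).re := by simpa using hlam
  have h := integral_cpow_mul_exp_rotated hs hα
  have h2 : ‖Complex.Gamma ((lam : ℂ) + Complex.I * x)‖ * Real.exp (α * x) =
      ‖Complex.exp (-(α * Complex.I) * ((lam : ℂ) + Complex.I * x)) *
        Complex.Gamma ((lam : ℂ) + Complex.I * x)‖ := by
    rw [norm_mul, norm_exp_rotated, mul_comm]
  rw [h2, ← h]
  refine (norm_integral_le_integral_norm _).trans (le_of_eq ?_)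
  refine setIntegral_congr_fun measurableSet_Ioi fun t ht => ?_
  rw [norm_cpow_mul_exp _ _ ht, exp_I_mul_re]
  simp

lemma continuous_gamma_line {lam : ℝ} (hlam : 0 < lam) :
    Continuous fun x : ℝ => Complex.Gamma ((lam : ℂ) + Complex.I * x) := by
  refine continuous_iff_continuousAt.2 fun x => ?_
  have hd : DifferentiableAt ℂ Complex.Gamma ((lam : ℂ) + Complex.I * x) := by
    refine Complex.differentiableAt_Gamma _ fun m h => ?_
    have := congrArg Complex.re h
    simp at this
    have : (0 : ℝ) ≤ m := Nat.cast_nonneg m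
    linarith
  exact ContinuousAt.comp (f := fun x : ℝ => (lam : ℂ) + Complex.I * x) hd.continuousAt (by fun_prop)

lemma integrable_exp_neg_mul_abs {δ : ℝ} (hδ : 0 < δ) :
    Integrable fun x : ℝ => Real.exp (-(δ * |x|)) := by
  have hm : 0 < min 1 (δ ^ 2 / 2) := by positivity
  refine Integrable.mono' (integrable_inv_one_add_sq.const_mul (min 1 (δ ^ 2 / 2))⁻¹)
    (by fun_prop) (Eventually.of_forall fun x => ?_)
  rw [Real.norm_of_nonneg (Real.exp_pos _).le, Real.exp_neg, ← mul_inv]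
  apply inv_anti₀ (by positivity)
  have h := Real.quadratic_le_exp_of_nonneg (x := δ * |x|) (by positivity)
  have h1 : min 1 (δ ^ 2 / 2) ≤ 1 := min_le_left _ _
  have h2 : min 1 (δ ^ 2 / 2) ≤ δ ^ 2 / 2 := min_le_right _ _
  have h3 : 0 ≤ δ * |x| := by positivity
  nlinarith [mul_le_mul_of_nonneg_right h2 (sq_nonneg x), sq_abs x, mul_pow δ |x| 2]

/-- The pointwise decay of the Gamma function times an exponential. -/
lemma exists_gamma_decay {lam t : ℝ} (hlam : 0 < lam) (ht : |t| < Real.pi / 2) :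
    ∃ C δ : ℝ, 0 < δ ∧ ∀ x : ℝ,
      ‖Complex.Gamma ((lam : ℂ) + Complex.I * x)‖ * Real.exp (t * x) ≤
        C * Real.exp (-(δ * |x|)) := by
  obtain ⟨δ, hδ, hδ'⟩ : ∃ δ, 0 < δ ∧ |t| + δ < Real.pi / 2 :=
    ⟨(Real.pi / 2 - |t|) / 2, by linarith, by linarith⟩
  have habs : ∀ ε : ℝ, |ε| = δ → |t + ε| < Real.pi / 2 := fun ε hε =>
    (abs_add_le t ε).trans_lt (by linarith)
  obtain ⟨C₁, hC₁⟩ := exists_gamma_bound hlam (habs δ (abs_of_pos hδ))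
  obtain ⟨C₂, hC₂⟩ := exists_gamma_bound hlam (habs (-δ) (by rw [abs_neg, abs_of_pos hδ]))
  refine ⟨max C₁ C₂, δ, hδ, fun x => ?_⟩
  rw [Real.exp_neg, ← div_eq_mul_inv, le_div_iff₀ (Real.exp_pos _), mul_assoc, ← Real.exp_add]
  rcases le_total 0 x with hx | hx
  · rw [abs_of_nonneg hx, ← add_mul]
    exact (hC₁ x).trans (le_max_left _ _)
  · rw [abs_of_nonpos hx, show t * x + δ * -x = (t + -δ) * x by ring]
    exact (hC₂ x).trans (le_max_right _ _)

end MeixnerPollaczek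

namespace MeixnerPollaczek

open scoped FourierTransform ComplexConjugate

/-! ### The total mass of the weight -/

/-- Plancherel's formula for continuous integrable functions with integrable Fourier transform. -/
lemma integral_normSq_fourier {f : ℝ → ℂ} (hc : Continuous f) (hf : Integrable f)
    (hf' : Integrable (𝓕 f)) : ∫ ξ, ‖𝓕 f ξ‖ ^ 2 = ∫ u, ‖f u‖ ^ 2 := by
  have hg : Integrable fun ξ => conj (𝓕 f ξ) := 
    Complex.conjCLE.toContinuousLinearMap.integrable_comp hf'
  have hflip := VectorFourier.integral_fourierIntegral_smul_eq_flip (L := innerₗ ℝ)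
      Real.continuous_fourierChar continuous_inner hf hg
  have hinv : ∀ u, VectorFourier.fourierIntegral Real.fourierChar volume (innerₗ ℝ).flip
      (fun ξ => conj (𝓕 f ξ)) u = conj (f u) := by
    intro u
    have h1 : VectorFourier.fourierIntegral Real.fourierChar volume (innerₗ ℝ).flip
      (fun ξ => conj (𝓕 f ξ)) u = 𝓕 (fun ξ => conj (𝓕 f ξ)) u := by
      rw [flip_innerₗ]; rfl
    rw [h1, ← congrFun (hc.fourierInv_fourier_eq hf hf') u, Real.fourier_eq', Real.fourierInv_eq',
      ← integral_conj]
    congr 1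
    ext ξ
    simp only [smul_eq_mul, map_mul, ← Complex.exp_conj, Complex.conj_I, Complex.conj_ofReal]
    congr 2
    push_cast
    ring
  simp_rw [hinv] at hflip
  have e1 : ∀ z : ℂ, z • conj z = ((‖z‖ ^ 2 : ℝ) : ℂ) := fun z => by
    rw [smul_eq_mul, Complex.mul_conj, Complex.normSq_eq_norm_sq]
  have e2 : ∀ ξ, VectorFourier.fourierIntegral Real.fourierChar volume (innerₗ ℝ) f ξ = 𝓕 f ξ :=
    fun ξ => rfl
  simp_rw [e2, e1] at hflip
  exact Complex.ofReal_injective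
    ((integral_complex_ofReal).symm.trans (hflip.trans integral_complex_ofReal))

lemma image_exp_neg_univ : (fun u : ℝ => Real.exp (-u)) '' univ = Ioi 0 := by
  ext x
  simp only [image_univ, mem_range, mem_Ioi]
  exact ⟨fun ⟨u, hu⟩ => hu ▸ Real.exp_pos _, fun h => ⟨-Real.log x, by simp [Real.exp_log h]⟩⟩

lemma abs_smul_rpow_exp (a c u : ℝ) :
    |(-Real.exp (-u))| • (Real.exp (-u) ^ (a - 1) * Real.exp (-(c * Real.exp (-u)))) =
      Real.exp (-a * u) * Real.exp (-(c * Real.exp (-u))) := by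
  rw [abs_neg, abs_of_pos (Real.exp_pos _), smul_eq_mul, ← mul_assoc, ← Real.exp_mul,
    ← Real.exp_add]
  congr 2
  ring

lemma integrable_exp_mul_exp_exp {a c : ℝ} (ha : 0 < a) (hc : 0 < c) :
    Integrable fun u : ℝ => Real.exp (-a * u) * Real.exp (-(c * Real.exp (-u))) := by
  have h := (integrableOn_image_iff_integrableOn_abs_deriv_smul MeasurableSet.univ
    (f := fun u : ℝ => Real.exp (-u)) (f' := fun u => -Real.exp (-u))
    (fun x _ => ((hasDerivAt_neg x).exp.congr_deriv (by simp)).hasDerivWithinAt)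
    (fun x _ y _ h => by simpa using h)
    (fun t => t ^ (a - 1) * Real.exp (-(c * t)))).1
    (by rw [image_exp_neg_univ]; exact integrableOn_rpow_mul_exp ha hc)
  simpa only [abs_smul_rpow_exp, integrableOn_univ] using h

lemma integral_exp_mul_exp_exp {a c : ℝ} (ha : 0 < a) (hc : 0 < c) :
    ∫ u : ℝ, Real.exp (-a * u) * Real.exp (-(c * Real.exp (-u))) =
      (1 / c) ^ a * Real.Gamma a := by
  have h := (integral_image_eq_integral_abs_deriv_smul MeasurableSet.univ
    (f := fun u : ℝ => Real.exp (-u)) (f' := fun u => -Real.exp (-u))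
    (fun x _ => ((hasDerivAt_neg x).exp.congr_deriv (by simp)).hasDerivWithinAt)
    (fun x _ y _ h => by simpa using h)
    (fun t => t ^ (a - 1) * Real.exp (-(c * t))))
  rw [image_exp_neg_univ, Real.integral_rpow_mul_exp_neg_mul_Ioi ha hc] at h
  simpa only [abs_smul_rpow_exp, setIntegral_univ] using h.symm

/-- The function whose Fourier transform is `Γ` on a vertical line, times an exponential. -/
noncomputable def rotatedExp (lam t u : ℝ) : ℂ :=
  Real.exp (-lam * u) • Complex.exp (-(Complex.exp (t * Complex.I) * (Real.exp (-u) : ℝ)))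

lemma norm_rotatedExp (lam t u : ℝ) :
    ‖rotatedExp lam t u‖ = Real.exp (-lam * u) * Real.exp (-(Real.cos t * Real.exp (-u))) := by
  rw [rotatedExp, norm_smul, Complex.norm_exp, Real.norm_of_nonneg (Real.exp_pos _).le,
    Complex.neg_re, Complex.re_mul_ofReal, exp_I_mul_re]

lemma continuous_rotatedExp (lam t : ℝ) : Continuous (rotatedExp lam t) := by
  unfold rotatedExp
  fun_prop

lemma integrable_rotatedExp {lam t : ℝ} (hlam : 0 < lam) (ht : |t| < Real.pi / 2) :
    Integrable (rotatedExp lam t) :=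
  Integrable.mono' (integrable_exp_mul_exp_exp hlam (cos_pos_of_abs_lt ht))
    (continuous_rotatedExp lam t).aestronglyMeasurable
    (Eventually.of_forall fun u => (norm_rotatedExp lam t u).le)

lemma fourier_rotatedExp {lam t : ℝ} (hlam : 0 < lam) (ht : |t| < Real.pi / 2) (ξ : ℝ) :
    𝓕 (rotatedExp lam t) ξ =
      Complex.exp (-(t * Complex.I) * ((lam : ℂ) + Complex.I * (2 * Real.pi * ξ : ℝ))) *
        Complex.Gamma ((lam : ℂ) + Complex.I * (2 * Real.pi * ξ : ℝ)) := by
  have hs : ((lam : ℂ) + Complex.I * (2 * Real.pi * ξ : ℝ)).re = lam := by simp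
  have him : ((lam : ℂ) + Complex.I * (2 * Real.pi * ξ : ℝ)).im = 2 * Real.pi * ξ := by
    simp
  rw [← integral_cpow_mul_exp_rotated (by rw [hs]; exact hlam) ht]
  have h := mellin_eq_fourier (fun v : ℝ => Complex.exp (-(Complex.exp (t * Complex.I) * v)))
    (s := (lam : ℂ) + Complex.I * (2 * Real.pi * ξ : ℝ))
  rw [hs, him, mul_div_cancel_left₀ _ (by positivity)] at h
  exact h.symm

lemma norm_fourier_rotatedExp {lam t : ℝ} (hlam : 0 < lam) (ht : |t| < Real.pi / 2) (ξ : ℝ) :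
    ‖𝓕 (rotatedExp lam t) ξ‖ =
      ‖Complex.Gamma ((lam : ℂ) + Complex.I * (2 * Real.pi * ξ : ℝ))‖ *
        Real.exp (t * (2 * Real.pi * ξ)) := by
  rw [fourier_rotatedExp hlam ht, norm_mul, norm_exp_rotated, mul_comm]

lemma integrable_gamma_mul_exp {lam t : ℝ} (hlam : 0 < lam) (ht : |t| < Real.pi / 2) :
    Integrable fun x : ℝ =>
      ‖Complex.Gamma ((lam : ℂ) + Complex.I * x)‖ * Real.exp (t * x) := by
  obtain ⟨C, δ, hδ, h⟩ := exists_gamma_decay hlam ht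
  refine Integrable.mono' ((integrable_exp_neg_mul_abs hδ).const_mul C) ?_
    (Eventually.of_forall fun x => ?_)
  · exact ((continuous_gamma_line hlam).norm.mul (by fun_prop)).aestronglyMeasurable
  · rw [Real.norm_of_nonneg (by positivity)]
    exact h x

lemma continuous_weight {lam : ℝ} (hlam : 0 < lam) (t : ℝ) : Continuous (weight lam t) := by
  unfold weight
  exact Continuous.mul (by fun_prop) ((continuous_gamma_line hlam).norm.pow 2)

lemma weight_pos {lam : ℝ} (hlam : 0 < lam) (t x : ℝ) : 0 < weight lam t x := by
  have : Complex.Gamma ((lam : ℂ) + Complex.I * x) ≠ 0 :=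
    Complex.Gamma_ne_zero_of_re_pos (by simpa using hlam)
  unfold weight
  have := norm_pos_iff.2 this
  positivity

lemma weight_eq_sq (lam t x : ℝ) : weight lam t x =
    1 / (2 * Real.pi) *
      (‖Complex.Gamma ((lam : ℂ) + Complex.I * x)‖ * Real.exp (t * x)) ^ 2 := by
  rw [weight, mul_pow, ← Real.exp_nat_mul]
  push_cast
  ring_nf

lemma integrable_weight {lam t : ℝ} (hlam : 0 < lam) (ht : |t| < Real.pi / 2) :
    Integrable (weight lam t) := by
  obtain ⟨C, hC⟩ := exists_gamma_bound hlam ht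
  refine Integrable.mono' ((integrable_gamma_mul_exp hlam ht).const_mul (1 / (2 * Real.pi) * C))
    (continuous_weight hlam t).aestronglyMeasurable (Eventually.of_forall fun x => ?_)
  rw [Real.norm_of_nonneg (weight_pos hlam t x).le, weight_eq_sq, mul_assoc, pow_two]
  have := hC x
  have h0 : 0 ≤ ‖Complex.Gamma ((lam : ℂ) + Complex.I * x)‖ * Real.exp (t * x) := by positivity
  gcongr

/-- The total mass of the Meixner-Pollaczek weight. -/
lemma integral_weight {lam t : ℝ} (hlam : 0 < lam) (ht : |t| < Real.pi / 2) :
    ∫ x, weight lam t x = (1 / (2 * Real.cos t)) ^ (2 * lam) * Real.Gamma (2 * lam) := by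
  have hpl := integral_normSq_fourier (continuous_rotatedExp lam t) (integrable_rotatedExp hlam ht)
    ?_
  · have h1 : ∫ u, ‖rotatedExp lam t u‖ ^ 2 =
        (1 / (2 * Real.cos t)) ^ (2 * lam) * Real.Gamma (2 * lam) := by
      rw [← integral_exp_mul_exp_exp (by positivity)
        (mul_pos two_pos (cos_pos_of_abs_lt ht))]
      congr 1
      ext u
      rw [norm_rotatedExp, ← Real.exp_add, ← Real.exp_add, ← Real.exp_nat_mul]
      congr 1
      push_cast
      ring
    rw [← h1, ← hpl]
    simp_rw [norm_fourier_rotatedExp hlam ht]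
    have h2 := Measure.integral_comp_mul_left (fun x : ℝ =>
      (‖Complex.Gamma ((lam : ℂ) + Complex.I * x)‖ * Real.exp (t * x)) ^ 2) (2 * Real.pi)
    rw [h2, abs_of_pos (by positivity), smul_eq_mul, ← integral_const_mul]
    congr 1
    ext x
    rw [weight_eq_sq, one_div]
  · have h := (integrable_gamma_mul_exp hlam ht).comp_mul_left' (R := 2 * Real.pi) (by positivity)
    have hcont : Continuous (𝓕 (rotatedExp lam t)) := by
      have : 𝓕 (rotatedExp lam t) = fun ξ : ℝ =>
          Complex.exp (-(t * Complex.I) * ((lam : ℂ) + Complex.I * (2 * Real.pi * ξ : ℝ))) *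
          Complex.Gamma ((lam : ℂ) + Complex.I * (2 * Real.pi * ξ : ℝ)) :=
        funext fun ξ => fourier_rotatedExp hlam ht ξ
      rw [this]
      refine Continuous.mul (by fun_prop) ?_
      exact (continuous_gamma_line hlam).comp (by fun_prop : Continuous fun ξ : ℝ => 2 * Real.pi * ξ)
    exact h.mono' hcont.aestronglyMeasurable
      (Eventually.of_forall fun ξ => (norm_fourier_rotatedExp hlam ht ξ).le)

/-! ### Moments of the weight -/

/-- The operator `g ↦ l T g + (1 + T²) g' / 2`. -/
noncomputable def mpOp {K : Type*} [Field K] (l : K) : Module.End K K[X] :=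
  LinearMap.mulLeft K (C l * X) + LinearMap.mulLeft K (C (1 / 2) * (1 + X ^ 2)) ∘ₗ derivative

lemma mpOp_apply {K : Type*} [Field K] (l : K) (g : K[X]) :
    mpOp l g = C l * X * g + C (1 / 2) * (1 + X ^ 2) * derivative g := rfl

/-- The linear map intertwining multiplication by `X` with `mpOp l` and fixing `1`. -/
noncomputable def mpTransform {K : Type*} [Field K] (l : K) : K[X] →ₗ[K] K[X] :=
  LinearMap.applyₗ (1 : K[X]) ∘ₗ (aeval (mpOp l)).toLinearMap

lemma mpTransform_apply {K : Type*} [Field K] (l : K) (P : K[X]) :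
    mpTransform l P = aeval (mpOp l) P 1 := rfl

@[simp] lemma mpTransform_one {K : Type*} [Field K] (l : K) : mpTransform l 1 = 1 := by
  simp [mpTransform_apply]

lemma mpTransform_X_mul {K : Type*} [Field K] (l : K) (P : K[X]) :
    mpTransform l (X * P) = mpOp l (mpTransform l P) := by
  simp [mpTransform_apply]

lemma mpTransform_X_pow_succ {K : Type*} [Field K] (l : K) (m : ℕ) :
    mpTransform l (X ^ (m + 1)) = mpOp l (mpTransform l (X ^ m)) := by
  rw [pow_succ', mpTransform_X_mul]

/-- The measure with the symmetric Meixner-Pollaczek weight. -/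
noncomputable def mpMeasure (lam : ℝ) : Measure ℝ :=
  volume.withDensity fun x => ENNReal.ofReal (weight lam 0 x)

lemma weight_eq_mul_exp (lam t x : ℝ) :
    weight lam t x = weight lam 0 x * Real.exp (2 * t * x) := by
  simp [weight]
  ring

lemma integrable_mpMeasure_iff {lam : ℝ} (hlam : 0 < lam) (m : ℕ) (t : ℝ) :
    Integrable (fun x : ℝ => id x ^ m * Real.exp (2 * t * id x)) (mpMeasure lam) ↔
      Integrable fun x : ℝ => x ^ m * weight lam t x := by
  rw [mpMeasure, integrable_withDensity_iff_integrable_smul'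
    (continuous_weight hlam 0).measurable.ennreal_ofReal (by simp)]
  refine integrable_congr (Eventually.of_forall fun x => ?_)
  simp only [ENNReal.toReal_ofReal (weight_pos hlam 0 x).le, smul_eq_mul, id]
  rw [weight_eq_mul_exp lam t x]
  ring

lemma integral_mpMeasure {lam : ℝ} (hlam : 0 < lam) (m : ℕ) (t : ℝ) :
    ∫ x : ℝ, id x ^ m * Real.exp (2 * t * id x) ∂(mpMeasure lam) =
      ∫ x : ℝ, x ^ m * weight lam t x := by
  rw [mpMeasure, integral_withDensity_eq_integral_toReal_smul
    (continuous_weight hlam 0).measurable.ennreal_ofReal (by simp)]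
  congr 1
  ext x
  simp only [ENNReal.toReal_ofReal (weight_pos hlam 0 x).le, smul_eq_mul, id]
  rw [weight_eq_mul_exp lam t x]
  ring

lemma mem_interior_integrableExpSet {lam t : ℝ} (hlam : 0 < lam) (ht : |t| < Real.pi / 2) :
    2 * t ∈ interior (ProbabilityTheory.integrableExpSet id (mpMeasure lam)) := by
  have hsub : Ioo (-Real.pi) Real.pi ⊆
      ProbabilityTheory.integrableExpSet id (mpMeasure lam) := fun v hv => by
    have h := (integrable_mpMeasure_iff hlam 0 (v / 2)).2 (by
      simpa using integrable_weight hlam (abs_lt.2 ⟨by linarith [hv.1], by linarith [hv.2]⟩))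
    have e : 2 * (v / 2) = v := by ring
    simpa [ProbabilityTheory.integrableExpSet, e] using h
  refine interior_maximal hsub isOpen_Ioo ?_
  rw [abs_lt] at ht
  exact ⟨by linarith, by linarith⟩

lemma integrable_pow_mul_weight {lam t : ℝ} (hlam : 0 < lam) (ht : |t| < Real.pi / 2) (m : ℕ) :
    Integrable fun x : ℝ => x ^ m * weight lam t x := by
  rw [← integrable_mpMeasure_iff hlam]
  exact ProbabilityTheory.integrable_pow_mul_exp_of_mem_interior_integrableExpSet
    (mem_interior_integrableExpSet hlam ht) m

lemma hasDerivAt_moment {lam t : ℝ} (hlam : 0 < lam) (ht : |t| < Real.pi / 2) (m : ℕ) :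
    HasDerivAt (fun t => ∫ x : ℝ, x ^ m * weight lam t x)
      (2 * ∫ x : ℝ, x ^ (m + 1) * weight lam t x) t := by
  have h := ProbabilityTheory.hasDerivAt_integral_pow_mul_exp_real
    (mem_interior_integrableExpSet hlam ht) m
  have h2 := HasDerivAt.comp t h ((hasDerivAt_id t).const_mul 2)
  simp only [Function.comp_def, id] at h2
  have e := integral_mpMeasure hlam (m + 1) t
  simp only [id] at e
  rw [e] at h2
  have e2 := fun t => integral_mpMeasure hlam m t
  simp only [id] at e2
  simp_rw [e2] at h2
  exact h2.congr_deriv (by ring)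

lemma hasDerivAt_mass {lam t : ℝ} (hlam : 0 < lam) (ht : |t| < Real.pi / 2) :
    HasDerivAt (fun t => ∫ x : ℝ, weight lam t x)
      (2 * lam * Real.tan t * ∫ x : ℝ, weight lam t x) t := by
  have hev : (fun t => ∫ x : ℝ, weight lam t x) =ᶠ[𝓝 t]
      fun t => (1 / (2 * Real.cos t)) ^ (2 * lam) * Real.Gamma (2 * lam) := by
    filter_upwards [(isOpen_lt continuous_abs continuous_const).mem_nhds ht] with u hu
    exact integral_weight hlam hu
  rw [integral_weight hlam ht]
  refine HasDerivAt.congr_of_eventuallyEq ?_ hev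
  have hc := cos_pos_of_abs_lt ht
  have h1 : HasDerivAt (fun t => 1 / (2 * Real.cos t))
      (Real.tan t * (1 / (2 * Real.cos t))) t := by
    have := ((Real.hasDerivAt_cos t).const_mul 2).inv (by positivity)
    simp only [one_div]
    refine this.congr_deriv ?_
    rw [Real.tan_eq_sin_div_cos]
    field_simp
  have hpos : 0 < 1 / (2 * Real.cos t) := by positivity
  have h2 := (h1.rpow_const (p := 2 * lam) (Or.inl hpos.ne')).mul_const (Real.Gamma (2 * lam))
  refine h2.congr_deriv ?_
  rw [Real.rpow_sub_one hpos.ne']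
  field_simp

lemma mass_pos {lam t : ℝ} (hlam : 0 < lam) (ht : |t| < Real.pi / 2) :
    0 < ∫ x : ℝ, weight lam t x := by
  rw [integral_weight hlam ht]
  have := cos_pos_of_abs_lt ht
  have := Real.Gamma_pos_of_pos (show 0 < 2 * lam by positivity)
  positivity

lemma integral_pow_mul_weight {lam : ℝ} (hlam : 0 < lam) (m : ℕ) :
    ∀ t : ℝ, |t| < Real.pi / 2 → ∫ x : ℝ, x ^ m * weight lam t x =
      (∫ x : ℝ, weight lam t x) * (mpTransform lam (X ^ m : ℝ[X])).eval (Real.tan t) := by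
  induction m with
  | zero => intro t _; simp
  | succ m ih =>
    intro t ht
    have hc := cos_pos_of_abs_lt ht
    have h1 := hasDerivAt_moment hlam ht m
    have htan : HasDerivAt Real.tan (1 + Real.tan t ^ 2) t := by
      refine (Real.hasDerivAt_tan hc.ne').congr_deriv ?_
      rw [Real.tan_eq_sin_div_cos, div_pow]
      have := Real.sin_sq_add_cos_sq t
      field_simp
      linarith
    have h2 := (hasDerivAt_mass hlam ht).mul
      (HasDerivAt.comp t ((mpTransform lam (X ^ m : ℝ[X])).hasDerivAt (Real.tan t)) htan)
    have hev : (fun t => ∫ x : ℝ, x ^ m * weight lam t x) =ᶠ[𝓝 t] ((fun t => ∫ x : ℝ, weight lam t x) *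
        ((fun x => (mpTransform lam (X ^ m : ℝ[X])).eval x) ∘ Real.tan)) := by
      filter_upwards [(isOpen_lt continuous_abs continuous_const).mem_nhds ht] with u hu
      exact ih u hu
    have h3 := h1.unique (h2.congr_of_eventuallyEq hev)
    rw [mpTransform_X_pow_succ, mpOp_apply]
    simp only [Function.comp_apply, eval_add, eval_mul, eval_C, eval_X, eval_one, eval_pow] at h3 ⊢
    linarith

lemma integrable_eval_mul_weight {lam t : ℝ} (hlam : 0 < lam) (ht : |t| < Real.pi / 2)
    (P : ℝ[X]) : Integrable fun x : ℝ => P.eval x * weight lam t x := by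
  induction P using Polynomial.induction_on' with
  | add p q hp hq => exact (hp.add hq).congr (ae_of_all _ fun x => by simp [add_mul])
  | monomial n a =>
    simpa [mul_assoc] using (integrable_pow_mul_weight hlam ht n).const_mul a

/-- Integration against the weight is evaluation of the transform at `tan t`. -/
lemma integral_eval_mul_weight {lam t : ℝ} (hlam : 0 < lam) (ht : |t| < Real.pi / 2)
    (P : ℝ[X]) : ∫ x : ℝ, P.eval x * weight lam t x =
      (∫ x : ℝ, weight lam t x) * (mpTransform lam P).eval (Real.tan t) := by
  induction P using Polynomial.induction_on' with
  | add p q hp hq =>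
    simp only [eval_add, add_mul, map_add, mul_add]
    rw [integral_add (integrable_eval_mul_weight hlam ht p) (integrable_eval_mul_weight hlam ht q),
      hp, hq]
  | monomial n a =>
    have : (monomial n a : ℝ[X]) = a • X ^ n := by rw [smul_X_eq_monomial]
    rw [this, map_smul]
    simp only [eval_smul, smul_eq_mul, mul_assoc, eval_pow, eval_X]
    rw [integral_const_mul, integral_pow_mul_weight hlam n t ht]
    ring

/-! ### Orthogonality as divisibility -/

lemma pow_dvd_of_mpOp_iterate {l τ : ℝ} (k : ℕ) (g : ℝ[X])
    (h : ∀ m < k, ((mpOp l)^[m] g).eval τ = 0) : (X - C τ) ^ k ∣ g := by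
  induction k generalizing g with
  | zero => simp
  | succ k ih =>
    obtain ⟨q, hq⟩ := ih g fun m hm => h m (hm.trans k.lt_succ_self)
    have key : ∀ (j : ℕ) (q : ℝ[X]), ∃ q', (mpOp l)^[j] ((X - C τ) ^ j * q) = q' ∧
        q'.eval τ = (j.factorial : ℝ) * ((1 + τ ^ 2) / 2) ^ j * q.eval τ := by
      intro j
      induction j with
      | zero => intro q; exact ⟨_, rfl, by simp⟩
      | succ j ihj =>
        intro q
        refine ⟨_, rfl, ?_⟩
        have e : mpOp l ((X - C τ) ^ (j + 1) * q) = (X - C τ) ^ j *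
            (C l * X * (X - C τ) * q + C (1 / 2) * (1 + X ^ 2) *
              (C (j + 1 : ℝ) * q + (X - C τ) * derivative q)) := by
          rw [mpOp_apply, derivative_mul, derivative_X_sub_C_pow]
          simp only [Nat.add_sub_cancel, map_add, map_natCast, map_one, Nat.cast_add, Nat.cast_one]
          ring
        rw [Function.iterate_succ_apply, e]
        obtain ⟨q', h1, h2⟩ := ihj (C l * X * (X - C τ) * q + C (1 / 2) * (1 + X ^ 2) *
              (C (j + 1 : ℝ) * q + (X - C τ) * derivative q))
        rw [h1, h2]
        simp only [eval_add, eval_mul, eval_C, eval_X, eval_sub, eval_one, eval_pow, sub_self,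
          Nat.factorial_succ, pow_succ]
        push_cast
        ring
    obtain ⟨q', h1, h2⟩ := key k q
    have h3 := h k k.lt_succ_self
    rw [hq, h1, h2] at h3
    have h4 : q.eval τ = 0 := by
      have : (0 : ℝ) < (k.factorial : ℝ) * ((1 + τ ^ 2) / 2) ^ k := by positivity
      exact (mul_eq_zero.1 h3).resolve_left this.ne'
    obtain ⟨r, hr⟩ := dvd_iff_isRoot.2 h4
    exact ⟨r, by rw [hq, hr, pow_succ]; ring⟩

lemma mpOp_iterate_eval_of_pow_dvd {l τ : ℝ} (k : ℕ) (g : ℝ[X]) (h : (X - C τ) ^ k ∣ g) :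
    ∀ m < k, ((mpOp l)^[m] g).eval τ = 0 := by
  intro m
  induction m generalizing g k with
  | zero =>
    intro hk
    exact dvd_iff_isRoot.1 ((dvd_pow_self _ hk.ne').trans h)
  | succ m ih =>
    intro hk
    obtain ⟨k, rfl⟩ : ∃ k', k = k' + 1 := ⟨k - 1, by omega⟩
    rw [Function.iterate_succ_apply]
    refine ih k _ ?_ (by omega)
    obtain ⟨q, rfl⟩ := h
    rw [mpOp_apply, derivative_mul, derivative_X_sub_C_pow, Nat.add_sub_cancel, pow_succ]
    exact ⟨C l * X * (X - C τ) * q + C (1 / 2) * (1 + X ^ 2) *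
      (C (↑(k + 1) : ℝ) * q + (X - C τ) * derivative q), by ring⟩

lemma mpTransform_X_pow_mul {K : Type*} [Field K] (l : K) (m : ℕ) (P : K[X]) :
    mpTransform l (X ^ m * P) = (mpOp l)^[m] (mpTransform l P) := by
  induction m with
  | zero => simp
  | succ m ih => rw [pow_succ', mul_assoc, mpTransform_X_mul, ih, Function.iterate_succ_apply']

lemma orthogonal_iff_dvd {lam t : ℝ} (hlam : 0 < lam) (ht : |t| < Real.pi / 2) (k : ℕ)
    (P : ℝ[X]) : (∀ m < k, ∫ x : ℝ, P.eval x * x ^ m * weight lam t x = 0) ↔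
      (X - C (Real.tan t)) ^ k ∣ mpTransform lam P := by
  have e : ∀ m, ∫ x : ℝ, P.eval x * x ^ m * weight lam t x = (∫ x : ℝ, weight lam t x) *
      ((mpOp lam)^[m] (mpTransform lam P)).eval (Real.tan t) := fun m => by
    rw [← mpTransform_X_pow_mul, ← integral_eval_mul_weight hlam ht]
    simp [mul_comm]
  simp only [e, mul_eq_zero, (mass_pos hlam ht).ne', false_or]
  exact ⟨pow_dvd_of_mpOp_iterate k _, mpOp_iterate_eval_of_pow_dvd k _⟩

/-! ### Degrees and bijectivity of the transform -/

lemma natDegree_mpOp_le {K : Type*} [Field K] (l : K) {g : K[X]} {n : ℕ} (hg : g.natDegree ≤ n) :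
    (mpOp l g).natDegree ≤ n + 1 := by
  rw [mpOp_apply]
  refine (natDegree_add_le _ _).trans (max_le ?_ ?_)
  · refine natDegree_mul_le.trans ?_
    have : (C l * X : K[X]).natDegree ≤ 1 := by compute_degree
    omega
  · rcases Nat.eq_zero_or_pos n with rfl | hn
    · rw [eq_C_of_natDegree_le_zero hg]
      simp
    refine natDegree_mul_le.trans ?_
    have h1 : (C (1 / 2) * (1 + X ^ 2) : K[X]).natDegree ≤ 2 := by compute_degree
    have := natDegree_derivative_le g
    omega

lemma coeff_mpOp {K : Type*} [Field K] (l : K) {g : K[X]} {n : ℕ} (hg : g.natDegree ≤ n) :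
    (mpOp l g).coeff (n + 1) = (l + n / 2) * g.coeff n := by
  have h1 : g.coeff (n + 2) = 0 := coeff_eq_zero_of_natDegree_lt (by omega)
  have e : mpOp l g = C l * (X * g) + C (1 / 2) * derivative g + C (1 / 2) * (X ^ 2 * derivative g) := by
    rw [mpOp_apply]; ring
  rw [e, coeff_add, coeff_add, coeff_C_mul, coeff_C_mul, coeff_C_mul, coeff_X_mul,
    coeff_derivative, h1, coeff_X_pow_mul']
  rcases n with _ | n
  · simp
  · simp [coeff_derivative]
    ring

/-- The factor by which `mpTransform l` multiplies the coefficient of degree `n`. -/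
noncomputable def mpLead {K : Type*} [Field K] (l : K) (n : ℕ) : K :=
  ∏ i ∈ Finset.range n, (l + i / 2)

lemma mpTransform_C {K : Type*} [Field K] (l a : K) : mpTransform l (C a) = C a := by
  have : (C a : K[X]) = a • 1 := by rw [smul_eq_C_mul, mul_one]
  rw [this, map_smul, mpTransform_one]

lemma mpTransform_natDegree_coeff {K : Type*} [Field K] (l : K) (n : ℕ) (P : K[X])
    (hP : P.natDegree ≤ n) : (mpTransform l P).natDegree ≤ n ∧
      (mpTransform l P).coeff n = mpLead l n * P.coeff n := by
  induction n generalizing P with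
  | zero =>
    rw [eq_C_of_natDegree_le_zero hP, mpTransform_C]
    simp [mpLead]
  | succ n ih =>
    have hd : (divX P).natDegree ≤ n := by rw [natDegree_divX_eq_natDegree_tsub_one]; omega
    obtain ⟨h1, h2⟩ := ih _ hd
    have e : mpTransform l P = mpOp l (mpTransform l (divX P)) + C (P.coeff 0) := by
      conv_lhs => rw [← X_mul_divX_add P]
      rw [map_add, mpTransform_X_mul, mpTransform_C]
    rw [e]
    refine ⟨(natDegree_add_le _ _).trans (max_le (natDegree_mpOp_le l h1) (by simp)), ?_⟩
    rw [coeff_add, coeff_mpOp l h1, h2, coeff_divX, coeff_C_succ, mpLead, mpLead,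
      Finset.prod_range_succ]
    ring

lemma mpTransform_injective {K : Type*} [Field K] {l : K} (hl : ∀ n : ℕ, l + n / 2 ≠ 0) :
    Function.Injective (mpTransform l) := by
  rw [injective_iff_map_eq_zero]
  intro P hP
  have h := (mpTransform_natDegree_coeff l P.natDegree P le_rfl).2
  rw [hP, coeff_zero, eq_comm, mul_eq_zero] at h
  exact leadingCoeff_eq_zero.1 (h.resolve_left (Finset.prod_ne_zero_iff.2 fun i _ => hl i))

lemma mpTransform_surjective {K : Type*} [Field K] {l : K} (hl : ∀ n : ℕ, l + n / 2 ≠ 0) :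
    Function.Surjective (mpTransform l) := by
  have key : ∀ n : ℕ, ∀ g : K[X], g.natDegree < n → ∃ P, mpTransform l P = g := by
    intro n
    induction n with
    | zero => intro g hg; omega
    | succ n ih =>
      intro g hg
      have hκ : mpLead l n ≠ 0 := Finset.prod_ne_zero_iff.2 fun i _ => hl i
      obtain ⟨h1, h2⟩ := mpTransform_natDegree_coeff l n (C (g.coeff n / mpLead l n) * X ^ n)
        (natDegree_C_mul_X_pow_le _ _)
      rcases Nat.eq_zero_or_pos n with rfl | hn
      · exact ⟨C (g.coeff 0), by rw [mpTransform_C, ← eq_C_of_natDegree_le_zero (by omega)]⟩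
      obtain ⟨P, hP⟩ := ih (g - mpTransform l (C (g.coeff n / mpLead l n) * X ^ n)) (by
        refine lt_of_le_of_lt (natDegree_le_iff_coeff_eq_zero (n := n - 1).2 fun N hN => ?_) (by omega)
        rw [coeff_sub]
        rcases (show n ≤ N by omega).eq_or_lt with rfl | hN'
        · rw [h2, coeff_C_mul_X_pow, if_pos rfl, mul_div_cancel₀ _ hκ, sub_self]
        · rw [coeff_eq_zero_of_natDegree_lt (by omega),
            coeff_eq_zero_of_natDegree_lt (h1.trans_lt hN'), sub_self])
      exact ⟨P + C (g.coeff n / mpLead l n) * X ^ n, by rw [map_add, hP]; ring⟩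
  intro g
  exact key _ g (Nat.lt_succ_self _)


/-! ### The polynomials with transform `(T - τ)^((k+1)/2) (T + τ)^(k/2)` -/

/-- The polynomial `(T - τ)^((k+1)/2) (T + τ)^(k/2)`. -/
noncomputable def stepBasis {K : Type*} [Field K] (τ : K) (k : ℕ) : K[X] :=
  (X - C τ) ^ ((k + 1) / 2) * (X + C τ) ^ (k / 2)

lemma stepBasis_monic {K : Type*} [Field K] (τ : K) (k : ℕ) : (stepBasis τ k).Monic :=
  ((monic_X_sub_C τ).pow _).mul ((monic_X_add_C τ).pow _)

lemma stepBasis_natDegree {K : Type*} [Field K] (τ : K) (k : ℕ) :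
    (stepBasis τ k).natDegree = k := by
  rw [stepBasis, Monic.natDegree_mul ((monic_X_sub_C τ).pow _) ((monic_X_add_C τ).pow _),
    natDegree_pow, natDegree_pow, natDegree_X_sub_C, natDegree_X_add_C]
  omega

lemma stepBasis_even {K : Type*} [Field K] (τ : K) (m : ℕ) :
    stepBasis τ (2 * m) = (X ^ 2 - C τ ^ 2) ^ m := by
  rw [stepBasis, show (2 * m + 1) / 2 = m by omega, show 2 * m / 2 = m by omega, ← mul_pow]
  ring

lemma stepBasis_odd {K : Type*} [Field K] (τ : K) (m : ℕ) :
    stepBasis τ (2 * m + 1) = (X - C τ) * (X ^ 2 - C τ ^ 2) ^ m := by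
  rw [stepBasis, show (2 * m + 1 + 1) / 2 = m + 1 by omega, show (2 * m + 1) / 2 = m by omega,
    pow_succ', mul_assoc, ← mul_pow]
  ring

/-- The preimage of `stepBasis τ k` under the transform. -/
noncomputable def mpPoly (l τ : ℝ) (k : ℕ) : ℝ[X] :=
  Function.invFun (mpTransform l) (stepBasis τ k)

lemma add_half_ne_zero {lam : ℝ} (hlam : 0 < lam) (n : ℕ) : lam + n / 2 ≠ 0 := by positivity

lemma mpLead_pos {lam : ℝ} (hlam : 0 < lam) (n : ℕ) : 0 < mpLead lam n :=
  Finset.prod_pos fun i _ => by positivity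

lemma mpTransform_mpPoly {lam : ℝ} (hlam : 0 < lam) (τ : ℝ) (k : ℕ) :
    mpTransform lam (mpPoly lam τ k) = stepBasis τ k :=
  Function.invFun_eq (mpTransform_surjective (add_half_ne_zero hlam) _)

lemma natDegree_mpTransform {lam : ℝ} (hlam : 0 < lam) (P : ℝ[X]) :
    (mpTransform lam P).natDegree = P.natDegree := by
  obtain ⟨h1, h2⟩ := mpTransform_natDegree_coeff lam P.natDegree P le_rfl
  rcases eq_or_ne P 0 with rfl | hP
  · simp
  refine le_antisymm h1 (le_natDegree_of_ne_zero ?_)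
  rw [h2]
  exact mul_ne_zero (mpLead_pos hlam _).ne' (leadingCoeff_ne_zero.2 hP)

lemma leadingCoeff_mpTransform {lam : ℝ} (hlam : 0 < lam) (P : ℝ[X]) :
    (mpTransform lam P).leadingCoeff = mpLead lam P.natDegree * P.leadingCoeff := by
  rw [leadingCoeff, natDegree_mpTransform hlam, (mpTransform_natDegree_coeff lam _ P le_rfl).2]
  rfl

lemma mpPoly_natDegree {lam : ℝ} (hlam : 0 < lam) (τ : ℝ) (k : ℕ) :
    (mpPoly lam τ k).natDegree = k := by
  rw [← natDegree_mpTransform hlam, mpTransform_mpPoly hlam, stepBasis_natDegree]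

lemma mpPoly_leadingCoeff {lam : ℝ} (hlam : 0 < lam) (τ : ℝ) (k : ℕ) :
    mpLead lam k * (mpPoly lam τ k).leadingCoeff = 1 := by
  have h := leadingCoeff_mpTransform hlam (mpPoly lam τ k)
  rw [mpTransform_mpPoly hlam, mpPoly_natDegree hlam, (stepBasis_monic τ k).leadingCoeff] at h
  exact h.symm

lemma mpPoly_zero {lam : ℝ} (hlam : 0 < lam) (τ : ℝ) : mpPoly lam τ 0 = 1 := by
  apply mpTransform_injective (add_half_ne_zero hlam)
  rw [mpTransform_mpPoly hlam, mpTransform_one]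
  simp [stepBasis]

lemma isMultipleMP_iff {lam t : ℝ} (hlam : 0 < lam) (ht : |t| < Real.pi / 2)
    (h0 : Real.tan t ≠ 0) (k : ℕ) (P : ℝ[X]) :
    IsMultipleMP lam t (-t) ((k + 1) / 2) (k / 2) P ↔
      P = C (mpLead lam k) * mpPoly lam (Real.tan t) k := by
  have hmon : IsMultipleMP lam t (-t) ((k + 1) / 2) (k / 2) P ↔
      P.Monic ∧ P.natDegree = k ∧ stepBasis (Real.tan t) k ∣ mpTransform lam P := by
    have hdeg : (k + 1) / 2 + k / 2 = k := by omega
    have hdvd : stepBasis (Real.tan t) k ∣ mpTransform lam P ↔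
        (X - C (Real.tan t)) ^ ((k + 1) / 2) ∣ mpTransform lam P ∧
        (X - C (Real.tan (-t))) ^ (k / 2) ∣ mpTransform lam P := by
      rw [Real.tan_neg, C_neg, sub_neg_eq_add, stepBasis]
      refine ⟨fun h => ⟨(dvd_mul_right _ _).trans h, (dvd_mul_left _ _).trans h⟩, fun h => ?_⟩
      refine IsCoprime.mul_dvd (IsCoprime.pow ?_) h.1 h.2
      rw [← sub_neg_eq_add, ← C_neg]
      exact isCoprime_X_sub_C_of_isUnit_sub (by
        rw [isUnit_iff_ne_zero, sub_neg_eq_add, ← two_mul]; positivity)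
    rw [hdvd, ← orthogonal_iff_dvd hlam ht, ← orthogonal_iff_dvd hlam (by rwa [abs_neg])]
    constructor
    · rintro ⟨h1, h2, h3, h4⟩
      exact ⟨h1, h2.trans hdeg, h3, h4⟩
    · rintro ⟨h1, h2, h3, h4⟩
      exact ⟨h1, h2.trans hdeg.symm, h3, h4⟩
  rw [hmon]
  have hκ := (mpLead_pos hlam k).ne'
  constructor
  · rintro ⟨h1, h2, h3⟩
    apply mpTransform_injective (add_half_ne_zero hlam)
    rw [← smul_eq_C_mul, map_smul, mpTransform_mpPoly hlam, smul_eq_C_mul]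
    have h4 := eq_leadingCoeff_mul_of_monic_of_dvd_of_natDegree_le (stepBasis_monic _ k) h3
      (by rw [natDegree_mpTransform hlam, h2, stepBasis_natDegree])
    rw [h4, leadingCoeff_mpTransform hlam, h2, h1.leadingCoeff, mul_one]
  · rintro rfl
    refine ⟨?_, ?_, ?_⟩
    · rw [Monic, leadingCoeff_mul, leadingCoeff_C, mpPoly_leadingCoeff hlam]
    · rw [natDegree_C_mul hκ, mpPoly_natDegree hlam]
    · rw [← smul_eq_C_mul, map_smul, mpTransform_mpPoly hlam, smul_eq_C_mul]
      exact dvd_mul_left _ _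

lemma stepMP_eq {lam t : ℝ} (hlam : 0 < lam) (ht : |t| < Real.pi / 2)
    (h0 : Real.tan t ≠ 0) (k : ℕ) :
    stepMP lam t (-t) k = C (mpLead lam k) * mpPoly lam (Real.tan t) k := by
  have hex : ∃ P, IsMultipleMP lam t (-t) ((k + 1) / 2) (k / 2) P :=
    ⟨_, (isMultipleMP_iff hlam ht h0 k _).2 rfl⟩
  rw [stepMP, multipleMP, dif_pos hex]
  exact (isMultipleMP_iff hlam ht h0 k _).1 hex.choose_spec

lemma existsUnique_multipleMP {lam t : ℝ} (hlam : 0 < lam) (ht : |t| < Real.pi / 2)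
    (h0 : Real.tan t ≠ 0) (k : ℕ) :
    ∃! P, IsMultipleMP lam t (-t) ((k + 1) / 2) (k / 2) P :=
  ⟨_, (isMultipleMP_iff hlam ht h0 k _).2 rfl, fun P hP => (isMultipleMP_iff hlam ht h0 k P).1 hP⟩

/-! ### The four-term recurrence -/

/-- The recurrence coefficients of `mpPoly`. -/
noncomputable def recA (lam : ℝ) (k : ℤ) : ℝ := lam + k / 2

noncomputable def recB (lam τ : ℝ) (k : ℤ) : ℝ := τ * ((-1) ^ k * (lam + k / 2 - 1 / 4) + 1 / 4)

noncomputable def recC (τ : ℝ) (k : ℤ) : ℝ := (1 + τ ^ 2) * k / 2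

noncomputable def recD (τ : ℝ) (k : ℤ) : ℝ :=
  τ * (1 + τ ^ 2) * ((-1) ^ k * (k / 2 - 1 / 4) + 1 / 4)

lemma mpOp_stepBasis (lam τ : ℝ) (k : ℕ) :
    mpOp lam (stepBasis τ k) = C (recA lam k) * stepBasis τ (k + 1) +
      C (recB lam τ k) * stepBasis τ k + C (recC τ k) * stepBasis τ (k - 1) +
      C (recD τ k) * stepBasis τ (k - 2) := by
  have hder : ∀ m : ℕ, derivative ((X ^ 2 - C τ ^ 2 : ℝ[X]) ^ (m + 1)) =
      C (2 * (m + 1 : ℝ)) * X * (X ^ 2 - C τ ^ 2) ^ m := fun m => by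
    rw [derivative_pow_succ, ← C_pow, derivative_sub, derivative_X_pow, derivative_C]
    simp only [map_mul, map_add, map_natCast, map_one, Nat.cast_ofNat]
    simp
    ring
  have half : (C (1 / 2) * 2 : ℝ[X]) = 1 := by
    rw [show (2 : ℝ[X]) = C 2 from (map_ofNat C 2).symm, ← C_mul]; norm_num
  have quarter : (C (1 / 4) * 4 : ℝ[X]) = 1 := by
    rw [show (4 : ℝ[X]) = C 4 from (map_ofNat C 4).symm, ← C_mul]; norm_num
  obtain ⟨m, rfl | rfl⟩ := Nat.even_or_odd' k
  · rcases m with _ | m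
    · simp [mpOp_apply, stepBasis, recA, recB, recC, recD]
      ring
    · have e1 : recB lam τ ((2 * (m + 1) : ℕ) : ℤ) = τ * (lam + (m + 1)) := by
        rw [recB, zpow_natCast, pow_mul]; push_cast; ring
      have e2 : recD τ ((2 * (m + 1) : ℕ) : ℤ) = τ * (1 + τ ^ 2) * (m + 1) := by
        rw [recD, zpow_natCast, pow_mul]; push_cast; ring
      have e3 : recA lam ((2 * (m + 1) : ℕ) : ℤ) = lam + (m + 1) := by
        rw [recA]; push_cast; ring
      have e4 : recC τ ((2 * (m + 1) : ℕ) : ℤ) = (1 + τ ^ 2) * (m + 1) := by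
        rw [recC]; push_cast; ring
      rw [e1, e2, e3, e4, show 2 * (m + 1) - 1 = 2 * m + 1 by omega,
        show 2 * (m + 1) - 2 = 2 * m by omega, mpOp_apply, stepBasis_odd, stepBasis_odd,
        stepBasis_even, stepBasis_even, hder, pow_succ]
      simp only [map_mul, map_add, map_one, map_pow, map_ofNat]
      linear_combination (1 + X ^ 2) * (C (m : ℝ) + 1) * X * (X ^ 2 - C τ ^ 2) ^ m * half
  · have s : (-1 : ℝ) ^ (2 * m + 1) = -1 := by rw [pow_succ, pow_mul]; norm_num
    have e1 : recB lam τ ((2 * m + 1 : ℕ) : ℤ) = - (τ * (lam + m)) := by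
      rw [recB, zpow_natCast, s]; push_cast; ring
    have e2 : recD τ ((2 * m + 1 : ℕ) : ℤ) = -(τ * (1 + τ ^ 2) * m) := by
      rw [recD, zpow_natCast, s]; push_cast; ring
    have e3 : recA lam ((2 * m + 1 : ℕ) : ℤ) = lam + m + 1 / 2 := by
      rw [recA]; push_cast; ring
    have e4 : recC τ ((2 * m + 1 : ℕ) : ℤ) = (1 + τ ^ 2) * (m + 1 / 2) := by
      rw [recC]; push_cast; ring
    rw [e1, e2, e3, e4, show 2 * m + 1 - 1 = 2 * m by omega, mpOp_apply,
      show 2 * m + 1 + 1 = 2 * (m + 1) by ring, stepBasis_odd, stepBasis_even, stepBasis_even,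
      derivative_mul, derivative_X_sub_C]
    rcases m with _ | m
    · simp only [map_mul, map_add, map_one, map_pow, map_neg, map_natCast]
      simp
      linear_combination 0 * half
    · rw [hder, show 2 * (m + 1) + 1 - 2 = 2 * m + 1 by omega, stepBasis_odd, pow_succ, pow_succ]
      simp only [map_mul, map_add, map_one, map_pow, map_ofNat, map_neg, Nat.cast_add, Nat.cast_one]
      linear_combination (1 + X ^ 2) * (C (m : ℝ) + 1) * X * (X - C τ) * (X ^ 2 - C τ ^ 2) ^ m * half

lemma X_mul_mpPoly {lam : ℝ} (hlam : 0 < lam) (τ : ℝ) (k : ℕ) :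
    X * mpPoly lam τ k = C (recA lam k) * mpPoly lam τ (k + 1) +
      C (recB lam τ k) * mpPoly lam τ k + C (recC τ k) * mpPoly lam τ (k - 1) +
      C (recD τ k) * mpPoly lam τ (k - 2) := by
  apply mpTransform_injective (add_half_ne_zero hlam)
  rw [mpTransform_X_mul]
  simp only [← smul_eq_C_mul, map_add, map_smul, mpTransform_mpPoly hlam]
  simp only [smul_eq_C_mul]
  exact mpOp_stepBasis lam τ k

/-! ### Real and simple zeros -/

lemma norm_sub_I_half_le {y r : ℂ} (hr : r.im = 0) (hy : 0 ≤ y.im) :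
    ‖y - Complex.I / 2 - r‖ ≤ ‖y + Complex.I / 2 - r‖ := by
  rw [Complex.norm_def, Complex.norm_def]
  apply Real.sqrt_le_sqrt
  simp only [Complex.normSq_apply, Complex.sub_re, Complex.sub_im, Complex.add_re, Complex.add_im,
    hr]
  norm_num
  nlinarith

lemma multiset_prod_le {α : Type*} (s : Multiset α) (f g : α → ℝ)
    (h : ∀ a ∈ s, 0 ≤ f a ∧ f a ≤ g a) : (s.map f).prod ≤ (s.map g).prod := by
  induction s using Multiset.induction_on with
  | empty => simp
  | cons a s ih =>
    rw [Multiset.map_cons, Multiset.map_cons, Multiset.prod_cons, Multiset.prod_cons]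
    have ha := h a (Multiset.mem_cons_self a s)
    refine mul_le_mul ha.2 (ih fun b hb => h b (Multiset.mem_cons_of_mem hb)) ?_
      (ha.1.trans ha.2)
    refine Multiset.prod_nonneg fun x hx => ?_
    obtain ⟨b, hb, rfl⟩ := Multiset.mem_map.1 hx
    exact (h b (Multiset.mem_cons_of_mem hb)).1

lemma norm_eval_le_of_roots (P : ℂ[X]) (y w : ℂ)
    (h : ∀ r ∈ P.roots, ‖y - r‖ ≤ ‖w - r‖) : ‖P.eval y‖ ≤ ‖P.eval w‖ := by
  rw [(IsAlgClosed.splits P).eval_eq_prod_roots, (IsAlgClosed.splits P).eval_eq_prod_roots,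
    norm_mul, norm_mul]
  refine mul_le_mul_of_nonneg_left ?_ (norm_nonneg _)
  have e : ∀ s : Multiset ℂ, ‖s.prod‖ = (s.map fun z => ‖z‖).prod := fun s =>
    map_multiset_prod (normHom : ℂ →*₀ ℝ) s
  rw [e, e, Multiset.map_map, Multiset.map_map]
  exact multiset_prod_le _ _ _ fun r hr => ⟨norm_nonneg _, h r hr⟩

lemma im_sum_nonneg (s : Multiset ℂ) (f : ℂ → ℂ) (h : ∀ r ∈ s, 0 ≤ (f r).im) :
    0 ≤ (s.map f).sum.im := by
  have : (s.map f).sum.im = (s.map fun r => (f r).im).sum := by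
    have := map_multiset_sum Complex.imCLM (s.map f)
    rwa [Multiset.map_map] at this
  rw [this]
  refine Multiset.sum_nonneg fun x hx => ?_
  obtain ⟨r, hr, rfl⟩ := Multiset.mem_map.1 hx
  exact h r hr

lemma mpTransform_C_mul {K : Type*} [Field K] (l a : K) (P : K[X]) :
    mpTransform l (C a * P) = C a * mpTransform l P := by
  rw [← smul_eq_C_mul, ← smul_eq_C_mul, map_smul]

/-- The raising operator: it multiplies the transform by `l (T - θ)` and lowers the parameter. -/
noncomputable def raise (l θ : ℂ) (P : ℂ[X]) : ℂ[X] :=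
  C ((-θ - Complex.I) / 2) * ((C l + C Complex.I * X) * P.comp (X - C (Complex.I / 2))) +
    C ((-θ + Complex.I) / 2) * ((C l - C Complex.I * X) * P.comp (X + C (Complex.I / 2)))

lemma mpTransform_shift (l ε : ℂ) (hε : ε ^ 2 = -1) (P : ℂ[X]) :
    mpTransform l ((C l + C ε * X) * P.comp (X - C (ε / 2))) =
      C l * ((1 + C ε * X) * mpTransform (l + 1 / 2) P) := by
  induction P using Polynomial.induction_on' with
  | add p q hp hq =>
    rw [add_comp, mul_add, map_add, hp, hq, map_add]; ring
  | monomial n a =>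
    have e : (monomial n a : ℂ[X]) = a • X ^ n := by rw [smul_X_eq_monomial]
    have e2 : (C l + C ε * X) * (a • X ^ n : ℂ[X]).comp (X - C (ε / 2)) =
      a • ((C l + C ε * X) * (X ^ n : ℂ[X]).comp (X - C (ε / 2))) := by
      rw [smul_comp, mul_smul_comm]
    rw [e, e2, map_smul, map_smul, mul_smul_comm, mul_smul_comm]
    congr 1
    clear e e2
    induction n with
    | zero =>
      have e3 : (C l + C ε * X : ℂ[X]) = l • 1 + ε • (X * 1) := by
        rw [smul_eq_C_mul, smul_eq_C_mul]; ring
      rw [pow_zero, one_comp, mul_one, mpTransform_one, e3, map_add, map_smul, map_smul,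
        mpTransform_X_mul, mpTransform_one, mpOp_apply, smul_eq_C_mul, smul_eq_C_mul]
      simp
      ring
    | succ n ih =>
      have e3 : (C l + C ε * X) * (X ^ (n + 1) : ℂ[X]).comp (X - C (ε / 2)) =
          X * ((C l + C ε * X) * (X ^ n : ℂ[X]).comp (X - C (ε / 2))) -
          (ε / 2) • ((C l + C ε * X) * (X ^ n : ℂ[X]).comp (X - C (ε / 2))) := by
        rw [smul_eq_C_mul, X_pow_comp, X_pow_comp]; ring
      rw [e3, map_sub, map_smul, mpTransform_X_mul, ih, mpTransform_X_pow_succ, smul_eq_C_mul,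
        mpOp_apply, mpOp_apply]
      simp only [derivative_mul, derivative_C, derivative_add, derivative_one, derivative_X]
      have h1 : (C ε : ℂ[X]) = 2 * C (ε / 2) := by
        rw [show (2 : ℂ[X]) = C 2 from (map_ofNat C 2).symm, ← C_mul]; congr 1; ring
      have h2 : (C (ε / 2) ^ 2 * 4 : ℂ[X]) = -1 := by
        rw [show (4 : ℂ[X]) = C 4 from (map_ofNat C 4).symm, ← C_pow, ← C_mul, ← C_1, ← C_neg]
        congr 1; linear_combination hε
      have h3 : (C (1 / 2) * 2 : ℂ[X]) = 1 := by
        rw [show (2 : ℂ[X]) = C 2 from (map_ofNat C 2).symm, ← C_mul]; norm_num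
      rw [C_add, h1]
      set g := mpTransform (l + 1 / 2) (X ^ n : ℂ[X])
      linear_combination (-C (1 / 2) * X * g * C l) * h2 +
        (C l * (C (ε / 2) * g + 2 * C (ε / 2) ^ 2 * X * g)) * h3

lemma mpTransform_raise (l θ : ℂ) (P : ℂ[X]) :
    mpTransform l (raise l θ P) = C l * ((X - C θ) * mpTransform (l + 1 / 2) P) := by
  have h1 := mpTransform_shift l Complex.I Complex.I_sq P
  have h2 := mpTransform_shift l (-Complex.I) (by rw [neg_sq, Complex.I_sq]) P
  have e : (C l - C Complex.I * X) * P.comp (X + C (Complex.I / 2)) =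
      (C l + C (-Complex.I) * X) * P.comp (X - C (-Complex.I / 2)) := by
    rw [neg_div, C_neg, C_neg]; ring_nf
  rw [raise, e, map_add, mpTransform_C_mul, mpTransform_C_mul, h1, h2]
  have e1 : (C ((-θ - Complex.I) / 2) + C ((-θ + Complex.I) / 2) : ℂ[X]) = - C θ := by
    rw [← C_add, ← C_neg]; congr 1; ring
  have e2 : ((C ((-θ - Complex.I) / 2) - C ((-θ + Complex.I) / 2)) * C Complex.I : ℂ[X]) = 1 := by
    rw [← C_sub, ← C_mul, ← C_1]; congr 1; ring_nf; rw [Complex.I_sq]; ring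
  rw [C_neg]
  linear_combination (C l * mpTransform (l + 1 / 2) P) * e1 +
    (C l * X * mpTransform (l + 1 / 2) P) * e2

/-- All complex zeros are real and simple. -/
def HasRealSimpleZeros (P : ℂ[X]) : Prop :=
  ∀ z, P.eval z = 0 → z.im = 0 ∧ P.derivative.eval z ≠ 0

lemma norm_raise_const (θ : ℝ) :
    ‖(-(θ : ℂ) - Complex.I) / 2‖ = ‖(-(θ : ℂ) + Complex.I) / 2‖ := by
  rw [norm_div, norm_div]
  congr 1
  rw [Complex.norm_def, Complex.norm_def]
  simp [Complex.normSq_apply]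

lemma raise_const_ne_zero (θ : ℝ) : (-(θ : ℂ) - Complex.I) / 2 ≠ 0 := by
  intro h
  have := congrArg Complex.im h
  simp at this

lemma norm_lam_add_lt {lam : ℝ} (hlam : 0 < lam) {y : ℂ} (hy : 0 < y.im) :
    ‖(lam : ℂ) + Complex.I * y‖ < ‖(lam : ℂ) - Complex.I * y‖ := by
  rw [Complex.norm_def, Complex.norm_def]
  apply Real.sqrt_lt_sqrt (Complex.normSq_nonneg _)
  simp [Complex.normSq_apply]
  nlinarith [mul_pos hlam hy]

lemma raise_eval (l θ y : ℂ) (P : ℂ[X]) : (raise l θ P).eval y =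
    (-θ - Complex.I) / 2 * ((l + Complex.I * y) * P.eval (y - Complex.I / 2)) +
    (-θ + Complex.I) / 2 * ((l - Complex.I * y) * P.eval (y + Complex.I / 2)) := by
  simp [raise, eval_comp]

lemma raise_derivative_eval (l θ y : ℂ) (P : ℂ[X]) : (raise l θ P).derivative.eval y =
    (-θ - Complex.I) / 2 * (Complex.I * P.eval (y - Complex.I / 2) +
      (l + Complex.I * y) * P.derivative.eval (y - Complex.I / 2)) +
    (-θ + Complex.I) / 2 * (-Complex.I * P.eval (y + Complex.I / 2) +
      (l - Complex.I * y) * P.derivative.eval (y + Complex.I / 2)) := by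
  simp [raise, eval_comp, derivative_comp]

lemma raise_im_eq_zero {lam : ℝ} (hlam : 0 < lam) (θ : ℝ) {P : ℂ[X]}
    (hroots : ∀ z, P.eval z = 0 → z.im = 0) {y : ℂ}
    (hy : (raise lam θ P).eval y = 0) : y.im = 0 := by
  have hroots' : ∀ r ∈ P.roots, r.im = 0 := fun r hr => hroots r (isRoot_of_mem_roots hr)
  rw [raise_eval] at hy
  have hnorm := congrArg norm (eq_neg_of_add_eq_zero_left hy)
  rw [norm_neg, norm_mul, norm_mul, norm_mul, norm_mul, norm_raise_const] at hnorm
  have hA : 0 < ‖(-(θ : ℂ) + Complex.I) / 2‖ := by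
    rw [← norm_raise_const, norm_pos_iff]; exact raise_const_ne_zero θ
  have hnorm := mul_left_cancel₀ hA.ne' hnorm
  rcases lt_trichotomy y.im 0 with him | him | him
  · exfalso
    have h1 : ‖P.eval (y + Complex.I / 2)‖ ≤ ‖P.eval (y - Complex.I / 2)‖ := by
      refine norm_eval_le_of_roots P _ _ fun r hr => ?_
      have := norm_sub_I_half_le (y := -y) (r := -r) (by simp [hroots' r hr]) (by simp; linarith)
      rw [show -y - Complex.I / 2 - -r = -(y + Complex.I / 2 - r) by ring,
        show -y + Complex.I / 2 - -r = -(y - Complex.I / 2 - r) by ring, norm_neg, norm_neg] at this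
      exact this
    have h2 := norm_lam_add_lt hlam (y := -y) (by simpa using him)
    rw [mul_neg, sub_neg_eq_add, ← sub_eq_add_neg] at h2
    have h3 : 0 < ‖P.eval (y - Complex.I / 2)‖ := by
      rw [norm_pos_iff]
      intro h
      have := hroots _ h
      simp at this
      linarith
    nlinarith [norm_nonneg ((lam : ℂ) - Complex.I * y)]
  · exact him
  · exfalso
    have h1 : ‖P.eval (y - Complex.I / 2)‖ ≤ ‖P.eval (y + Complex.I / 2)‖ :=
      norm_eval_le_of_roots P _ _ fun r hr => norm_sub_I_half_le (hroots' r hr) him.le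
    have h2 := norm_lam_add_lt hlam him
    have h3 : 0 < ‖P.eval (y + Complex.I / 2)‖ := by
      rw [norm_pos_iff]
      intro h
      have := hroots _ h
      simp at this
      linarith
    nlinarith [norm_nonneg ((lam : ℂ) + Complex.I * y)]

lemma raise_hasRealSimpleZeros {lam : ℝ} (hlam : 0 < lam) (θ : ℝ) {P : ℂ[X]}
    (hroots : ∀ z, P.eval z = 0 → z.im = 0) : HasRealSimpleZeros (raise lam θ P) := by
  intro y hy
  have him := raise_im_eq_zero hlam θ hroots hy
  refine ⟨him, fun hd => ?_⟩
  have hroots' : ∀ r ∈ P.roots, r.im = 0 := fun r hr => hroots r (isRoot_of_mem_roots hr)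
  rw [raise_eval] at hy
  rw [raise_derivative_eval] at hd
  have hm : P.eval (y - Complex.I / 2) ≠ 0 := fun h => by
    have := hroots _ h
    simp [him] at this
  have hp : P.eval (y + Complex.I / 2) ≠ 0 := fun h => by
    have := hroots _ h
    simp [him] at this
  have dm := (IsAlgClosed.splits P).eval_derivative_eq_eval_mul_sum hm
  have dp := (IsAlgClosed.splits P).eval_derivative_eq_eval_mul_sum hp
  rw [dm, dp] at hd
  set Sm := (P.roots.map fun z => 1 / (y - Complex.I / 2 - z)).sum with hSm
  set Sp := (P.roots.map fun z => 1 / (y + Complex.I / 2 - z)).sum with hSp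
  have hl1 : (lam : ℂ) + Complex.I * y ≠ 0 := fun h => by
    have := congrArg Complex.re h
    simp [him] at this
    linarith
  have hl2 : (lam : ℂ) - Complex.I * y ≠ 0 := fun h => by
    have := congrArg Complex.re h
    simp [him] at this
    linarith
  have key : Complex.I / (lam + Complex.I * y) + Sm = -Complex.I / (lam - Complex.I * y) + Sp := by
    have hB : (-(θ : ℂ) - Complex.I) / 2 * ((lam + Complex.I * y) * P.eval (y - Complex.I / 2)) ≠ 0 :=
      mul_ne_zero (raise_const_ne_zero θ) (mul_ne_zero hl1 hm)
    have e1 : Complex.I = Complex.I / (lam + Complex.I * y) * (lam + Complex.I * y) := by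
      field_simp
    have e2 : -Complex.I = -Complex.I / (lam - Complex.I * y) * (lam - Complex.I * y) := by
      field_simp
    apply mul_left_cancel₀ hB
    linear_combination hd - (-(θ : ℂ) - Complex.I) / 2 * P.eval (y - Complex.I / 2) * e1
      - (-(θ : ℂ) + Complex.I) / 2 * P.eval (y + Complex.I / 2) * e2
      - (-Complex.I / (lam - Complex.I * y) + Sp) * hy
  have him' := congrArg Complex.im key
  have h1 : 0 ≤ Sm.im := im_sum_nonneg _ _ fun r hr => by
    rw [one_div, Complex.inv_im]
    apply div_nonneg _ (Complex.normSq_nonneg _)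
    simp [him, hroots' r hr]
  have h2 : 0 ≤ (-Sp).im := by
    rw [show -Sp = (P.roots.map fun z => -(1 / (y + Complex.I / 2 - z))).sum by
      rw [Multiset.sum_map_neg]]
    refine im_sum_nonneg _ _ fun r hr => ?_
    rw [one_div, Complex.neg_im, Complex.inv_im, neg_div, neg_neg]
    apply div_nonneg _ (Complex.normSq_nonneg _)
    simp [him, hroots' r hr]
  have h3 : 0 < (Complex.I / (lam + Complex.I * y)).im := by
    rw [Complex.div_im]
    have := Complex.normSq_pos.2 hl1
    simp [him]
    positivity
  have h4 : 0 < (Complex.I / (lam - Complex.I * y)).im := by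
    rw [Complex.div_im]
    have := Complex.normSq_pos.2 hl2
    simp [him]
    positivity
  rw [Complex.add_im, Complex.add_im, neg_div, Complex.neg_im] at him'
  rw [Complex.neg_im] at h2
  linarith

lemma map_mpTransform (lam : ℝ) (P : ℝ[X]) : (mpTransform lam P).map Complex.ofRealHom =
    mpTransform (lam : ℂ) (P.map Complex.ofRealHom) := by
  induction P using Polynomial.induction_on' with
  | add p q hp hq => simp [hp, hq]
  | monomial n a =>
    have e : (monomial n a : ℝ[X]) = C a * X ^ n := by rw [C_mul_X_pow_eq_monomial]
    rw [e, Polynomial.map_mul, map_C, ← smul_eq_C_mul, ← smul_eq_C_mul, map_smul, map_smul,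
      smul_eq_C_mul, smul_eq_C_mul, Polynomial.map_mul, map_C]
    congr 1
    clear e
    induction n with
    | zero => simp
    | succ n ih =>
      rw [mpTransform_X_pow_succ, Polynomial.map_pow, map_X, mpTransform_X_pow_succ]
      rw [Polynomial.map_pow, map_X] at ih
      rw [← ih, mpOp_apply, mpOp_apply]
      simp [derivative_map]

lemma stepBasis_succ (τ : ℂ) (k : ℕ) : ∃ θ : ℂ, (θ = τ ∨ θ = -τ) ∧
    stepBasis τ (k + 1) = (X - C θ) * stepBasis τ k := by
  obtain ⟨m, rfl | rfl⟩ := Nat.even_or_odd' k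
  · exact ⟨τ, Or.inl rfl, by rw [stepBasis_odd, stepBasis_even]⟩
  · refine ⟨-τ, Or.inr rfl, ?_⟩
    rw [show 2 * m + 1 + 1 = 2 * (m + 1) by ring, stepBasis_odd, stepBasis_even, C_neg]
    ring

lemma mpPoly_hasRealSimpleZeros (τ : ℝ) (k : ℕ) : ∀ lam : ℝ, 0 < lam →
    HasRealSimpleZeros ((mpPoly lam τ k).map Complex.ofRealHom) := by
  induction k with
  | zero =>
    intro lam hlam z hz
    simp [mpPoly_zero hlam] at hz
  | succ k ih =>
    intro lam hlam
    have hlam' : 0 < lam + 1 / 2 := by linarith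
    have hne : ∀ n : ℕ, (lam : ℂ) + n / 2 ≠ 0 := fun n => by
      intro h
      have h2 : ((lam + n / 2 : ℝ) : ℂ) = 0 := by push_cast; exact h
      exact add_half_ne_zero hlam n (by exact_mod_cast h2)
    have hT : ∀ (l : ℝ) (_ : 0 < l) (k : ℕ), mpTransform (l : ℂ)
        ((mpPoly l τ k).map Complex.ofRealHom) = stepBasis (τ : ℂ) k := fun l hl k => by
      rw [← map_mpTransform, mpTransform_mpPoly hl]
      simp [stepBasis]
    obtain ⟨θ, hθ, hs⟩ := stepBasis_succ (τ : ℂ) k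
    obtain ⟨θ, rfl⟩ : ∃ θ' : ℝ, θ = θ' := by
      rcases hθ with rfl | rfl
      · exact ⟨τ, rfl⟩
      · exact ⟨-τ, by simp⟩
    have hlc : (lam : ℂ) ≠ 0 := by exact_mod_cast hlam.ne'
    have e : C (lam : ℂ) * (mpPoly lam τ (k + 1)).map Complex.ofRealHom =
        raise lam θ ((mpPoly (lam + 1 / 2) τ k).map Complex.ofRealHom) := by
      apply mpTransform_injective hne
      have h := hT (lam + 1 / 2) hlam' k
      push_cast at h
      rw [mpTransform_raise, h, ← smul_eq_C_mul, map_smul, hT lam hlam, smul_eq_C_mul, hs]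
    have hr := raise_hasRealSimpleZeros hlam θ fun z hz => (ih _ hlam' z hz).1
    rw [← e] at hr
    intro z hz
    have := hr z (by rw [eval_mul, hz, mul_zero])
    refine ⟨this.1, fun h => this.2 ?_⟩
    rw [derivative_mul, derivative_C, zero_mul, zero_add, eval_mul, h, mul_zero]

lemma roots_card_nodup_of_hasRealSimpleZeros {P : ℝ[X]} (hP : P ≠ 0)
    (h : HasRealSimpleZeros (P.map Complex.ofRealHom)) :
    P.roots.card = P.natDegree ∧ P.roots.Nodup := by
  have hs : P.Splits := by
    refine Splits.of_splits_map Complex.ofRealHom (IsAlgClosed.splits _) fun a ha => ?_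
    exact ⟨a.re, Complex.ext (by simp) (by simp [(h a (isRoot_of_mem_roots ha)).1])⟩
  refine ⟨hs.natDegree_eq_card_roots.symm, Multiset.nodup_iff_count_le_one.2 fun a => ?_⟩
  rw [count_roots]
  by_contra! hc
  have hroot : P.IsRoot a := (rootMultiplicity_pos hP).1 (by omega)
  have hd : P.derivative.IsRoot a := ((one_lt_rootMultiplicity_iff_isRoot hP).1 hc).2
  refine (h a ?_).2 ?_
  · have := eval_map_apply (f := Complex.ofRealHom) (p := P) a
    simpa [hroot.eq_zero] using this
  · have := eval_map_apply (f := Complex.ofRealHom) (p := P.derivative) a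
    rw [derivative_map]
    simpa [hd.eq_zero] using this

lemma mpPoly_ne_zero {lam : ℝ} (hlam : 0 < lam) (τ : ℝ) (k : ℕ) : mpPoly lam τ k ≠ 0 := by
  intro h
  have := mpPoly_leadingCoeff hlam τ k
  simp [h] at this

lemma mpPoly_roots {lam : ℝ} (hlam : 0 < lam) (τ : ℝ) (k : ℕ) :
    (mpPoly lam τ k).roots.card = k ∧ (mpPoly lam τ k).roots.Nodup := by
  have := roots_card_nodup_of_hasRealSimpleZeros (mpPoly_ne_zero hlam τ k)
    (mpPoly_hasRealSimpleZeros τ k lam hlam)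
  rwa [mpPoly_natDegree hlam] at this

lemma scaledMP_roots {lam t : ℝ} (hlam : 0 < lam) (ht : |t| < Real.pi / 2)
    (h0 : Real.tan t ≠ 0) {n : ℕ} (hn : n ≠ 0) :
    (scaledMP lam t (-t) n n).roots =
      (mpPoly lam (Real.tan t) n).roots.map fun x : ℝ => x / (n : ℝ) := by
  have hn' : (n : ℝ) ≠ 0 := by exact_mod_cast hn
  have hu : IsUnit (n : ℝ) := isUnit_iff_ne_zero.2 hn'
  rw [scaledMP, stepMP_eq hlam ht h0, mul_comp, C_comp, roots_C_mul _ (by positivity),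
    roots_C_mul _ (mpLead_pos hlam n).ne']
  have h := roots_comp_C_mul_X_add_C (mpPoly lam (Real.tan t) n) (n : ℝ) 0 hu
  rw [C_0, add_zero] at h
  rw [h]
  refine Multiset.map_congr rfl fun x _ => ?_
  rw [Ring.inverse_eq_inv', sub_zero, div_eq_inv_mul]

/-! ### The recurrence matrix and its powers -/

/-- The entries of the recurrence matrix. -/
noncomputable def recEntry (lam τ : ℝ) (k l : ℤ) : ℝ :=
  (if k = l + 1 then recA lam l else 0) + (if k = l then recB lam τ l else 0) +
    (if k = l - 1 then recC τ l else 0) + (if k = l - 2 then recD τ l else 0)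

/-- The finite section of the recurrence matrix. -/
noncomputable def recMatrix (lam τ : ℝ) (n : ℕ) : Matrix (Fin n) (Fin n) ℝ :=
  fun k l => recEntry lam τ (k : ℕ) (l : ℕ)

lemma sum_fin_ite_mul (n : ℕ) (j : ℤ) (f g : ℤ → ℝ)
    (h : ¬ (0 ≤ j ∧ j < n) → g j * f j = 0) :
    ∑ k : Fin n, (if ((k : ℕ) : ℤ) = j then g (k : ℕ) else 0) * f (k : ℕ) = g j * f j := by
  by_cases hj : 0 ≤ j ∧ j < n
  · obtain ⟨i, rfl⟩ := Int.eq_ofNat_of_zero_le hj.1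
    have hi : i < n := by exact_mod_cast hj.2
    rw [Finset.sum_eq_single (⟨i, hi⟩ : Fin n)]
    · simp
    · intro b _ hb
      rw [if_neg, zero_mul]
      intro e
      exact hb (Fin.ext (by exact_mod_cast e))
    · simp
  · rw [h hj]
    refine Finset.sum_eq_zero fun k _ => ?_
    rw [if_neg, zero_mul]
    rintro rfl
    exact hj ⟨by positivity, by exact_mod_cast k.2⟩

lemma recC_zero (τ : ℝ) : recC τ 0 = 0 := by simp [recC]

lemma recD_zero (τ : ℝ) : recD τ 0 = 0 := by simp [recD]

lemma recD_one (τ : ℝ) : recD τ 1 = 0 := by simp [recD]; norm_num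

/-- The coefficients of the powers of the infinite recurrence matrix. -/
noncomputable def pathCoeff (lam τ : ℝ) : ℕ → ℤ → ℤ → ℝ
  | 0, i, k => if k = i then 1 else 0
  | m + 1, i, k => recA lam (k - 1) * pathCoeff lam τ m i (k - 1) +
      recB lam τ k * pathCoeff lam τ m i k + recC τ (k + 1) * pathCoeff lam τ m i (k + 1) +
      recD τ (k + 2) * pathCoeff lam τ m i (k + 2)

lemma pathCoeff_eq_zero_of_lt (lam τ : ℝ) (m : ℕ) {i k : ℤ} (h : i + m < k) :
    pathCoeff lam τ m i k = 0 := by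
  induction m generalizing k with
  | zero => rw [pathCoeff, if_neg]; push_cast at h; omega
  | succ m ih =>
    push_cast at h
    rw [pathCoeff, ih (by omega), ih (by omega), ih (by omega), ih (by omega)]
    simp

lemma pathCoeff_eq_zero_of_neg (lam τ : ℝ) (m : ℕ) {i k : ℤ} (hi : 0 ≤ i) (h : k < 0) :
    pathCoeff lam τ m i k = 0 := by
  induction m generalizing k with
  | zero => rw [pathCoeff, if_neg]; omega
  | succ m ih =>
    rw [pathCoeff, ih (by omega), ih h]
    have h1 : recC τ (k + 1) * pathCoeff lam τ m i (k + 1) = 0 := by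
      rcases (show k + 1 < 0 ∨ k + 1 = 0 by omega) with h | h
      · rw [ih h, mul_zero]
      · rw [h, recC_zero, zero_mul]
    have h2 : recD τ (k + 2) * pathCoeff lam τ m i (k + 2) = 0 := by
      rcases (show k + 2 < 0 ∨ k + 2 = 0 ∨ k + 2 = 1 by omega) with h | h | h
      · rw [ih h, mul_zero]
      · rw [h, recD_zero, zero_mul]
      · rw [h, recD_one, zero_mul]
    rw [h1, h2]
    simp

lemma recMatrix_pow_eq_pathCoeff (lam τ : ℝ) (n m : ℕ) (k i : Fin n) (h : (i : ℕ) + m < n) :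
    (recMatrix lam τ n ^ m) k i = pathCoeff lam τ m (i : ℕ) (k : ℕ) := by
  induction m generalizing k with
  | zero =>
    rw [pow_zero, Matrix.one_apply, pathCoeff]
    congr 1
    simp [Fin.ext_iff]
  | succ m ih =>
    have hf : ∀ (j : ℤ) (g : ℤ → ℝ), ¬ (0 ≤ j ∧ j < n) →
        g j * pathCoeff lam τ m (i : ℕ) j = 0 := fun j g hj => by
      rcases lt_or_ge j 0 with h0 | h0
      · rw [pathCoeff_eq_zero_of_neg lam τ m (by positivity) h0, mul_zero]
      · rw [pathCoeff_eq_zero_of_lt lam τ m (by omega), mul_zero]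
    rw [pow_succ', Matrix.mul_apply]
    simp_rw [ih _ (by omega)]
    have e : ∀ l : Fin n, recMatrix lam τ n k l * pathCoeff lam τ m (i : ℕ) (l : ℕ) =
        (if ((l : ℕ) : ℤ) = (k : ℕ) - 1 then recA lam (l : ℕ) else 0) * pathCoeff lam τ m (i : ℕ) (l : ℕ) +
        (if ((l : ℕ) : ℤ) = (k : ℕ) then recB lam τ (l : ℕ) else 0) * pathCoeff lam τ m (i : ℕ) (l : ℕ) +
        (if ((l : ℕ) : ℤ) = (k : ℕ) + 1 then recC τ (l : ℕ) else 0) * pathCoeff lam τ m (i : ℕ) (l : ℕ) +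
        (if ((l : ℕ) : ℤ) = (k : ℕ) + 2 then recD τ (l : ℕ) else 0) * pathCoeff lam τ m (i : ℕ) (l : ℕ) := by
      intro l
      rw [recMatrix, recEntry, ← add_mul, ← add_mul, ← add_mul]
      simp only [show ((k : ℕ) : ℤ) = (l : ℕ) + 1 ↔ ((l : ℕ) : ℤ) = (k : ℕ) - 1 by omega,
        show ((k : ℕ) : ℤ) = (l : ℕ) ↔ ((l : ℕ) : ℤ) = (k : ℕ) by omega,
        show ((k : ℕ) : ℤ) = (l : ℕ) - 1 ↔ ((l : ℕ) : ℤ) = (k : ℕ) + 1 by omega,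
        show ((k : ℕ) : ℤ) = (l : ℕ) - 2 ↔ ((l : ℕ) : ℤ) = (k : ℕ) + 2 by omega]
    simp_rw [e, Finset.sum_add_distrib]
    rw [sum_fin_ite_mul n _ (pathCoeff lam τ m (i : ℕ)) (recA lam) (hf _ _),
      sum_fin_ite_mul n _ (pathCoeff lam τ m (i : ℕ)) (recB lam τ) (hf _ _),
      sum_fin_ite_mul n _ (pathCoeff lam τ m (i : ℕ)) (recC τ) (hf _ _),
      sum_fin_ite_mul n _ (pathCoeff lam τ m (i : ℕ)) (recD τ) (hf _ _), pathCoeff]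

/-! ### Zeros as eigenvalues -/

lemma sum_eval_mul_recMatrix {lam : ℝ} (hlam : 0 < lam) (τ : ℝ) {n : ℕ} {x : ℝ}
    (hx : (mpPoly lam τ n).eval x = 0) (l : Fin n) :
    ∑ k : Fin n, (mpPoly lam τ k).eval x * recMatrix lam τ n k l =
      x * (mpPoly lam τ l).eval x := by
  set f : ℤ → ℝ := fun k => (mpPoly lam τ k.toNat).eval x with hf
  have e : ∀ k : Fin n, (mpPoly lam τ k).eval x * recMatrix lam τ n k l =
      (if ((k : ℕ) : ℤ) = (l : ℕ) + 1 then recA lam (l : ℕ) else 0) * f (k : ℕ) +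
      (if ((k : ℕ) : ℤ) = (l : ℕ) then recB lam τ (l : ℕ) else 0) * f (k : ℕ) +
      (if ((k : ℕ) : ℤ) = (l : ℕ) - 1 then recC τ (l : ℕ) else 0) * f (k : ℕ) +
      (if ((k : ℕ) : ℤ) = (l : ℕ) - 2 then recD τ (l : ℕ) else 0) * f (k : ℕ) := by
    intro k
    rw [recMatrix, recEntry, ← add_mul, ← add_mul, ← add_mul, mul_comm]
    rfl
  have hl : ((l : ℕ) : ℤ) < n := by exact_mod_cast l.2
  have hrec := congrArg (Polynomial.eval x) (X_mul_mpPoly hlam τ l)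
  simp only [eval_add, eval_mul, eval_C, eval_X] at hrec
  rw [Finset.sum_congr rfl fun k _ => e k, Finset.sum_add_distrib, Finset.sum_add_distrib, Finset.sum_add_distrib,
    sum_fin_ite_mul n _ f (fun _ => recA lam (l : ℕ)), sum_fin_ite_mul n _ f (fun _ => recB lam τ (l : ℕ)),
    sum_fin_ite_mul n _ f (fun _ => recC τ (l : ℕ)), sum_fin_ite_mul n _ f (fun _ => recD τ (l : ℕ)), hrec]
  · simp only [hf, Int.toNat_natCast, show (((l : ℕ) : ℤ) + 1).toNat = (l : ℕ) + 1 by omega,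
      show (((l : ℕ) : ℤ) - 1).toNat = (l : ℕ) - 1 by omega,
      show (((l : ℕ) : ℤ) - 2).toNat = (l : ℕ) - 2 by omega]
  · intro h
    rcases (show ((l : ℕ) : ℤ) = 0 ∨ ((l : ℕ) : ℤ) = 1 by omega) with h | h
    · rw [h, recD_zero, zero_mul]
    · rw [h, recD_one, zero_mul]
  · intro h
    rw [show ((l : ℕ) : ℤ) = 0 by omega, recC_zero, zero_mul]
  · intro h
    omega
  · intro h
    have : (((l : ℕ) : ℤ) + 1).toNat = n := by omega
    simp only [hf, this, hx, mul_zero]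

/-- The sum of the powers of the zeros is a trace. -/
lemma trace_recMatrix_pow {lam : ℝ} (hlam : 0 < lam) (τ : ℝ) (n m : ℕ) :
    (recMatrix lam τ n ^ m).trace = ((mpPoly lam τ n).roots.map fun x => x ^ m).sum := by
  obtain ⟨hcard, hnodup⟩ := mpPoly_roots hlam τ n
  have hcard' : (mpPoly lam τ n).roots.toFinset.card = n := by
    rw [Multiset.toFinset_card_of_nodup hnodup, hcard]
  let e : Fin n ≃ (mpPoly lam τ n).roots.toFinset := (Finset.equivFinOfCardEq hcard').symm
  let x : Fin n → ℝ := fun j => e j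
  have hxinj : Function.Injective x := Subtype.val_injective.comp e.injective
  have hx : ∀ j, (mpPoly lam τ n).eval (x j) = 0 := fun j => by
    have := (e j).2
    rw [Multiset.mem_toFinset] at this
    exact isRoot_of_mem_roots this
  let V : Matrix (Fin n) (Fin n) ℝ := fun j l => (mpPoly lam τ l).eval (x j)
  have hVH : V * recMatrix lam τ n = Matrix.diagonal x * V := by
    ext j l
    rw [Matrix.mul_apply, Matrix.diagonal_mul]
    exact sum_eval_mul_recMatrix hlam τ (hx j) l
  have hVHm : V * recMatrix lam τ n ^ m = Matrix.diagonal x ^ m * V := by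
    induction m with
    | zero => simp
    | succ m ih => rw [pow_succ, ← mul_assoc, ih, mul_assoc, hVH, ← mul_assoc, ← pow_succ]
  have hdet : IsUnit V.det := by
    have h1 := Matrix.det_eval_matrixOfPolynomials_eq_det_vandermonde x
      (fun l : Fin n => C (mpLead lam l) * mpPoly lam τ l)
      (fun l => by rw [natDegree_C_mul (mpLead_pos hlam l).ne', mpPoly_natDegree hlam])
      (fun l => by rw [Monic, leadingCoeff_mul, leadingCoeff_C, mpPoly_leadingCoeff hlam])
    have h2 : (Matrix.of fun i j : Fin n => (C (mpLead lam j) * mpPoly lam τ j).eval (x i)) =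
        V * Matrix.diagonal fun l : Fin n => mpLead lam l := by
      ext i j
      rw [Matrix.of_apply, Matrix.mul_diagonal, eval_mul, eval_C, mul_comm]
    have h3 : (Matrix.vandermonde x).det ≠ 0 := Matrix.det_vandermonde_ne_zero_iff.2 hxinj
    rw [h1, h2, Matrix.det_mul] at h3
    exact isUnit_iff_ne_zero.2 (left_ne_zero_of_mul h3)
  have hconj : recMatrix lam τ n ^ m = V⁻¹ * (Matrix.diagonal x ^ m * V) := by
    rw [← hVHm, ← mul_assoc, Matrix.nonsing_inv_mul V hdet, one_mul]
  rw [hconj, Matrix.trace_mul_comm, mul_assoc, Matrix.mul_nonsing_inv V hdet, mul_one,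
    Matrix.diagonal_pow, Matrix.trace_diagonal]
  have h1 : ((mpPoly lam τ n).roots.map fun x => x ^ m).sum =
      ∑ y ∈ (mpPoly lam τ n).roots.toFinset, y ^ m := by
    rw [Finset.sum, Multiset.toFinset_val, hnodup.dedup]
  rw [h1]
  trans ∑ y : (mpPoly lam τ n).roots.toFinset, (y : ℝ) ^ m
  · rw [← e.sum_comp]
    rfl
  · exact Finset.sum_coe_sort _ fun y => y ^ m

/-! ### Bounds -/

lemma exists_rec_bound {lam : ℝ} (hlam : 0 < lam) (τ : ℝ) : ∃ K : ℝ, 0 < K ∧ ∀ n k : ℕ, k < n →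
    |recA lam k| + |recB lam τ k| + |recC τ k| + |recD τ k| ≤ K * n := by
  refine ⟨(lam + 1) + |τ| * (lam + 2) + (1 + τ ^ 2) + |τ| * (1 + τ ^ 2) * 2, by positivity,
    fun n k hk => ?_⟩
  have hk' : (k : ℝ) ≤ n := by exact_mod_cast hk.le
  have hn : (1 : ℝ) ≤ n := by exact_mod_cast (show 1 ≤ n by omega)
  have hk0 : (0 : ℝ) ≤ k := by positivity
  have hs : |(-1 : ℝ) ^ (k : ℤ)| = 1 := by rw [zpow_natCast]; simp
  have hA : |recA lam k| ≤ (lam + 1) * n := by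
    rw [recA, abs_of_nonneg (by positivity)]; push_cast; nlinarith
  have hC : |recC τ k| ≤ (1 + τ ^ 2) * n := by
    rw [recC, abs_of_nonneg (by positivity)]; push_cast; nlinarith [sq_nonneg τ]
  have hB : |recB lam τ k| ≤ |τ| * (lam + 2) * n := by
    rw [recB, abs_mul, mul_assoc]
    refine mul_le_mul_of_nonneg_left ?_ (abs_nonneg _)
    refine (abs_add_le _ _).trans ?_
    rw [abs_mul, hs, one_mul]
    have : |lam + ((k : ℤ) : ℝ) / 2 - 1 / 4| ≤ lam + k / 2 + 1 / 4 := by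
      push_cast; rw [abs_le]; constructor <;> linarith
    have h4 : |(1 / 4 : ℝ)| = 1 / 4 := abs_of_pos (by norm_num)
    nlinarith
  have hD : |recD τ k| ≤ |τ| * (1 + τ ^ 2) * 2 * n := by
    rw [recD, abs_mul, abs_mul, abs_of_pos (show 0 < 1 + τ ^ 2 by positivity), mul_assoc _ 2]
    refine mul_le_mul_of_nonneg_left ?_ (by positivity)
    refine (abs_add_le _ _).trans ?_
    rw [abs_mul, hs, one_mul]
    have : |((k : ℤ) : ℝ) / 2 - 1 / 4| ≤ k / 2 + 1 / 4 := by
      push_cast; rw [abs_le]; constructor <;> linarith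
    have h4 : |(1 / 4 : ℝ)| = 1 / 4 := abs_of_pos (by norm_num)
    nlinarith
  linarith

lemma abs_root_le {lam τ K : ℝ} (hlam : 0 < lam)
    (hK : ∀ n k : ℕ, k < n →
      |recA lam k| + |recB lam τ k| + |recC τ k| + |recD τ k| ≤ K * n) {n : ℕ} {x : ℝ}
    (hx : (mpPoly lam τ n).eval x = 0) : |x| ≤ K * n := by
  have hn : n ≠ 0 := by rintro rfl; simp [mpPoly_zero hlam] at hx
  obtain ⟨k, hk, hmax⟩ := Finset.exists_max_image (Finset.range n)
    (fun k => |(mpPoly lam τ k).eval x|) ⟨0, by simpa using Nat.pos_of_ne_zero hn⟩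
  rw [Finset.mem_range] at hk
  set M := |(mpPoly lam τ k).eval x| with hM
  have hM0 : 0 < M := by
    have := hmax 0 (by simpa using Nat.pos_of_ne_zero hn)
    simp [mpPoly_zero hlam] at this
    linarith
  have hle : ∀ j ≤ n, |(mpPoly lam τ j).eval x| ≤ M := fun j hj => by
    rcases hj.eq_or_lt with rfl | h
    · rw [hx, abs_zero]; exact hM0.le
    · exact hmax j (Finset.mem_range.2 h)
  have hrec := congrArg (Polynomial.eval x) (X_mul_mpPoly hlam τ k)
  simp only [eval_add, eval_mul, eval_C, eval_X] at hrec
  have h := congrArg abs hrec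
  rw [abs_mul, ← hM] at h
  have hb : |x| * M ≤ (|recA lam k| + |recB lam τ k| + |recC τ k| + |recD τ k|) * M := by
    rw [h]
    refine (abs_add_le _ _).trans ?_
    rw [add_mul]
    refine add_le_add ((abs_add_le _ _).trans ?_) (by
      rw [abs_mul]; exact mul_le_mul_of_nonneg_left (hle _ (by omega)) (abs_nonneg _))
    rw [add_mul]
    refine add_le_add ((abs_add_le _ _).trans ?_) (by
      rw [abs_mul]; exact mul_le_mul_of_nonneg_left (hle _ (by omega)) (abs_nonneg _))
    rw [add_mul]
    refine add_le_add ?_ ?_ <;>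
    · exact (abs_mul _ _).le.trans (mul_le_mul_of_nonneg_left (hle _ (by omega)) (abs_nonneg _))
  exact (le_of_mul_le_mul_right hb hM0).trans (hK n k hk)

lemma sum_abs_ite_le (n : ℕ) (j : ℤ) (a : ℝ) :
    ∑ k : Fin n, |if ((k : ℕ) : ℤ) = j then a else 0| ≤ |a| := by
  by_cases hj : ∃ k : Fin n, ((k : ℕ) : ℤ) = j
  · obtain ⟨k, hk⟩ := hj
    rw [Finset.sum_eq_single k]
    · rw [if_pos hk]
    · intro b _ hb
      rw [if_neg, abs_zero]
      intro e
      exact hb (Fin.ext (by exact_mod_cast e.trans hk.symm))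
    · simp
  · push Not at hj
    rw [Finset.sum_eq_zero fun k _ => by rw [if_neg (hj k), abs_zero]]
    exact abs_nonneg a

lemma abs_recMatrix_pow_le {lam τ K : ℝ} (hK0 : 0 < K)
    (hK : ∀ n k : ℕ, k < n →
      |recA lam k| + |recB lam τ k| + |recC τ k| + |recD τ k| ≤ K * n) (n m : ℕ) (k i : Fin n) :
    |(recMatrix lam τ n ^ m) k i| ≤ (K * n) ^ m := by
  induction m generalizing i with
  | zero =>
    rw [pow_zero, pow_zero, Matrix.one_apply]
    split_ifs <;> simp
  | succ m ih =>
    rw [pow_succ, Matrix.mul_apply, pow_succ]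
    refine (Finset.abs_sum_le_sum_abs _ _).trans ?_
    have h1 : ∑ l : Fin n, |(recMatrix lam τ n ^ m) k l * recMatrix lam τ n l i| ≤
        ∑ l : Fin n, (K * n) ^ m * |recMatrix lam τ n l i| :=
      Finset.sum_le_sum fun l _ => by
        rw [abs_mul]; exact mul_le_mul_of_nonneg_right (ih l) (abs_nonneg _)
    refine h1.trans ?_
    rw [← Finset.mul_sum]
    refine mul_le_mul_of_nonneg_left (le_trans ?_ (hK n i i.2)) (by positivity)
    have h2 : ∀ l : Fin n, |recMatrix lam τ n l i| ≤
        |if ((l : ℕ) : ℤ) = (i : ℕ) + 1 then recA lam (i : ℕ) else 0| +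
        |if ((l : ℕ) : ℤ) = (i : ℕ) then recB lam τ (i : ℕ) else 0| +
        |if ((l : ℕ) : ℤ) = (i : ℕ) - 1 then recC τ (i : ℕ) else 0| +
        |if ((l : ℕ) : ℤ) = (i : ℕ) - 2 then recD τ (i : ℕ) else 0| := fun l =>
      (abs_add_le _ _).trans (add_le_add_left ((abs_add_le _ _).trans
        (add_le_add_left (abs_add_le _ _) _)) _)
    refine (Finset.sum_le_sum fun l _ => h2 l).trans ?_
    rw [Finset.sum_add_distrib, Finset.sum_add_distrib, Finset.sum_add_distrib]
    exact add_le_add (add_le_add (add_le_add (sum_abs_ite_le _ _ _) (sum_abs_ite_le _ _ _))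
      (sum_abs_ite_le _ _ _)) (sum_abs_ite_le _ _ _)

lemma abs_pathCoeff_le {lam τ K : ℝ} (hK0 : 0 < K)
    (hK : ∀ n k : ℕ, k < n →
      |recA lam k| + |recB lam τ k| + |recC τ k| + |recD τ k| ≤ K * n) (m i : ℕ) :
    |pathCoeff lam τ m i i| ≤ (K * (i + m + 1)) ^ m := by
  have h := abs_recMatrix_pow_le hK0 hK (i + m + 1) m ⟨i, by omega⟩ ⟨i, by omega⟩
  rw [recMatrix_pow_eq_pathCoeff _ _ _ _ _ _ (by simp)] at h
  exact_mod_cast h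

/-! ### Asymptotics of the traces -/

/-- The limits of the rescaled path coefficients. -/
noncomputable def limCoeff (τ : ℝ) : ℕ → ℤ → ℤ → ℝ
  | 0, _, d => if d = 0 then 1 else 0
  | m + 1, ε, d => limCoeff τ m ε (d - 1) + τ * (-1) ^ (ε + d) * limCoeff τ m ε d +
      (1 + τ ^ 2) * limCoeff τ m ε (d + 1) +
      τ * (1 + τ ^ 2) * (-1) ^ (ε + d) * limCoeff τ m ε (d + 2)

lemma tendsto_affine_div (a b c : ℝ) :
    Tendsto (fun k : ℕ => (a * k + b) / (k : ℝ) + c / k) atTop (𝓝 a) := by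
  have h : Tendsto (fun k : ℕ => a + (b + c) / (k : ℝ)) atTop (𝓝 (a + 0)) :=
    tendsto_const_nhds.add (tendsto_const_div_atTop_nhds_zero_nat _)
  rw [add_zero] at h
  refine h.congr' ?_
  filter_upwards [eventually_gt_atTop 0] with k hk
  have : (k : ℝ) ≠ 0 := by positivity
  field_simp
  ring

lemma neg_one_zpow_two_mul_add (k : ℕ) (e : ℤ) : (-1 : ℝ) ^ (2 * (k : ℤ) + e) = (-1) ^ e := by
  rw [zpow_add₀ (by norm_num), zpow_mul]
  norm_num

lemma tendsto_recA_div (lam : ℝ) (e : ℤ) :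
    Tendsto (fun k : ℕ => recA lam (2 * k + e) / k) atTop (𝓝 1) := by
  refine (tendsto_affine_div 1 (lam + e / 2) 0).congr fun k => ?_
  rw [recA]; push_cast; ring

lemma tendsto_recB_div (lam τ : ℝ) (e : ℤ) :
    Tendsto (fun k : ℕ => recB lam τ (2 * k + e) / k) atTop (𝓝 (τ * (-1) ^ e)) := by
  refine (tendsto_affine_div (τ * (-1) ^ e) (τ * (-1) ^ e * (lam + e / 2 - 1 / 4)) (τ / 4)).congr
    fun k => ?_
  rw [recB, neg_one_zpow_two_mul_add]; push_cast; ring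

lemma tendsto_recC_div (τ : ℝ) (e : ℤ) :
    Tendsto (fun k : ℕ => recC τ (2 * k + e) / k) atTop (𝓝 (1 + τ ^ 2)) := by
  refine (tendsto_affine_div (1 + τ ^ 2) ((1 + τ ^ 2) * (e / 2)) 0).congr fun k => ?_
  rw [recC]; push_cast; ring

lemma tendsto_recD_div (τ : ℝ) (e : ℤ) :
    Tendsto (fun k : ℕ => recD τ (2 * k + e) / k) atTop (𝓝 (τ * (1 + τ ^ 2) * (-1) ^ e)) := by
  refine (tendsto_affine_div (τ * (1 + τ ^ 2) * (-1) ^ e)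
    (τ * (1 + τ ^ 2) * (-1) ^ e * (e / 2 - 1 / 4)) (τ * (1 + τ ^ 2) / 4)).congr fun k => ?_
  rw [recD, neg_one_zpow_two_mul_add]; push_cast; ring

lemma tendsto_pathCoeff (lam τ : ℝ) (m : ℕ) (ε d : ℤ) :
    Tendsto (fun k : ℕ => pathCoeff lam τ m (2 * k + ε) (2 * k + ε + d) / (k : ℝ) ^ m) atTop
      (𝓝 (limCoeff τ m ε d)) := by
  induction m generalizing d with
  | zero =>
    simp only [pathCoeff, limCoeff, pow_zero, div_one]
    simp
  | succ m ih =>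
    have h1 := (tendsto_recA_div lam (ε + d - 1)).mul (ih (d - 1))
    have h2 := (tendsto_recB_div lam τ (ε + d)).mul (ih d)
    have h3 := (tendsto_recC_div τ (ε + d + 1)).mul (ih (d + 1))
    have h4 := (tendsto_recD_div τ (ε + d + 2)).mul (ih (d + 2))
    have hs : (-1 : ℝ) ^ (ε + d + 2) = (-1) ^ (ε + d) := by
      rw [zpow_add₀ (by norm_num)]; norm_num
    rw [hs] at h4
    rw [limCoeff]
    refine (((h1.add h2).add h3).add h4).congr (fun k => ?_) |>.trans (le_of_eq (by rw [one_mul]))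
    rw [pathCoeff]
    simp only [show (2 * (k : ℤ) + ε + d) - 1 = 2 * k + ε + (d - 1) by ring,
      show (2 * (k : ℤ) + ε + d) + 1 = 2 * k + ε + (d + 1) by ring,
      show (2 * (k : ℤ) + ε + d) + 2 = 2 * k + ε + (d + 2) by ring,
      show 2 * (k : ℤ) + (ε + d - 1) = 2 * k + ε + (d - 1) by ring,
      show 2 * (k : ℤ) + (ε + d) = 2 * k + ε + d by ring,
      show 2 * (k : ℤ) + (ε + d + 1) = 2 * k + ε + (d + 1) by ring,
      show 2 * (k : ℤ) + (ε + d + 2) = 2 * k + ε + (d + 2) by ring]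
    rw [div_mul_div_comm, div_mul_div_comm, div_mul_div_comm, div_mul_div_comm, ← pow_succ',
      ← add_div, ← add_div, ← add_div]

lemma tendsto_succ_pow_sub_pow_div (m : ℕ) :
    Tendsto (fun k : ℕ => (((k : ℝ) + 1) ^ (m + 1) - (k : ℝ) ^ (m + 1)) / (k : ℝ) ^ m) atTop
      (𝓝 (m + 1)) := by
  have hd : HasDerivAt (fun x : ℝ => (1 + x) ^ (m + 1)) (m + 1) 0 := by
    have := ((hasDerivAt_id (0 : ℝ)).const_add 1).pow (m + 1)
    refine this.congr_deriv ?_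
    simp
  have hu : Tendsto (fun k : ℕ => ((k : ℝ))⁻¹) atTop (𝓝[≠] 0) := by
    refine tendsto_nhdsWithin_iff.2 ⟨tendsto_inv_atTop_nhds_zero_nat, ?_⟩
    filter_upwards [eventually_gt_atTop 0] with k hk
    simpa using hk.ne'
  have h := (hd.tendsto_slope_zero).comp hu
  refine h.congr' ?_
  filter_upwards [eventually_gt_atTop 0] with k hk
  have hk' : (k : ℝ) ≠ 0 := by positivity
  simp only [Function.comp_apply, zero_add, inv_inv, smul_eq_mul, add_zero, one_pow]
  rw [show (1 + (k : ℝ)⁻¹) = (k + 1) / k by field_simp, div_pow]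
  field_simp
  ring

lemma tendsto_sum_div_pow {b : ℕ → ℝ} {L : ℝ} (m : ℕ)
    (h : Tendsto (fun k : ℕ => b k / (k : ℝ) ^ m) atTop (𝓝 L)) :
    Tendsto (fun N : ℕ => (∑ k ∈ Finset.range N, b k) / (N : ℝ) ^ (m + 1)) atTop
      (𝓝 (L / (m + 1))) := by
  set g : ℕ → ℝ := fun k => ((k : ℝ) + 1) ^ (m + 1) - (k : ℝ) ^ (m + 1) with hg
  have hm : (m : ℝ) + 1 ≠ 0 := by positivity
  have hgpos : ∀ k, 0 < g k := fun k => by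
    have : (k : ℝ) ^ (m + 1) < ((k : ℝ) + 1) ^ (m + 1) := by gcongr; linarith
    simp only [hg]; linarith
  have hsum : ∀ N, ∑ k ∈ Finset.range N, g k = (N : ℝ) ^ (m + 1) := fun N => by
    have := Finset.sum_range_sub (fun k : ℕ => (k : ℝ) ^ (m + 1)) N
    simp only [Nat.cast_add, Nat.cast_one, Nat.cast_zero] at this
    simp only [hg, this]
    simp
  have hratio : Tendsto (fun k => b k / g k) atTop (𝓝 (L / (m + 1))) := by
    refine (h.div (tendsto_succ_pow_sub_pow_div m) hm).congr' ?_
    filter_upwards [eventually_gt_atTop 0] with k hk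
    have hk' : (k : ℝ) ^ m ≠ 0 := by positivity
    simp only [Pi.div_apply]
    rw [div_div_div_cancel_right₀ hk']
  have ho : (fun k => b k - L / (m + 1) * g k) =o[atTop] g := by
    rw [Asymptotics.isLittleO_iff_tendsto fun k hk => absurd hk (hgpos k).ne']
    have h2 : Tendsto (fun k => b k / g k - L / (m + 1)) atTop (𝓝 (L / (m + 1) - L / (m + 1))) :=
      hratio.sub_const _
    rw [sub_self] at h2
    refine h2.congr fun k => ?_
    rw [sub_div, mul_div_cancel_right₀ _ (hgpos k).ne']
  have hN : Tendsto (fun N : ℕ => (N : ℝ) ^ (m + 1)) atTop atTop :=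
    (tendsto_pow_atTop (by omega)).comp tendsto_natCast_atTop_atTop
  have hs := ho.sum_range (fun k => (hgpos k).le) (by simp_rw [hsum]; exact hN)
  simp_rw [hsum] at hs
  have hs2 := hs.tendsto_div_nhds_zero
  have hs3 := hs2.add_const (L / (m + 1))
  rw [zero_add] at hs3
  refine hs3.congr' ?_
  filter_upwards [eventually_gt_atTop 0] with N hN0
  have : (N : ℝ) ^ (m + 1) ≠ 0 := by positivity
  rw [Finset.sum_sub_distrib, ← Finset.mul_sum, hsum, sub_div, mul_div_cancel_right₀ _ this]
  ring

lemma sum_range_parity (a : ℕ → ℝ) (n : ℕ) : ∑ i ∈ Finset.range n, a i =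
    ∑ k ∈ Finset.range ((n + 1) / 2), a (2 * k) + ∑ k ∈ Finset.range (n / 2), a (2 * k + 1) := by
  induction n with
  | zero => simp
  | succ n ih =>
    rw [Finset.sum_range_succ, ih]
    obtain ⟨m, rfl | rfl⟩ := Nat.even_or_odd' n
    · rw [show (2 * m + 1 + 1) / 2 = m + 1 by omega, show (2 * m + 1) / 2 = m by omega,
        show 2 * m / 2 = m by omega, Finset.sum_range_succ]
      ring
    · rw [show (2 * m + 1 + 1 + 1) / 2 = m + 1 by omega, show (2 * m + 1 + 1) / 2 = m + 1 by omega,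
        show (2 * m + 1) / 2 = m by omega, Finset.sum_range_succ _ m, Finset.sum_range_succ _ m]
      ring

lemma tendsto_half_div (e : ℕ) (he : e ≤ 1) :
    Tendsto (fun n : ℕ => (((n + e) / 2 : ℕ) : ℝ) / n) atTop (𝓝 (1 / 2)) := by
  have hlo : Tendsto (fun n : ℕ => 1 / 2 - (1 : ℝ) / n) atTop (𝓝 (1 / 2 - 0)) :=
    tendsto_const_nhds.sub (tendsto_const_div_atTop_nhds_zero_nat 1)
  have hhi : Tendsto (fun n : ℕ => 1 / 2 + (1 : ℝ) / n) atTop (𝓝 (1 / 2 + 0)) :=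
    tendsto_const_nhds.add (tendsto_const_div_atTop_nhds_zero_nat 1)
  rw [sub_zero] at hlo
  rw [add_zero] at hhi
  refine tendsto_of_tendsto_of_tendsto_of_le_of_le' hlo hhi ?_ ?_ <;>
    filter_upwards [eventually_gt_atTop 0] with n hn
  all_goals
    have hn' : (0 : ℝ) < n := by exact_mod_cast hn
    have h1 : ((n : ℕ) : ℝ) ≤ 2 * (((n + e) / 2 : ℕ) : ℝ) + 1 := by
      exact_mod_cast (show n ≤ 2 * ((n + e) / 2) + 1 by omega)
    have h2 : 2 * (((n + e) / 2 : ℕ) : ℝ) ≤ n + 1 := by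
      exact_mod_cast (show 2 * ((n + e) / 2) ≤ n + 1 by omega)
  · rw [le_div_iff₀ hn', sub_mul, one_div_mul_cancel hn'.ne']; linarith
  · rw [div_le_iff₀ hn', add_mul, one_div_mul_cancel hn'.ne']; linarith

lemma tendsto_sum_parity {a : ℕ → ℝ} {L₀ L₁ : ℝ} (m : ℕ)
    (h₀ : Tendsto (fun k : ℕ => a (2 * k) / (k : ℝ) ^ m) atTop (𝓝 L₀))
    (h₁ : Tendsto (fun k : ℕ => a (2 * k + 1) / (k : ℝ) ^ m) atTop (𝓝 L₁)) :
    Tendsto (fun n : ℕ => (∑ i ∈ Finset.range n, a i) / (n : ℝ) ^ (m + 1)) atTop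
      (𝓝 ((L₀ + L₁) / (2 ^ (m + 1) * (m + 1)))) := by
  have key : ∀ (e : ℕ) (_ : e ≤ 1) (b : ℕ → ℝ) (L : ℝ)
      (_ : Tendsto (fun k : ℕ => b k / (k : ℝ) ^ m) atTop (𝓝 L)),
      Tendsto (fun n : ℕ => (∑ k ∈ Finset.range ((n + e) / 2), b k) / (n : ℝ) ^ (m + 1)) atTop
        (𝓝 (L / (m + 1) * (1 / 2) ^ (m + 1))) := by
    intro e he b L hb
    have ht : Tendsto (fun n : ℕ => (n + e) / 2) atTop atTop := by
      refine tendsto_atTop_atTop.2 fun N => ⟨2 * N, fun n hn => by omega⟩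
    refine (((tendsto_sum_div_pow m hb).comp ht).mul ((tendsto_half_div e he).pow (m + 1))).congr' ?_
    filter_upwards [eventually_gt_atTop 1] with n hn
    have : (((n + e) / 2 : ℕ) : ℝ) ^ (m + 1) ≠ 0 := by
      have : 0 < (n + e) / 2 := by omega
      positivity
    rw [Function.comp_apply, div_pow, div_mul_div_cancel₀ this]
  have h := (key 1 le_rfl _ _ h₀).add (key 0 (by omega) _ _ h₁)
  have e : L₀ / (m + 1) * (1 / 2) ^ (m + 1) + L₁ / (m + 1) * (1 / 2) ^ (m + 1) =
      (L₀ + L₁) / (2 ^ (m + 1) * (m + 1)) := by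
    have : (m : ℝ) + 1 ≠ 0 := by positivity
    rw [div_pow, one_pow]
    field_simp
  rw [← e]
  refine h.congr fun n => ?_
  rw [sum_range_parity a n, add_div]
  rfl

lemma tendsto_pathCoeff_diag (lam τ : ℝ) (m : ℕ) :
    Tendsto (fun n : ℕ => (∑ i ∈ Finset.range n, pathCoeff lam τ m i i) / (n : ℝ) ^ (m + 1)) atTop
      (𝓝 ((limCoeff τ m 0 0 + limCoeff τ m 1 0) / (2 ^ (m + 1) * (m + 1)))) := by
  refine tendsto_sum_parity m ?_ ?_
  · refine (tendsto_pathCoeff lam τ m 0 0).congr fun k => ?_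
    push_cast
    simp only [add_zero]
  · refine (tendsto_pathCoeff lam τ m 1 0).congr fun k => ?_
    push_cast
    simp only [add_zero]

lemma tendsto_trace_sub (lam τ : ℝ) (hlam : 0 < lam) (m : ℕ) :
    Tendsto (fun n : ℕ => ((recMatrix lam τ n ^ m).trace -
      ∑ i ∈ Finset.range n, pathCoeff lam τ m i i) / (n : ℝ) ^ (m + 1)) atTop (𝓝 0) := by
  obtain ⟨K, hK0, hK⟩ := exists_rec_bound hlam τ
  have hlim : Tendsto (fun n : ℕ => (m * (2 * K ^ m)) * ((1 + ((m : ℝ) + 1) / n) ^ m / n)) atTop (𝓝 0) := by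
    have h1 : Tendsto (fun n : ℕ => (1 + ((m : ℝ) + 1) / n) ^ m) atTop (𝓝 ((1 + 0) ^ m)) :=
      (tendsto_const_nhds.add (tendsto_const_div_atTop_nhds_zero_nat _)).pow m
    have h2 := (h1.div_atTop tendsto_natCast_atTop_atTop).const_mul (m * (2 * K ^ m))
    simpa using h2
  refine squeeze_zero_norm' ?_ hlim
  filter_upwards [eventually_gt_atTop 0] with n hn
  have hn' : (0 : ℝ) < n := by exact_mod_cast hn
  have hterm : ∀ i : Fin n, |(recMatrix lam τ n ^ m) i i - pathCoeff lam τ m (i : ℕ) (i : ℕ)| ≤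
      if n ≤ (i : ℕ) + m then 2 * (K * (n + m + 1)) ^ m else 0 := by
    intro i
    split_ifs with hi
    · have h1 := abs_recMatrix_pow_le hK0 hK n m i i
      have h2 := abs_pathCoeff_le hK0 hK m i
      have hin : ((i : ℕ) : ℝ) ≤ n := by exact_mod_cast i.2.le
      have h3 : (K * n) ^ m ≤ (K * (n + m + 1)) ^ m := by
        have : (0 : ℝ) ≤ m := by positivity
        gcongr; linarith
      have h4 : (K * (((i : ℕ) : ℝ) + m + 1)) ^ m ≤ (K * (n + m + 1)) ^ m := by gcongr
      refine (abs_sub _ _).trans ?_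
      linarith
    · rw [recMatrix_pow_eq_pathCoeff _ _ _ _ _ _ (by omega), sub_self, abs_zero]
  have hsum : (recMatrix lam τ n ^ m).trace - ∑ i ∈ Finset.range n, pathCoeff lam τ m i i =
      ∑ i : Fin n, ((recMatrix lam τ n ^ m) i i - pathCoeff lam τ m (i : ℕ) (i : ℕ)) := by
    rw [Finset.sum_sub_distrib, Matrix.trace, Fin.sum_univ_eq_sum_range
      (fun i : ℕ => pathCoeff lam τ m i i)]
    rfl
  have hcard : ∑ i : Fin n, (if n ≤ (i : ℕ) + m then 2 * (K * ((n : ℝ) + m + 1)) ^ m else 0) ≤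
      m * (2 * (K * (n + m + 1)) ^ m) := by
    rw [Fin.sum_univ_eq_sum_range (fun i : ℕ => if n ≤ i + m then 2 * (K * ((n : ℝ) + m + 1)) ^ m else 0),
      ← Finset.sum_filter, Finset.sum_const, nsmul_eq_mul]
    refine mul_le_mul_of_nonneg_right ?_ (by positivity)
    have hsub : (Finset.range n).filter (fun i => n ≤ i + m) ⊆ Finset.Ico (n - m) n := fun i hi => by
      rw [Finset.mem_filter, Finset.mem_range] at hi
      rw [Finset.mem_Ico]; omega
    have := Finset.card_le_card hsub
    rw [Nat.card_Ico] at this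
    exact_mod_cast this.trans (by omega)
  rw [Real.norm_eq_abs, abs_div, abs_of_pos (show (0 : ℝ) < (n : ℝ) ^ (m + 1) by positivity),
    div_le_iff₀ (by positivity), hsum]
  refine ((Finset.abs_sum_le_sum_abs _ _).trans (Finset.sum_le_sum fun i _ => hterm i)).trans
    (hcard.trans (le_of_eq ?_))
  have e : (1 + ((m : ℝ) + 1) / n) = (n + m + 1) / n := by field_simp; ring
  rw [e, div_pow, mul_pow, pow_succ]
  field_simp

/-- Limits of the normalized power sums of the zeros. -/
lemma tendsto_powerSum {lam : ℝ} (hlam : 0 < lam) (τ : ℝ) (m : ℕ) :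
    Tendsto (fun n : ℕ => ((mpPoly lam τ n).roots.map fun x => x ^ m).sum / (n : ℝ) ^ (m + 1)) atTop
      (𝓝 ((limCoeff τ m 0 0 + limCoeff τ m 1 0) / (2 ^ (m + 1) * (m + 1)))) := by
  have h := (tendsto_trace_sub lam τ hlam m).add (tendsto_pathCoeff_diag lam τ m)
  rw [zero_add] at h
  refine h.congr fun n => ?_
  rw [← trace_recMatrix_pow hlam, ← add_div]
  ring

/-! ### The limit coefficients -/

lemma limCoeff_add_two (τ : ℝ) (m : ℕ) (ε d : ℤ) : limCoeff τ (m + 2) ε d =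
    limCoeff τ m ε (d - 2) + (2 * (1 + τ ^ 2) + τ ^ 2) * limCoeff τ m ε d +
      ((1 + τ ^ 2) ^ 2 + 2 * (1 + τ ^ 2) * τ ^ 2) * limCoeff τ m ε (d + 2) +
      (1 + τ ^ 2) ^ 2 * τ ^ 2 * limCoeff τ m ε (d + 4) := by
  have hs : ((-1 : ℝ) ^ (ε + d)) ^ 2 = 1 := by
    rw [← zpow_natCast, ← zpow_mul, mul_comm, zpow_mul]; norm_num
  have h1 : (-1 : ℝ) ^ (ε + (d - 1)) = -(-1) ^ (ε + d) := by
    rw [← add_sub_assoc, zpow_sub₀ (by norm_num), zpow_one, div_neg, div_one]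
  have h2 : (-1 : ℝ) ^ (ε + (d + 1)) = -(-1) ^ (ε + d) := by
    rw [← add_assoc, zpow_add₀ (by norm_num)]; norm_num
  have h3 : (-1 : ℝ) ^ (ε + (d + 2)) = (-1) ^ (ε + d) := by
    rw [← add_assoc, zpow_add₀ (by norm_num)]; norm_num
  simp only [limCoeff, h1, h2, h3]
  simp only [show d - 1 - 1 = d - 2 by ring, show d - 1 + 1 = d by ring,
    show d - 1 + 2 = d + 1 by ring, show d + 1 - 1 = d by ring, show d + 1 + 1 = d + 2 by ring,
    show d + 1 + 2 = d + 3 by ring, show d + 2 - 1 = d + 1 by ring, show d + 2 + 1 = d + 3 by ring,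
    show d + 2 + 2 = d + 4 by ring]
  linear_combination (τ ^ 2 * limCoeff τ m ε d + 2 * τ ^ 2 * (1 + τ ^ 2) * limCoeff τ m ε (d + 2) +
    τ ^ 2 * (1 + τ ^ 2) ^ 2 * limCoeff τ m ε (d + 4)) * hs

lemma limCoeff_even_eq (τ : ℝ) (j : ℕ) (ε d : ℤ) :
    limCoeff τ (2 * j) ε d = limCoeff τ (2 * j) 0 d := by
  induction j generalizing d with
  | zero => rfl
  | succ j ih =>
    rw [show 2 * (j + 1) = 2 * j + 2 by ring, limCoeff_add_two, limCoeff_add_two τ _ 0, ih, ih, ih, ih]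

lemma limCoeff_even_odd (τ : ℝ) (j : ℕ) (l : ℤ) :
    limCoeff τ (2 * j) 0 (2 * l + 1) = 0 := by
  induction j generalizing l with
  | zero => rw [mul_zero, limCoeff, if_neg (by omega)]
  | succ j ih =>
    rw [show 2 * (j + 1) = 2 * j + 2 by ring, limCoeff_add_two,
      show 2 * l + 1 - 2 = 2 * (l - 1) + 1 by ring, show 2 * l + 1 + 2 = 2 * (l + 1) + 1 by ring,
      show 2 * l + 1 + 4 = 2 * (l + 2) + 1 by ring, ih, ih, ih, ih]
    simp

lemma limCoeff_odd_sum (τ : ℝ) (j : ℕ) :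
    limCoeff τ (2 * j + 1) 0 0 + limCoeff τ (2 * j + 1) 1 0 = 0 := by
  rw [limCoeff, limCoeff]
  simp only [limCoeff_even_eq τ j 1]
  have h1 := limCoeff_even_odd τ j (-1)
  have h2 := limCoeff_even_odd τ j 0
  norm_num at h1 h2 ⊢
  rw [h1, h2]
  ring

end MeixnerPollaczek

namespace MeixnerPollaczek

open scoped ComplexConjugate

/-! ### The roots of the normalized cubic -/

/-- `Z 0, Z 1, Z 2` are the roots of `(1 + Z)² (1 + α Z) = y Z`, expressed by a factorization. -/
def CubicFactors (α : ℝ) (y z₀ z₁ z₂ : ℂ) : Prop :=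
  ∀ Z : ℂ, (1 + Z) ^ 2 * (1 + α * Z) - y * Z = α * ((Z - z₀) * (Z - z₁) * (Z - z₂))

section roots

variable {α : ℝ} {y z₀ z₁ z₂ : ℂ}

lemma CubicFactors.prod (h : CubicFactors α y z₀ z₁ z₂) : (α : ℂ) * (z₀ * z₁ * z₂) = -1 := by
  have := h 0
  linear_combination this

lemma CubicFactors.sum (h : CubicFactors α y z₀ z₁ z₂) :
    (α : ℂ) * (z₀ + z₁ + z₂) = -(1 + 2 * α) := by
  have h0 := h 0
  have h1 := h 1
  have h2 := h (-1)
  linear_combination -h0 + (1 / 2) * h1 + (1 / 2) * h2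

lemma CubicFactors.pairs (h : CubicFactors α y z₀ z₁ z₂) :
    (α : ℂ) * (z₀ * z₁ + z₀ * z₂ + z₁ * z₂) = 2 + α - y := by
  have h1 := h 1
  have h2 := h (-1)
  linear_combination - (1 / 2) * h1 + (1 / 2) * h2

lemma CubicFactors.eq₀ (h : CubicFactors α y z₀ z₁ z₂) :
    (1 + z₀) ^ 2 * (1 + α * z₀) = y * z₀ := by
  linear_combination h z₀

lemma CubicFactors.swap (h : CubicFactors α y z₀ z₁ z₂) : CubicFactors α y z₁ z₀ z₂ := fun Z => by
  rw [h Z]; ring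

lemma CubicFactors.root_cases (hα : 0 < α) (h : CubicFactors α y z₀ z₁ z₂) {Z : ℂ}
    (hZ : (1 + Z) ^ 2 * (1 + α * Z) = y * Z) : Z = z₀ ∨ Z = z₁ ∨ Z = z₂ := by
  have h1 := h Z
  rw [hZ, sub_self, eq_comm, mul_eq_zero, mul_eq_zero, mul_eq_zero, sub_eq_zero, sub_eq_zero,
    sub_eq_zero, Complex.ofReal_eq_zero] at h1
  rcases h1 with h1 | (h1 | h1) | h1
  · exact absurd h1 hα.ne'
  · exact Or.inl h1
  · exact Or.inr (Or.inl h1)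
  · exact Or.inr (Or.inr h1)

/-- A labelling by increasing modulus agrees with any factorization whose third root dominates. -/
lemma CubicFactors.labeled_eq (hα : 0 < α) {b₀ b₁ b₂ : ℂ} (h : CubicFactors α y z₀ z₁ z₂)
    (hb : CubicFactors α y b₀ b₁ b₂) (h01 : ‖z₀‖ ≤ ‖z₁‖) (h12 : ‖z₁‖ ≤ ‖z₂‖) (hne : b₀ ≠ b₁)
    (h02 : ‖b₀‖ < ‖b₂‖) (hb12 : ‖b₁‖ < ‖b₂‖) :
    z₂ = b₂ ∧ ((z₀ = b₀ ∧ z₁ = b₁) ∨ (z₀ = b₁ ∧ z₁ = b₀)) := by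
  have r0 := h.root_cases hα hb.eq₀
  have r1 := h.root_cases hα hb.swap.eq₀
  have r2 := h.root_cases hα (Z := b₂) (by linear_combination hb b₂)
  have key : ∀ b, ‖b‖ < ‖b₂‖ → (b = z₀ ∨ b = z₁ ∨ b = z₂) →
      (b₂ = z₁ ∧ b = z₀) ∨ (b₂ = z₂ ∧ (b = z₀ ∨ b = z₁)) := by
    intro b hlt hb
    rcases r2 with rfl | rfl | rfl <;> rcases hb with rfl | rfl | rfl
    · exact absurd hlt (lt_irrefl _)
    · exact absurd hlt (not_lt.2 h01)
    · exact absurd hlt (not_lt.2 (h01.trans h12))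
    · exact Or.inl ⟨rfl, rfl⟩
    · exact absurd hlt (lt_irrefl _)
    · exact absurd hlt (not_lt.2 h12)
    · exact Or.inr ⟨rfl, Or.inl rfl⟩
    · exact Or.inr ⟨rfl, Or.inr rfl⟩
    · exact absurd hlt (lt_irrefl _)
  rcases key b₀ h02 r0 with ⟨e, k0⟩ | ⟨e, k0⟩ <;> rcases key b₁ hb12 r1 with ⟨e', k1⟩ | ⟨e', k1⟩
  · exact absurd (k0.trans k1.symm) hne
  · have : z₁ = z₂ := e.symm.trans e'
    rcases k1 with k1 | k1
    · exact absurd (k0.trans k1.symm) hne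
    · rw [k1, ← e] at hb12
      exact absurd hb12 (lt_irrefl _)
  · have : z₁ = z₂ := e'.symm.trans e
    rcases k0 with k0 | k0
    · exact absurd (k0.trans k1.symm) hne
    · rw [k0, ← e'] at h02
      exact absurd h02 (lt_irrefl _)
  · refine ⟨e.symm, ?_⟩
    rcases k0 with k0 | k0 <;> rcases k1 with k1 | k1
    · exact absurd (k0.trans k1.symm) hne
    · exact Or.inl ⟨k0.symm, k1.symm⟩
    · exact Or.inr ⟨k1.symm, k0.symm⟩
    · exact absurd (k0.trans k1.symm) hne

lemma CubicFactors.ne_zero (h : CubicFactors α y z₀ z₁ z₂) : z₀ ≠ 0 ∧ z₁ ≠ 0 ∧ z₂ ≠ 0 := by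
  have := h.prod
  refine ⟨?_, ?_, ?_⟩ <;> · rintro rfl; simp at this

lemma eq_or_eq_conj_of_norm_eq (hα : 0 < α) {Z W : ℂ} (hn : ‖Z‖ = ‖W‖)
    (hZ : (1 + Z) ^ 2 * (1 + α * Z) = y * Z) (hW : (1 + W) ^ 2 * (1 + α * W) = y * W) :
    W = Z ∨ W = conj Z := by
  have hsq : Z.re ^ 2 + Z.im ^ 2 = W.re ^ 2 + W.im ^ 2 := by
    have := congrArg (· ^ 2) hn
    simp only [← Complex.normSq_eq_norm_sq, Complex.normSq_apply] at this
    linarith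
  have hm : ‖(1 + Z) ^ 2 * (1 + α * Z)‖ ^ 2 = ‖(1 + W) ^ 2 * (1 + α * W)‖ ^ 2 := by
    rw [hZ, hW, norm_mul, norm_mul, hn]
  have hf : ∀ V : ℂ, ‖(1 + V) ^ 2 * (1 + α * V)‖ ^ 2 =
      (1 + (V.re ^ 2 + V.im ^ 2) + 2 * V.re) ^ 2 *
        (1 + α ^ 2 * (V.re ^ 2 + V.im ^ 2) + 2 * α * V.re) := fun V => by
    rw [norm_mul, norm_pow, mul_pow, ← pow_mul, mul_comm 2 2, pow_mul, ← Complex.normSq_eq_norm_sq,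
      ← Complex.normSq_eq_norm_sq, Complex.normSq_apply, Complex.normSq_apply]
    simp
    ring
  rw [hf, hf, hsq] at hm
  set R := W.re ^ 2 + W.im ^ 2 with hR
  have mono : ∀ p q : ℝ, p < q → 0 ≤ 1 + R + 2 * p → 0 ≤ 1 + α ^ 2 * R + 2 * α * p →
      (1 + R + 2 * p) ^ 2 * (1 + α ^ 2 * R + 2 * α * p) <
        (1 + R + 2 * q) ^ 2 * (1 + α ^ 2 * R + 2 * α * q) := by
    intro p q hpq h1 h2
    have h3 : 1 + R + 2 * p < 1 + R + 2 * q := by linarith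
    have h4 : 1 + α ^ 2 * R + 2 * α * p < 1 + α ^ 2 * R + 2 * α * q := by nlinarith
    have h5 : (1 + R + 2 * p) ^ 2 ≤ (1 + R + 2 * q) ^ 2 := by gcongr
    have h6 : 0 < (1 + R + 2 * q) ^ 2 := by
      have : 0 < 1 + R + 2 * q := h1.trans_lt h3
      positivity
    calc _ ≤ (1 + R + 2 * q) ^ 2 * (1 + α ^ 2 * R + 2 * α * p) := by gcongr
      _ < _ := by gcongr
  have hnn : ∀ p v : ℝ, p ^ 2 + v ^ 2 = R → 0 ≤ 1 + R + 2 * p ∧ 0 ≤ 1 + α ^ 2 * R + 2 * α * p :=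
    fun p v h => ⟨by nlinarith [sq_nonneg (1 + p), sq_nonneg v],
      by rw [← h]; nlinarith [sq_nonneg (1 + α * p), sq_nonneg (α * v)]⟩
  have hre : Z.re = W.re := by
    rcases lt_trichotomy Z.re W.re with h | h | h
    · obtain ⟨h1, h2⟩ := hnn _ _ hsq
      exact absurd hm (mono _ _ h h1 h2).ne
    · exact h
    · obtain ⟨h1, h2⟩ := hnn W.re W.im hR.symm
      exact absurd hm (mono _ _ h h1 h2).ne'
  have him : (W.im - Z.im) * (W.im + Z.im) = 0 := by rw [hre] at hsq; linarith
  rcases mul_eq_zero.1 him with h | h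
  · exact Or.inl (Complex.ext hre.symm (by linarith))
  · exact Or.inr (Complex.ext (by simp [hre]) (by simp; linarith))

lemma im_eq_zero_of_quadratic (hα : 0 < α) {Z : ℂ} (h : 2 * α * Z ^ 2 + Z - 1 = 0) :
    Z.im = 0 := by
  have hre := congrArg Complex.re h
  have him := congrArg Complex.im h
  simp [pow_two] at hre him
  by_contra hne
  have h4 : 4 * α * Z.re + 1 = 0 := by
    have : Z.im * (4 * α * Z.re + 1) = 0 := by linarith
    exact (mul_eq_zero.1 this).resolve_left hne
  have h5 : 0 < Z.im ^ 2 := by positivity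
  nlinarith [mul_pos hα h5]

/-- A double root is real, and equals `-1` or is a zero of `2 α r² + r - 1`. -/
lemma CubicFactors.double (hα : 0 < α) (h : CubicFactors α y z₀ z₀ z₂) :
    z₀.im = 0 ∧ (z₀.re = -1 ∨ 2 * α * z₀.re ^ 2 + z₀.re - 1 = 0) := by
  have h1 := h.prod
  have h2 := h.sum
  have hα' : (α : ℂ) ≠ 0 := by exact_mod_cast hα.ne'
  have h3 : (z₀ + 1) * (2 * α * z₀ ^ 2 + z₀ - 1) = 0 := by
    linear_combination z₀ ^ 2 * h2 - h1
  rcases mul_eq_zero.1 h3 with h | h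
  · have : z₀ = -1 := by linear_combination h
    simp [this]
  · have h0 := im_eq_zero_of_quadratic hα h
    have hre := congrArg Complex.re h
    simp [pow_two] at hre
    refine ⟨h0, Or.inr ?_⟩
    rw [h0] at hre
    linarith

lemma CubicFactors.eq_conj (hα : 0 < α) (h : CubicFactors α y z₀ z₁ z₂) (hn : ‖z₀‖ = ‖z₁‖) :
    z₁ = conj z₀ := by
  rcases eq_or_eq_conj_of_norm_eq hα hn h.eq₀ h.swap.eq₀ with h1 | h1
  · subst h1
    exact (Complex.conj_eq_iff_im.2 (h.double hα).1).symm
  · exact h1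

lemma CubicFactors.im_eq_zero (hα : 0 < α) (h : CubicFactors α y z₀ z₁ z₂) (hn : ‖z₀‖ = ‖z₁‖) :
    y.im = 0 := by
  have h1 := h.eq_conj hα hn
  have h2 := h.swap.eq₀
  have h3 := congrArg conj h.eq₀
  simp only [map_mul, map_pow, map_add, map_one, Complex.conj_ofReal, ← h1] at h3
  rw [h2] at h3
  exact Complex.conj_eq_iff_im.1 (mul_right_cancel₀ h.ne_zero.2.1 h3).symm

lemma CubicFactors.re_nonneg (hα : 0 < α) (hα1 : α < 1) (h : CubicFactors α y z₀ z₁ z₂)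
    (hn : ‖z₀‖ = ‖z₁‖) (h12 : ‖z₁‖ ≤ ‖z₂‖) : 0 ≤ y.re := by
  by_contra! hy
  have him := h.im_eq_zero hα hn
  obtain ⟨r, ⟨hr1, hr2⟩, hr⟩ : ∃ r ∈ Ioo (-1 : ℝ) 0, (1 + r) ^ 2 * (1 + α * r) - y.re * r = 0 := by
    have hc : ContinuousOn (fun r : ℝ => (1 + r) ^ 2 * (1 + α * r) - y.re * r) (Icc (-1) 0) := by
      fun_prop
    have := intermediate_value_Ioo (by norm_num) hc
    exact this ⟨by norm_num; exact hy, by norm_num⟩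
  have hroot : (1 + (r : ℂ)) ^ 2 * (1 + α * r) = y * r := by
    rw [show y = (y.re : ℂ) from Complex.ext rfl (by simp [him])]
    exact_mod_cast sub_eq_zero.1 hr
  have hrn : ‖(r : ℂ)‖ < 1 := by
    rw [Complex.norm_real, Real.norm_of_nonpos hr2.le]; linarith
  have hconj := h.eq_conj hα hn
  have hcases : ‖z₂‖ < 1 ∨ z₀ = r := by
    rcases h.root_cases hα hroot with h1 | h1 | h1
    · exact Or.inr h1.symm
    · right
      rw [hconj] at h1
      have := congrArg conj h1
      rw [Complex.conj_conj, Complex.conj_ofReal] at this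
      exact this.symm
    · left; rw [← h1]; exact hrn
  rcases hcases with h2 | h2
  · have hp := congrArg norm h.prod
    rw [norm_mul, norm_mul, norm_mul, norm_neg, norm_one, Complex.norm_real,
      Real.norm_of_nonneg hα.le, hn] at hp
    have h3 : ‖z₁‖ < 1 := h12.trans_lt h2
    have h4 : ‖z₁‖ * ‖z₁‖ ≤ 1 := by nlinarith [norm_nonneg z₁]
    have h5 : ‖z₁‖ * ‖z₁‖ * ‖z₂‖ ≤ 1 :=
      mul_le_one₀ h4 (norm_nonneg _) h2.le
    nlinarith
  · have h3 : z₁ = z₀ := by rw [hconj, h2, Complex.conj_ofReal]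
    rw [h3] at h
    obtain ⟨-, h4 | h4⟩ := h.double hα
    · rw [h2, Complex.ofReal_re] at h4; linarith
    · rw [h2, Complex.ofReal_re] at h4
      nlinarith

end roots

/-! ### Parametrization of the critical curve -/

/-- The common value in the trigonometric solution of the cubic. -/
noncomputable def etaScale (α : ℝ) : ℝ := √((1 + 2 * α) / 3)

/-- The solution `η ≥ 1` of `η³ - (1 + 2α) η = 2 α cos θ`. -/
noncomputable def eta (α θ : ℝ) : ℝ :=
  2 * etaScale α * Real.cos (Real.arccos (α * Real.cos θ / etaScale α ^ 3) / 3)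

section eta

variable {α : ℝ}

lemma etaScale_sq (hα : 0 < α) : etaScale α ^ 2 = (1 + 2 * α) / 3 :=
  Real.sq_sqrt (by positivity)

lemma etaScale_pos (hα : 0 < α) : 0 < etaScale α := Real.sqrt_pos.2 (by positivity)

lemma etaScale_lt_one (hα : 0 < α) (hα1 : α < 1) : etaScale α < 1 := by
  have := etaScale_sq hα
  nlinarith [etaScale_pos hα]

lemma lt_etaScale_cube (hα : 0 < α) (hα1 : α < 1) : α < etaScale α ^ 3 := by
  have h1 := etaScale_sq hα
  have h2 := etaScale_pos hα
  have h3 := etaScale_lt_one hα hα1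
  have h4 : α = (3 * etaScale α ^ 2 - 1) / 2 := by rw [h1]; ring
  have h5 : etaScale α ^ 3 - α = (1 - etaScale α) ^ 2 * (2 * etaScale α + 1) / 2 := by
    linear_combination -h4
  have : 0 < (1 - etaScale α) ^ 2 * (2 * etaScale α + 1) / 2 := by
    have : 0 < 1 - etaScale α := by linarith
    positivity
  linarith

lemma abs_eta_arg_lt (hα : 0 < α) (hα1 : α < 1) (θ : ℝ) :
    |α * Real.cos θ / etaScale α ^ 3| < 1 := by
  have h := lt_etaScale_cube hα hα1
  rw [abs_div, abs_mul, abs_of_pos hα, abs_of_pos (hα.trans h), div_lt_one (hα.trans h)]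
  nlinarith [Real.abs_cos_le_one θ]

lemma eta_cubic (hα : 0 < α) (hα1 : α < 1) (θ : ℝ) :
    eta α θ ^ 3 - (1 + 2 * α) * eta α θ = 2 * α * Real.cos θ := by
  have habs := abs_lt.1 (abs_eta_arg_lt hα hα1 θ)
  have hcos := Real.cos_arccos habs.1.le habs.2.le
  set u := Real.arccos (α * Real.cos θ / etaScale α ^ 3) / 3 with hu
  have h3 : Real.cos (3 * u) = α * Real.cos θ / etaScale α ^ 3 := by
    rw [hu, mul_div_cancel₀ _ (by norm_num), hcos]
  rw [Real.cos_three_mul] at h3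
  have hq := etaScale_sq hα
  have hq0 := etaScale_pos hα
  have h4 : (4 * Real.cos u ^ 3 - 3 * Real.cos u) * etaScale α ^ 3 = α * Real.cos θ := by
    rw [h3]; field_simp
  rw [eta, ← hu]
  linear_combination 2 * h4 + 6 * etaScale α * Real.cos u * hq

lemma etaScale_le_eta (hα : 0 < α) (θ : ℝ) : etaScale α ≤ eta α θ := by
  set u := Real.arccos (α * Real.cos θ / etaScale α ^ 3) / 3 with hu
  have h1 : Real.cos (Real.pi / 3) ≤ Real.cos u := by
    have h0 := Real.arccos_nonneg (α * Real.cos θ / etaScale α ^ 3)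
    have hpi := Real.arccos_le_pi (α * Real.cos θ / etaScale α ^ 3)
    exact Real.cos_le_cos_of_nonneg_of_le_pi (by positivity) (by linarith [Real.pi_pos])
      (by rw [hu]; linarith)
  rw [Real.cos_pi_div_three] at h1
  rw [eta, ← hu]
  nlinarith [etaScale_pos hα]

lemma eta_strictMono_aux (hα : 0 < α) {p q : ℝ} (hp : etaScale α ≤ p) (hpq : p < q) :
    p ^ 3 - (1 + 2 * α) * p < q ^ 3 - (1 + 2 * α) * q := by
  have h1 := etaScale_sq hα
  have h2 := etaScale_pos hα
  have h3 : 1 + 2 * α = 3 * etaScale α ^ 2 := by rw [h1]; ring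
  rw [h3]
  have h4 : 3 * etaScale α ^ 2 < q ^ 2 + q * p + p ^ 2 := by nlinarith
  nlinarith [mul_pos (sub_pos.2 hpq) (sub_pos.2 h4)]

lemma eta_unique (hα : 0 < α) (hα1 : α < 1) {θ p : ℝ} (hp : 1 ≤ p)
    (h : p ^ 3 - (1 + 2 * α) * p = 2 * α * Real.cos θ) : eta α θ = p := by
  have h1 := eta_cubic hα hα1 θ
  rcases lt_trichotomy (eta α θ) p with hlt | heq | hgt
  · have := eta_strictMono_aux hα (etaScale_le_eta hα θ) hlt
    linarith
  · exact heq
  · have := eta_strictMono_aux hα ((etaScale_lt_one hα hα1).le.trans hp) hgt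
    linarith

lemma one_le_eta (hα : 0 < α) (hα1 : α < 1) (θ : ℝ) : 1 ≤ eta α θ := by
  by_contra! h
  have h1 := eta_strictMono_aux hα (etaScale_le_eta hα θ) h
  have h2 := eta_cubic hα hα1 θ
  nlinarith [Real.neg_one_le_cos θ]

lemma one_lt_eta (hα : 0 < α) (hα1 : α < 1) {θ : ℝ} (hθ : θ ∈ Ioo 0 Real.pi) : 1 < eta α θ := by
  refine lt_of_le_of_ne (one_le_eta hα hα1 θ) fun h => ?_
  have h2 := eta_cubic hα hα1 θ
  rw [← h] at h2
  have h3 : -1 < Real.cos θ := by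
    rw [← Real.cos_pi]
    exact Real.cos_lt_cos_of_nonneg_of_le_pi hθ.1.le le_rfl hθ.2
  nlinarith

lemma contDiff_eta (hα : 0 < α) (hα1 : α < 1) : ContDiff ℝ 1 (eta α) := by
  refine contDiff_iff_contDiffAt.2 fun θ => ?_
  have habs := abs_lt.1 (abs_eta_arg_lt hα hα1 θ)
  have h1 : ContDiffAt ℝ 1 (fun θ => α * Real.cos θ / etaScale α ^ 3) θ :=
    (contDiffAt_const.mul Real.contDiff_cos.contDiffAt).div_const _
  have h2 : ContDiffAt ℝ 1 (fun θ => Real.arccos (α * Real.cos θ / etaScale α ^ 3)) θ :=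
    ContDiffAt.comp (g := Real.arccos) θ (Real.contDiffAt_arccos habs.1.ne' habs.2.ne) h1
  exact contDiffAt_const.mul (Real.contDiff_cos.contDiffAt.comp θ (h2.div_const 3))

/-- The value of `(1 + Z)² (1 + α Z) / Z` at `Z = e^{iθ} / η`. -/
noncomputable def curveY (α θ : ℝ) : ℝ :=
  (eta α θ ^ 2 - α) ^ 2 * (eta α θ ^ 2 - 1) / (α * eta α θ ^ 2)

/-- The point `e^{iθ} / η` on the critical curve. -/
noncomputable def curveZ (α θ : ℝ) : ℂ := Complex.exp (θ * Complex.I) / eta α θ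

lemma curveY_pos (hα : 0 < α) (hα1 : α < 1) {θ : ℝ} (hθ : θ ∈ Ioo 0 Real.pi) :
    0 < curveY α θ := by
  have h := one_lt_eta hα hα1 hθ
  have h1 : 0 < eta α θ ^ 2 - 1 := by nlinarith
  have h2 : 0 < eta α θ ^ 2 - α := by linarith
  rw [curveY]
  positivity

lemma curveY_injOn (hα : 0 < α) (hα1 : α < 1) : InjOn (curveY α) (Ioo 0 Real.pi) := by
  intro θ hθ θ' hθ' h
  have mono : ∀ p q : ℝ, 1 < p → p < q → (p - α) ^ 2 * (p - 1) / (α * p) <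
      (q - α) ^ 2 * (q - 1) / (α * q) := by
    intro p q hp hpq
    have e : ∀ p : ℝ, 0 < p → (p - α) ^ 2 * (p - 1) / (α * p) = (p - α) ^ 2 / α * (1 - 1 / p) :=
      fun p hp => by field_simp
    rw [e p (by linarith), e q (by linarith)]
    have h1 : 1 / q < 1 / p := one_div_lt_one_div_of_lt (by linarith) hpq
    have h2 : 1 / p < 1 := by rw [div_lt_one (by linarith)]; exact hp
    have h3 : (p - α) ^ 2 / α < (q - α) ^ 2 / α := by
      have : 0 < p - α := by linarith
      gcongr
    have h4 : 0 < (p - α) ^ 2 / α := by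
      have : 0 < p - α := by linarith
      positivity
    have h5 : 0 < 1 - 1 / p := by linarith
    have h6 : 0 < (q - α) ^ 2 / α := h4.trans h3
    nlinarith
  have h1 := one_lt_eta hα hα1 hθ
  have h2 := one_lt_eta hα hα1 hθ'
  have hsq : eta α θ ^ 2 = eta α θ' ^ 2 := by
    rcases lt_trichotomy (eta α θ ^ 2) (eta α θ' ^ 2) with hl | he | hg
    · exact absurd h (mono _ _ (by nlinarith) hl).ne
    · exact he
    · exact absurd h (mono _ _ (by nlinarith) hg).ne'
  have heq : eta α θ = eta α θ' := by nlinarith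
  have h3 := eta_cubic hα hα1 θ
  have h4 := eta_cubic hα hα1 θ'
  rw [heq, h4] at h3
  have hcos : Real.cos θ = Real.cos θ' := by
    have : (2 * α) ≠ 0 := by positivity
    exact (mul_left_cancel₀ this h3).symm
  exact Real.injOn_cos (Ioo_subset_Icc_self hθ) (Ioo_subset_Icc_self hθ') hcos

lemma curveZ_re (α θ : ℝ) : (curveZ α θ).re = Real.cos θ / eta α θ := by
  rw [curveZ, Complex.div_ofReal_re, Complex.exp_ofReal_mul_I_re]

lemma curveZ_im (α θ : ℝ) : (curveZ α θ).im = Real.sin θ / eta α θ := by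
  rw [curveZ, Complex.div_ofReal_im, Complex.exp_ofReal_mul_I_im]

lemma norm_curveZ (hα : 0 < α) (hα1 : α < 1) (θ : ℝ) : ‖curveZ α θ‖ = 1 / eta α θ := by
  have := one_le_eta hα hα1 θ
  rw [curveZ, norm_div, Complex.norm_exp_ofReal_mul_I, Complex.norm_real,
    Real.norm_of_nonneg (by linarith)]

lemma cubicFactors_curve (hα : 0 < α) (hα1 : α < 1) (θ : ℝ) :
    CubicFactors α (curveY α θ) (curveZ α θ) (conj (curveZ α θ))
      ((-(eta α θ ^ 2 / α) : ℝ) : ℂ) := by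
  intro Z
  have h1 := one_le_eta hα hα1 θ
  have h0 : eta α θ ≠ 0 := by linarith
  have e1 : curveZ α θ + conj (curveZ α θ) = (2 * Real.cos θ / eta α θ : ℝ) := by
    rw [Complex.add_conj, curveZ_re]; push_cast; ring
  have e2 : curveZ α θ * conj (curveZ α θ) = (1 / eta α θ ^ 2 : ℝ) := by
    rw [Complex.mul_conj, Complex.normSq_eq_norm_sq, norm_curveZ hα hα1, div_pow, one_pow]
  have e3 : (Z - curveZ α θ) * (Z - conj (curveZ α θ)) =
      Z ^ 2 - (2 * Real.cos θ / eta α θ : ℝ) * Z + (1 / eta α θ ^ 2 : ℝ) := by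
    rw [← e1, ← e2]; ring
  have hc : Real.cos θ = (eta α θ ^ 3 - (1 + 2 * α) * eta α θ) / (2 * α) := by
    rw [eta_cubic hα hα1]; field_simp
  rw [e3, hc, curveY]
  have h0' : (eta α θ : ℂ) ≠ 0 := by exact_mod_cast h0
  have hα' : (α : ℂ) ≠ 0 := by exact_mod_cast hα.ne'
  push_cast
  field_simp
  ring

lemma norm_curveZ_lt (hα : 0 < α) (hα1 : α < 1) {θ : ℝ} (hθ : θ ∈ Ioo 0 Real.pi) :
    ‖curveZ α θ‖ < 1 ∧ 1 < ‖((-(eta α θ ^ 2 / α) : ℝ) : ℂ)‖ ∧ 0 < (curveZ α θ).im := by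
  have h := one_lt_eta hα hα1 hθ
  refine ⟨?_, ?_, ?_⟩
  · rw [norm_curveZ hα hα1, div_lt_one (by linarith)]; exact h
  · rw [Complex.norm_real, norm_neg, Real.norm_of_nonneg (by positivity), one_lt_div hα]
    nlinarith
  · rw [curveZ_im]
    exact div_pos (Real.sin_pos_of_mem_Ioo hθ) (by linarith)

/-- A positive `y` with two roots of equal modulus is on the curve or has a double root. -/
lemma CubicFactors.exists_theta (hα : 0 < α) (hα1 : α < 1) {y : ℝ} {z₀ z₁ z₂ : ℂ}
    (h : CubicFactors α y z₀ z₁ z₂) (hn : ‖z₀‖ = ‖z₁‖) (hy : 0 < y) :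
    (∃ r : ℝ, 2 * α * r ^ 2 + r - 1 = 0 ∧ y = (1 + r) ^ 2 * (1 + α * r) / r) ∨
      ∃ θ ∈ Ioo 0 Real.pi, y = curveY α θ := by
  have hconj := h.eq_conj hα hn
  rcases eq_or_ne z₀.im 0 with him | him
  · left
    have h1 : z₁ = z₀ := by rw [hconj]; exact Complex.conj_eq_iff_im.2 him
    have h2 := h.eq₀
    have h0 := h.ne_zero.1
    rw [h1] at h
    have hre : z₀ = (z₀.re : ℂ) := Complex.ext rfl (by simp [him])
    have hr0 : z₀.re ≠ 0 := fun h' => h0 (by rw [hre, h', Complex.ofReal_zero])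
    rw [hre] at h2
    have h3 : (1 + z₀.re) ^ 2 * (1 + α * z₀.re) = y * z₀.re := by exact_mod_cast h2
    refine ⟨z₀.re, ?_, by rw [h3, mul_div_cancel_right₀ _ hr0]⟩
    rcases (h.double hα).2 with h4 | h4
    · rw [h4] at h3
      norm_num at h3
      exact absurd h3 hy.ne'
    · exact h4
  · right
    set ρ := ‖z₀‖ with hρ
    have hρ0 : 0 < ρ := norm_pos_iff.2 h.ne_zero.1
    have hρsq : ρ ^ 2 = z₀.re ^ 2 + z₀.im ^ 2 := by
      rw [hρ, ← Complex.normSq_eq_norm_sq, Complex.normSq_apply]; ring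
    have hlt : |z₀.re / ρ| < 1 := by
      rw [abs_div, abs_of_pos hρ0, div_lt_one hρ0]
      exact abs_lt_of_sq_lt_sq (by rw [hρsq]; have := sq_pos_of_ne_zero him; linarith) hρ0.le
    rw [abs_lt] at hlt
    have e1 : z₀ + z₁ = (2 * z₀.re : ℝ) := by rw [hconj, Complex.add_conj]
    have e2 : z₀ * z₁ = (ρ ^ 2 : ℝ) := by
      rw [hconj, Complex.mul_conj, Complex.normSq_eq_norm_sq]
    have hα' : (α : ℂ) ≠ 0 := by exact_mod_cast hα.ne'
    have hρ' : (ρ : ℂ) ≠ 0 := by exact_mod_cast hρ0.ne'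
    have e3 : z₂ = (-1 / (α * ρ ^ 2) : ℝ) := by
      have := h.prod
      rw [e2] at this
      push_cast at this ⊢
      field_simp
      linear_combination this
    have s1 : α * (2 * z₀.re + -1 / (α * ρ ^ 2)) = -(1 + 2 * α) := by
      have := h.sum
      rw [e1, e3] at this
      exact_mod_cast this
    have s2 : α * (ρ ^ 2 + 2 * z₀.re * (-1 / (α * ρ ^ 2))) = 2 + α - y := by
      have := h.pairs
      rw [show z₀ * z₁ + z₀ * z₂ + z₁ * z₂ = z₀ * z₁ + (z₀ + z₁) * z₂ by ring, e1, e2, e3] at this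
      exact_mod_cast this
    have hrho2 : z₀.re = (1 / ρ ^ 2 - (1 + 2 * α)) / (2 * α) := by
      field_simp at s1 ⊢
      linarith
    have hyE : y = ((1 / ρ) ^ 2 - α) ^ 2 * ((1 / ρ) ^ 2 - 1) / (α * (1 / ρ) ^ 2) := by
      rw [hrho2] at s2
      field_simp at s2 ⊢
      linear_combination s2
    have hη : 1 ≤ 1 / ρ := by
      by_contra! hcon
      have : (1 / ρ) ^ 2 - 1 ≤ 0 := by nlinarith [one_div_pos.2 hρ0]
      have : y ≤ 0 := by
        rw [hyE]
        exact div_nonpos_of_nonpos_of_nonneg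
          (mul_nonpos_of_nonneg_of_nonpos (sq_nonneg _) this) (by positivity)
      linarith
    refine ⟨Real.arccos (z₀.re / ρ), ⟨Real.arccos_pos.2 hlt.2, ?_⟩, ?_⟩
    · refine lt_of_le_of_ne (Real.arccos_le_pi _) fun h => ?_
      rw [Real.arccos_eq_pi] at h
      linarith
    · have : eta α (Real.arccos (z₀.re / ρ)) = 1 / ρ := by
        refine eta_unique hα hα1 hη ?_
        rw [Real.cos_arccos hlt.1.le hlt.2.le, hrho2]
        field_simp
      rw [curveY, this, hyE]

/-- On the curve, the two roots of smallest modulus have equal modulus. -/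
lemma CubicFactors.norm_eq_of_curve (hα : 0 < α) (hα1 : α < 1) {θ : ℝ} {z₀ z₁ z₂ : ℂ}
    (hθ : θ ∈ Ioo 0 Real.pi)
    (h : CubicFactors α (curveY α θ) z₀ z₁ z₂) (h01 : ‖z₀‖ ≤ ‖z₁‖) (h12 : ‖z₁‖ ≤ ‖z₂‖) :
    ‖z₀‖ = ‖z₁‖ := by
  obtain ⟨h1, h2, h3⟩ := norm_curveZ_lt hα hα1 hθ
  have hne : curveZ α θ ≠ conj (curveZ α θ) := fun e => by
    have := congrArg Complex.im e
    rw [Complex.conj_im] at this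
    linarith
  obtain ⟨-, ⟨rfl, rfl⟩ | ⟨rfl, rfl⟩⟩ := h.labeled_eq hα (cubicFactors_curve hα hα1 θ) h01 h12 hne
    (by linarith) (by rw [RCLike.norm_conj]; linarith)
  · exact (RCLike.norm_conj _).symm
  · exact RCLike.norm_conj _

end eta
/-! ### The labelled roots -/

lemma sin_sq_mem {t : ℝ} (ht : t ∈ Ioo 0 (Real.pi / 2)) :
    0 < Real.sin t ^ 2 ∧ Real.sin t ^ 2 < 1 := by
  have h1 : 0 < Real.sin t := Real.sin_pos_of_mem_Ioo ⟨ht.1, by linarith [ht.2, Real.pi_pos]⟩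
  have h2 : 0 < Real.cos t := Real.cos_pos_of_mem_Ioo ⟨by linarith [ht.1, Real.pi_pos], ht.2⟩
  have h3 := Real.sin_sq_add_cos_sq t
  exact ⟨by positivity, by nlinarith⟩

lemma one_add_tan_sq {t : ℝ} (ht : t ∈ Ioo 0 (Real.pi / 2)) :
    Real.tan t ^ 2 = Real.sin t ^ 2 * (1 + Real.tan t ^ 2) := by
  have h2 : 0 < Real.cos t := Real.cos_pos_of_mem_Ioo ⟨by linarith [ht.1, Real.pi_pos], ht.2⟩
  have h3 := Real.sin_sq_add_cos_sq t
  rw [Real.tan_eq_sin_div_cos, div_pow]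
  field_simp
  linear_combination -Real.sin t ^ 2 * h3

lemma coeffA_sq {t : ℝ} (ht : t ∈ Ioo 0 (Real.pi / 2)) (s : ℝ) :
    coeffA t s ^ 2 = Real.sin t ^ 2 * coeffB t s := by
  have := one_add_tan_sq ht
  rw [coeffA, coeffB]
  linear_combination (s ^ 2 / 4) * this

lemma coeffB_pos (t : ℝ) {s : ℝ} (hs : 0 < s) : 0 < coeffB t s := by
  rw [coeffB]; positivity

lemma cubic_eq (t s : ℝ) (x : ℂ) : cubic t s x =
    C ((coeffB t s : ℂ) ^ 2 * (coeffA t s : ℂ) ^ 2) * X ^ 3 +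
    C ((coeffB t s : ℂ) ^ 2 + 2 * coeffB t s * (coeffA t s : ℂ) ^ 2) * X ^ 2 +
    C (2 * coeffB t s + (coeffA t s : ℂ) ^ 2 - x ^ 2) * X + C 1 := by
  simp only [cubic, map_add, map_mul, map_sub, map_pow, map_one, map_ofNat]
  ring

lemma cubic_lead_ne_zero {t s : ℝ} (ht : t ∈ Ioo 0 (Real.pi / 2)) (hs : 0 < s) :
    (coeffB t s : ℂ) ^ 2 * (coeffA t s : ℂ) ^ 2 ≠ 0 := by
  have h1 := coeffB_pos t hs
  have h2 := coeffA_sq ht s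
  have h3 := (sin_sq_mem ht).1
  have : coeffB t s ^ 2 * coeffA t s ^ 2 ≠ 0 := by rw [h2]; positivity
  exact_mod_cast this

lemma exists_sorted (a b c : ℂ) : ∃ z : Fin 3 → ℂ, ({a, b, c} : Multiset ℂ) = {z 0, z 1, z 2} ∧
    ‖z 0‖ ≤ ‖z 1‖ ∧ ‖z 1‖ ≤ ‖z 2‖ := by
  have swap01 : ∀ a b c : ℂ, ({a, b, c} : Multiset ℂ) = {b, a, c} := fun a b c =>
    Multiset.cons_swap a b {c}
  have swap12 : ∀ a b c : ℂ, ({a, b, c} : Multiset ℂ) = {a, c, b} := fun a b c =>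
    congrArg (Multiset.cons a) (Multiset.pair_comm b c)
  rcases le_total ‖a‖ ‖b‖ with h1 | h1 <;> rcases le_total ‖b‖ ‖c‖ with h2 | h2 <;>
    rcases le_total ‖a‖ ‖c‖ with h3 | h3
  · exact ⟨![a, b, c], rfl, h1, h2⟩
  · exact ⟨![a, b, c], rfl, h1, h2⟩
  · exact ⟨![a, c, b], swap12 a b c, h3, h2⟩
  · exact ⟨![c, a, b], (swap12 a b c).trans (swap01 a c b), h3, h1⟩
  · exact ⟨![b, a, c], swap01 a b c, h1, h3⟩
  · exact ⟨![b, c, a], (swap01 a b c).trans (swap12 b a c), h2, h3⟩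
  · exact ⟨![c, b, a], (swap01 a b c).trans ((swap12 b a c).trans (swap01 b c a)), h2, h1⟩
  · exact ⟨![c, b, a], (swap01 a b c).trans ((swap12 b a c).trans (swap01 b c a)), h2, h1⟩

lemma isLabeling_rootZ {t s : ℝ} (ht : t ∈ Ioo 0 (Real.pi / 2)) (hs : 0 < s) (x : ℂ) :
    IsLabeling t s x (rootZ t s x) := by
  have hex : ∃ z, IsLabeling t s x z := by
    have hcard : (cubic t s x).roots.card = 3 := by
      rw [← (IsAlgClosed.splits _).natDegree_eq_card_roots, cubic_eq,
        natDegree_cubic (cubic_lead_ne_zero ht hs)]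
    obtain ⟨a, b, c, h⟩ := Multiset.card_eq_three.1 hcard
    obtain ⟨z, h1, h2⟩ := exists_sorted a b c
    exact ⟨z, h.trans h1, h2⟩
  rw [rootZ, dif_pos hex]
  exact hex.choose_spec

/-- The labelled roots, rescaled by `b_s`, factor the normalized cubic. -/
lemma cubicFactors_rootZ {t s : ℝ} (ht : t ∈ Ioo 0 (Real.pi / 2)) (hs : 0 < s) (x : ℂ) :
    CubicFactors (Real.sin t ^ 2) (x ^ 2 / coeffB t s) (coeffB t s * rootZ t s x 0)
      (coeffB t s * rootZ t s x 1) (coeffB t s * rootZ t s x 2) := by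
  intro Z
  have hb := coeffB_pos t hs
  have hb' : (coeffB t s : ℂ) ≠ 0 := by exact_mod_cast hb.ne'
  have hA : (coeffA t s : ℂ) ^ 2 = (Real.sin t ^ 2 : ℝ) * coeffB t s := by
    exact_mod_cast coeffA_sq ht s
  have h := congrArg (Polynomial.eval (Z / coeffB t s)) (IsAlgClosed.splits (cubic t s x)).eq_prod_roots
  rw [(isLabeling_rootZ ht hs x).1] at h
  have hl : (cubic t s x).leadingCoeff = (coeffB t s : ℂ) ^ 2 * (coeffA t s : ℂ) ^ 2 := by
    rw [cubic_eq, leadingCoeff_cubic (cubic_lead_ne_zero ht hs)]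
  rw [hl, hA] at h
  simp only [cubic, hA, eval_add, eval_sub, eval_mul, eval_pow, eval_C, eval_X, eval_one,
    Multiset.insert_eq_cons, Multiset.map_cons, Multiset.prod_cons, Multiset.map_singleton,
    Multiset.prod_singleton] at h
  field_simp at h ⊢
  linear_combination h

lemma norm_coeffB_mul_le (t s : ℝ) {z w : ℂ} (h : ‖z‖ ≤ ‖w‖) :
    ‖(coeffB t s : ℂ) * z‖ ≤ ‖(coeffB t s : ℂ) * w‖ := by
  rw [norm_mul, norm_mul]
  exact mul_le_mul_of_nonneg_left h (norm_nonneg _)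

lemma mem_gammaOne_iff {t s : ℝ} (hs : 0 < s) (x : ℂ) : x ∈ gammaOne t s ↔
    ‖(coeffB t s : ℂ) * rootZ t s x 0‖ = ‖(coeffB t s : ℂ) * rootZ t s x 1‖ := by
  have : ‖(coeffB t s : ℂ)‖ ≠ 0 := by
    rw [norm_ne_zero_iff]; exact_mod_cast (coeffB_pos t hs).ne'
  rw [norm_mul, norm_mul, mul_right_inj' this]
  rfl

lemma gammaOne_subset_real {t s : ℝ} (ht : t ∈ Ioo 0 (Real.pi / 2)) (hs : 0 < s) {x : ℂ}
    (hx : x ∈ gammaOne t s) : x.im = 0 := by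
  obtain ⟨hα, hα1⟩ := sin_sq_mem ht
  have hb := coeffB_pos t hs
  have hn := (mem_gammaOne_iff hs x).1 hx
  have hf := cubicFactors_rootZ ht hs x
  have h1 := hf.im_eq_zero hα hn
  have h2 := hf.re_nonneg hα hα1 hn (norm_coeffB_mul_le t s (isLabeling_rootZ ht hs x).2.2)
  rw [Complex.div_ofReal_im, div_eq_zero_iff, or_iff_left hb.ne'] at h1
  rw [Complex.div_ofReal_re, le_div_iff₀ hb, zero_mul] at h2
  simp [pow_two] at h1 h2
  have h3 : x.re * x.im = 0 := by linarith
  rcases mul_eq_zero.1 h3 with h | h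
  · rw [h] at h2
    nlinarith [sq_nonneg x.im]
  · exact h

/-- The support point with parameter `θ`. -/
noncomputable def curveX (t s θ : ℝ) : ℝ := √(coeffB t s * curveY (Real.sin t ^ 2) θ)

lemma curveX_pos {t s : ℝ} (ht : t ∈ Ioo 0 (Real.pi / 2)) (hs : 0 < s) {θ : ℝ}
    (hθ : θ ∈ Ioo 0 Real.pi) : 0 < curveX t s θ := by
  obtain ⟨hα, hα1⟩ := sin_sq_mem ht
  exact Real.sqrt_pos.2 (mul_pos (coeffB_pos t hs) (curveY_pos hα hα1 hθ))

lemma curveX_sq {t s : ℝ} (ht : t ∈ Ioo 0 (Real.pi / 2)) (hs : 0 < s) {θ : ℝ}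
    (hθ : θ ∈ Ioo 0 Real.pi) : curveX t s θ ^ 2 = coeffB t s * curveY (Real.sin t ^ 2) θ := by
  obtain ⟨hα, hα1⟩ := sin_sq_mem ht
  exact Real.sq_sqrt (mul_pos (coeffB_pos t hs) (curveY_pos hα hα1 hθ)).le

/-- The finite set of exceptional points. -/
noncomputable def exceptionalSet (t s : ℝ) : Set ℝ :=
  {0} ∪ {x | ∃ r : ℝ, 2 * Real.sin t ^ 2 * r ^ 2 + r - 1 = 0 ∧
    x ^ 2 = coeffB t s * ((1 + r) ^ 2 * (1 + Real.sin t ^ 2 * r) / r)}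

lemma finite_exceptionalSet {t : ℝ} (s : ℝ) :
    (exceptionalSet t s).Finite := by
  refine (finite_singleton 0).union ?_
  have h1 : {r : ℝ | 2 * Real.sin t ^ 2 * r ^ 2 + r - 1 = 0}.Finite := by
    have hp : (C (2 * Real.sin t ^ 2) * X ^ 2 + X - 1 : ℝ[X]) ≠ 0 := fun h => by
      have := congrArg (Polynomial.eval 0) h
      simp at this
    refine (Polynomial.finite_setOfPred_isRoot hp).subset fun r hr => ?_
    simpa [IsRoot] using hr
  have h2 : ∀ c : ℝ, {x : ℝ | x ^ 2 = c}.Finite := fun c => by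
    have hp : (X ^ 2 - C c : ℝ[X]) ≠ 0 := (monic_X_pow_sub_C c two_ne_zero).ne_zero
    refine (Polynomial.finite_setOfPred_isRoot hp).subset fun r hr => ?_
    have : r ^ 2 = c := hr
    simp [IsRoot, this]
  refine (h1.biUnion fun r _ => h2 (coeffB t s * ((1 + r) ^ 2 * (1 + Real.sin t ^ 2 * r) / r))).subset
    fun x hx => ?_
  obtain ⟨r, hr, hx⟩ := hx
  exact mem_biUnion (x := r) hr hx

lemma exists_theta_of_mem_gammaOne {t s : ℝ} (ht : t ∈ Ioo 0 (Real.pi / 2)) (hs : 0 < s) {x : ℝ}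
    (hx : (x : ℂ) ∈ gammaOne t s) (hF : x ∉ exceptionalSet t s) :
    ∃ θ ∈ Ioo 0 Real.pi, x ^ 2 = coeffB t s * curveY (Real.sin t ^ 2) θ := by
  obtain ⟨hα, hα1⟩ := sin_sq_mem ht
  have hb := coeffB_pos t hs
  have hx0 : x ≠ 0 := fun h => hF (Or.inl h)
  have hn := (mem_gammaOne_iff hs _).1 hx
  have hf := cubicFactors_rootZ ht hs x
  have e : (x : ℂ) ^ 2 / coeffB t s = ((x ^ 2 / coeffB t s : ℝ) : ℂ) := by push_cast; rfl
  rw [e] at hf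
  rcases hf.exists_theta hα hα1 hn (by positivity) with ⟨r, h1, h2⟩ | ⟨θ, h1, h2⟩
  · exact absurd (Or.inr ⟨r, h1, by rw [← h2]; field_simp⟩) hF
  · exact ⟨θ, h1, by rw [← h2]; field_simp⟩

lemma mem_gammaOne_of_theta {t s : ℝ} (ht : t ∈ Ioo 0 (Real.pi / 2)) (hs : 0 < s) {x θ : ℝ}
    (hθ : θ ∈ Ioo 0 Real.pi) (hx : x ^ 2 = coeffB t s * curveY (Real.sin t ^ 2) θ) :
    (x : ℂ) ∈ gammaOne t s := by
  obtain ⟨hα, hα1⟩ := sin_sq_mem ht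
  have hb := coeffB_pos t hs
  have hf := cubicFactors_rootZ ht hs x
  have hl := (isLabeling_rootZ ht hs x).2
  have e : (x : ℂ) ^ 2 / coeffB t s = (curveY (Real.sin t ^ 2) θ : ℂ) := by
    rw [div_eq_iff (by exact_mod_cast hb.ne')]
    exact_mod_cast hx.trans (mul_comm _ _)
  rw [e] at hf
  exact (mem_gammaOne_iff hs _).2 (hf.norm_eq_of_curve hα hα1 hθ
    (norm_coeffB_mul_le t s hl.1) (norm_coeffB_mul_le t s hl.2))

/-! ### Local branches -/

lemma exists_local_branch {α : ℝ} (hα : 0 < α) (hα1 : α < 1) {θ : ℝ} (hθ : θ ∈ Ioo 0 Real.pi) :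
    ∃ ψ : ℂ → ℂ, ContDiffAt ℂ 1 ψ (curveY α θ) ∧ ψ (curveY α θ) = curveZ α θ ∧
      ∀ᶠ y in 𝓝 (curveY α θ : ℂ), (1 + ψ y) ^ 2 * (1 + α * ψ y) = y * ψ y := by
  set z := curveZ α θ with hz
  have him : 0 < z.im := (norm_curveZ_lt hα hα1 hθ).2.2
  have hz0 : z ≠ 0 := fun h => by rw [h] at him; simp at him
  set φ : ℂ → ℂ := fun Z => (1 + Z) ^ 2 * (1 + α * Z) / Z with hφ
  have hφz : φ z = curveY α θ := by
    rw [hφ]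
    simp only
    rw [(cubicFactors_curve hα hα1 θ).eq₀, mul_div_cancel_right₀ _ hz0]
  have hd : HasDerivAt φ ((1 + z) * (2 * α * z ^ 2 + z - 1) / z ^ 2) z := by
    have h1 : HasDerivAt (fun Z : ℂ => 1 + Z) 1 z := (hasDerivAt_id z).const_add 1
    have h2 : HasDerivAt (fun Z : ℂ => 1 + α * Z) α z := by
      simpa using ((hasDerivAt_id z).const_mul (α : ℂ)).const_add 1
    refine (((h1.pow 2).mul h2).div (hasDerivAt_id z) hz0).congr_deriv ?_
    simp only [Pi.mul_apply, Pi.pow_apply, id]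
    push_cast
    field_simp
    ring
  have hd0 : (1 + z) * (2 * α * z ^ 2 + z - 1) / z ^ 2 ≠ 0 := by
    refine div_ne_zero (mul_ne_zero (fun h => ?_) fun h => ?_) (pow_ne_zero 2 hz0)
    · have := congrArg Complex.im h
      simp at this
      linarith
    · exact him.ne' (im_eq_zero_of_quadratic hα h)
  have hc : ContDiffAt ℂ 1 φ z :=
    ContDiffAt.div (by fun_prop) contDiffAt_id hz0
  have hfd := hd.hasFDerivAt_equiv hd0
  have hcd : ContDiffAt ℂ 1 (hc.localInverse hfd one_ne_zero) (curveY α θ) := by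
    rw [← hφz]; exact hc.to_localInverse hfd one_ne_zero
  have hval : hc.localInverse hfd one_ne_zero (curveY α θ) = z := by
    rw [← hφz]; exact hc.localInverse_apply_image hfd one_ne_zero
  refine ⟨hc.localInverse hfd one_ne_zero, hcd, hval, ?_⟩
  have hr := (hc.hasStrictFDerivAt' hfd one_ne_zero).eventually_right_inverse
  rw [hφz] at hr
  have hne := hcd.continuousAt.eventually_ne (hval.trans_ne hz0)
  filter_upwards [hr, hne] with y hy hy0
  exact (div_eq_iff hy0).1 hy
/-! ### Boundary values from reflected branches -/

/-- Near `x₀` the function `f` agrees with `u` in the upper half plane and with the reflection of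
`u` in the lower half plane. -/
structure ReflectedBranch (f u : ℂ → ℂ) (x₀ r : ℝ) : Prop where
  r_pos : 0 < r
  diff : DifferentiableOn ℂ u (Metric.ball (x₀ : ℂ) r)
  above : ∀ w ∈ Metric.ball (x₀ : ℂ) r, 0 < w.im → f w = u w
  below : ∀ w ∈ Metric.ball (x₀ : ℂ) r, w.im < 0 → f w = conj (u (conj w))

lemma conj_mem_ball {x₀ r : ℝ} {w : ℂ} (hw : w ∈ Metric.ball (x₀ : ℂ) r) :
    conj w ∈ Metric.ball (x₀ : ℂ) r := by
  rw [Metric.mem_ball, dist_eq_norm] at hw ⊢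
  rwa [show conj w - (x₀ : ℂ) = conj (w - x₀) by simp, RCLike.norm_conj]

instance fromAbove_neBot (x : ℝ) : (fromAbove x).NeBot := by
  refine mem_closure_iff_nhdsWithin_neBot.1 ?_
  rw [Complex.closure_setOfPred_lt_im]
  simp

instance fromBelow_neBot (x : ℝ) : (fromBelow x).NeBot := by
  refine mem_closure_iff_nhdsWithin_neBot.1 ?_
  rw [Complex.closure_setOfPred_im_lt]
  simp

namespace ReflectedBranch

variable {f u : ℂ → ℂ} {x₀ r : ℝ}

lemma isOpen_upper : IsOpen (Metric.ball (x₀ : ℂ) r ∩ {w | 0 < w.im}) :=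
  Metric.isOpen_ball.inter (isOpen_lt continuous_const Complex.continuous_im)

lemma isOpen_lower : IsOpen (Metric.ball (x₀ : ℂ) r ∩ {w | w.im < 0}) :=
  Metric.isOpen_ball.inter (isOpen_lt Complex.continuous_im continuous_const)

lemma upper_mem (h : ReflectedBranch f u x₀ r) :
    Metric.ball (x₀ : ℂ) r ∩ {w | 0 < w.im} ∈ fromAbove x₀ :=
  inter_mem (nhdsWithin_le_nhds (Metric.ball_mem_nhds _ h.r_pos)) self_mem_nhdsWithin

lemma lower_mem (h : ReflectedBranch f u x₀ r) :
    Metric.ball (x₀ : ℂ) r ∩ {w | w.im < 0} ∈ fromBelow x₀ :=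
  inter_mem (nhdsWithin_le_nhds (Metric.ball_mem_nhds _ h.r_pos)) self_mem_nhdsWithin

lemma continuousAt (h : ReflectedBranch f u x₀ r) : ContinuousAt u x₀ :=
  (h.diff.differentiableAt (Metric.ball_mem_nhds _ h.r_pos)).continuousAt

lemma continuousAt_deriv (h : ReflectedBranch f u x₀ r) : ContinuousAt (deriv u) x₀ :=
  ((h.diff.deriv Metric.isOpen_ball).differentiableAt
    (Metric.ball_mem_nhds _ h.r_pos)).continuousAt

lemma continuousAt_reflect {g : ℂ → ℂ} (hg : ContinuousAt g x₀) :
    Tendsto (fun w => conj (g (conj w))) (𝓝 (x₀ : ℂ)) (𝓝 (conj (g x₀))) := by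
  have h1 : Tendsto (fun w : ℂ => conj w) (𝓝 (x₀ : ℂ)) (𝓝 (x₀ : ℂ)) := by
    have := Complex.continuous_conj.tendsto (x₀ : ℂ)
    rwa [Complex.conj_ofReal] at this
  exact (Complex.continuous_conj.tendsto _).comp (hg.tendsto.comp h1)

lemma tendsto_above (h : ReflectedBranch f u x₀ r) : Tendsto f (fromAbove x₀) (𝓝 (u x₀)) :=
  (h.continuousAt.tendsto.mono_left nhdsWithin_le_nhds).congr' <| by
    filter_upwards [h.upper_mem] with w hw using (h.above w hw.1 hw.2).symm

lemma tendsto_below (h : ReflectedBranch f u x₀ r) :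
    Tendsto f (fromBelow x₀) (𝓝 (conj (u x₀))) :=
  ((continuousAt_reflect h.continuousAt).mono_left nhdsWithin_le_nhds).congr' <| by
    filter_upwards [h.lower_mem] with w hw using (h.below w hw.1 hw.2).symm

lemma tendsto_deriv_above (h : ReflectedBranch f u x₀ r) :
    Tendsto (deriv f) (fromAbove x₀) (𝓝 (deriv u x₀)) :=
  (h.continuousAt_deriv.tendsto.mono_left nhdsWithin_le_nhds).congr' <| by
    filter_upwards [h.upper_mem] with w hw
    refine (Filter.EventuallyEq.deriv_eq ?_).symm
    filter_upwards [isOpen_upper.mem_nhds hw] with v hv using h.above v hv.1 hv.2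

lemma tendsto_deriv_below (h : ReflectedBranch f u x₀ r) :
    Tendsto (deriv f) (fromBelow x₀) (𝓝 (conj (deriv u x₀))) :=
  ((continuousAt_reflect h.continuousAt_deriv).mono_left nhdsWithin_le_nhds).congr' <| by
    filter_upwards [h.lower_mem] with w hw
    have : deriv f w = deriv (conj ∘ u ∘ conj) w := by
      refine Filter.EventuallyEq.deriv_eq ?_
      filter_upwards [isOpen_lower.mem_nhds hw] with v hv using h.below v hv.1 hv.2
    rw [this, deriv_conj_conj]
    rfl

lemma density_eq {t s : ℝ} (h : ReflectedBranch (zOne t s) u x₀ r) :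
    densityOne t s x₀ = ((deriv u x₀ / u x₀).im / (2 * Real.pi) : ℝ) := by
  rw [densityOne, h.tendsto_above.limUnder_eq, h.tendsto_below.limUnder_eq,
    h.tendsto_deriv_above.limUnder_eq, h.tendsto_deriv_below.limUnder_eq, ← map_div₀,
    Complex.sub_conj]
  have : (Real.pi : ℂ) ≠ 0 := by exact_mod_cast Real.pi_ne_zero
  push_cast
  field_simp

/-- The modulus of `u` decreases in the direction of the upper half plane. -/
lemma im_nonneg (h : ReflectedBranch f u x₀ r)
    (hle : ∀ w ∈ Metric.ball (x₀ : ℂ) r, 0 < w.im → ‖u w‖ ≤ ‖u (conj w)‖) :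
    0 ≤ (deriv u x₀ / u x₀).im := by
  have hu : HasDerivAt u (deriv u x₀) x₀ :=
    (h.diff.differentiableAt (Metric.ball_mem_nhds _ h.r_pos)).hasDerivAt
  have key : ∀ c : ℂ, HasDerivAt (fun y : ℝ => ‖u (x₀ + c * y)‖ ^ 2)
      (2 * (conj (u x₀) * (deriv u x₀ * c)).re) 0 := by
    intro c
    have h1 : HasDerivAt (fun y : ℝ => (x₀ : ℂ) + c * y) c 0 := by
      simpa using ((Complex.ofRealCLM.hasDerivAt (x := (0:ℝ))).const_mul c).const_add (x₀ : ℂ)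
    have h2 : HasDerivAt (fun y : ℝ => u (x₀ + c * y)) (deriv u x₀ * c) 0 := by
      have hu' : HasDerivAt u (deriv u x₀) ((x₀ : ℂ) + c * (0 : ℝ)) := by simpa using hu
      exact hu'.comp (0 : ℝ) h1
    have h3 := h2.norm_sq
    simp only [Complex.ofReal_zero, mul_zero, add_zero] at h3
    refine h3.congr_deriv ?_
    simp only [Complex.inner, mul_comm]
  have hd := (key Complex.I).sub (key (-Complex.I))
  have hge := hd.tendsto_slope_zero_right
  have hle' : 2 * (conj (u x₀) * (deriv u x₀ * Complex.I)).re -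
      2 * (conj (u x₀) * (deriv u x₀ * -Complex.I)).re ≤ 0 := by
    refine le_of_tendsto hge ?_
    have hr : Ioo (0 : ℝ) r ∈ 𝓝[>] (0 : ℝ) := Ioo_mem_nhdsGT h.r_pos
    filter_upwards [hr] with y hy
    have hb : (x₀ : ℂ) + Complex.I * y ∈ Metric.ball (x₀ : ℂ) r := by
      simp [abs_of_pos hy.1, hy.2]
    have h4 := hle _ hb (by simpa using hy.1)
    have h5 : conj ((x₀ : ℂ) + Complex.I * y) = x₀ + -Complex.I * y := by simp
    rw [h5] at h4
    have h6 : ‖u (x₀ + Complex.I * y)‖ ^ 2 ≤ ‖u (x₀ + -Complex.I * y)‖ ^ 2 := by gcongr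
    simp only [zero_add, Pi.sub_apply, Complex.ofReal_zero, mul_zero, add_zero, sub_self, sub_zero,
      smul_eq_mul]
    exact mul_nonpos_of_nonneg_of_nonpos (inv_nonneg.2 hy.1.le) (sub_nonpos.2 h6)
  have h7 : (deriv u x₀ / u x₀).im = -(conj (u x₀) * (deriv u x₀ * Complex.I)).re /
      Complex.normSq (u x₀) := by
    rw [Complex.div_im]
    simp
    ring
  rw [h7]
  refine div_nonneg ?_ (Complex.normSq_nonneg _)
  simp only [mul_neg, Complex.neg_re] at hle'
  linarith

lemma densityOneExists {t s : ℝ} (h : ReflectedBranch (zOne t s) u x₀ r) (h0 : u x₀ ≠ 0)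
    (hle : ∀ w ∈ Metric.ball (x₀ : ℂ) r, 0 < w.im → ‖u w‖ ≤ ‖u (conj w)‖) :
    DensityOneExists t s x₀ where
  above := ⟨_, h0, h.tendsto_above⟩
  below := ⟨_, by simpa using h0, h.tendsto_below⟩
  deriv_above := ⟨_, h.tendsto_deriv_above⟩
  deriv_below := ⟨_, h.tendsto_deriv_below⟩
  im_eq_zero := by rw [h.density_eq, Complex.ofReal_im]
  re_nonneg := by
    rw [h.density_eq, Complex.ofReal_re]
    exact div_nonneg (h.im_nonneg hle) (by positivity)

end ReflectedBranch

lemma cubicFactors_of_roots {α : ℝ} (hα : 0 < α) {y p q : ℂ} (hpq : p ≠ q) (hp0 : p ≠ 0)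
    (hq0 : q ≠ 0) (hp : (1 + p) ^ 2 * (1 + α * p) = y * p)
    (hq : (1 + q) ^ 2 * (1 + α * q) = y * q) :
    CubicFactors α y p q (-1 / (α * p * q)) := by
  have hα' : (α : ℂ) ≠ 0 := by exact_mod_cast hα.ne'
  have hd : p - q ≠ 0 := sub_ne_zero.2 hpq
  have h1 : α * p * q * (p + q) + (1 + 2 * α) * (p * q) = 1 := by
    refine mul_left_cancel₀ hd ?_
    linear_combination q * hp - p * hq
  have h2 : α * (p ^ 2 + p * q + q ^ 2) + (1 + 2 * α) * (p + q) + 2 + α - y = 0 := by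
    refine mul_left_cancel₀ hd ?_
    linear_combination hp - hq
  have h3 : -1 / (α * p * q) = -(p + q) - (1 + 2 * α) / α := by
    field_simp
    linear_combination h1
  intro Z
  rw [h3]
  have h4 : y = α * (p ^ 2 + p * q + q ^ 2) + (1 + 2 * α) * (p + q) + 2 + α := by
    linear_combination -h2
  rw [h4]
  field_simp
  linear_combination -h1

lemma eta_ne_zero {α : ℝ} (hα : 0 < α) (hα1 : α < 1) (θ : ℝ) : eta α θ ≠ 0 := by
  have := one_le_eta hα hα1 θ
  linarith

/-- The logarithmic derivative of `curveZ`. -/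
noncomputable def curveW (α θ : ℝ) : ℂ := Complex.I - ((deriv (eta α) θ / eta α θ : ℝ) : ℂ)

lemma hasDerivAt_curveZ {α : ℝ} (hα : 0 < α) (hα1 : α < 1) (θ : ℝ) :
    HasDerivAt (curveZ α) (curveZ α θ * curveW α θ) θ := by
  have h1 := ((contDiff_eta hα hα1).differentiable one_ne_zero θ).hasDerivAt
  have he0 : (eta α θ : ℂ) ≠ 0 := by exact_mod_cast eta_ne_zero hα hα1 θ
  have h2 : HasDerivAt (fun θ : ℝ => Complex.exp (θ * Complex.I))
      (Complex.exp (θ * Complex.I) * Complex.I) θ := by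
    have : HasDerivAt (fun θ : ℝ => (θ : ℂ) * Complex.I) Complex.I θ := by
      simpa using (Complex.ofRealCLM.hasDerivAt (x := θ)).mul_const Complex.I
    exact this.cexp
  refine (h2.div h1.ofReal_comp he0).congr_deriv ?_
  rw [curveZ, curveW]
  push_cast
  field_simp

lemma curveZ_ne_zero {α : ℝ} (hα : 0 < α) (hα1 : α < 1) (θ : ℝ) : curveZ α θ ≠ 0 :=
  div_ne_zero (Complex.exp_ne_zero _) (by exact_mod_cast eta_ne_zero hα hα1 θ)

lemma hasDerivAt_curveY {α : ℝ} (hα : 0 < α) (hα1 : α < 1) (θ : ℝ) :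
    HasDerivAt (curveY α) (deriv (curveY α) θ) θ := by
  have h1 : Differentiable ℝ (eta α) := (contDiff_eta hα hα1).differentiable one_ne_zero
  have h2 := one_le_eta hα hα1
  refine DifferentiableAt.hasDerivAt ?_
  unfold curveY
  refine DifferentiableAt.div (by fun_prop) (by fun_prop) ?_
  have : 0 < eta α θ := by linarith [h2 θ]
  positivity

/-- The derivative of a local branch along the curve. -/
lemma im_deriv_branch {α : ℝ} (hα : 0 < α) (hα1 : α < 1) {θ : ℝ} (hθ : θ ∈ Ioo 0 Real.pi)
    {ψ : ℂ → ℂ} (hd : DifferentiableAt ℂ ψ (curveY α θ)) (hv : ψ (curveY α θ) = curveZ α θ)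
    (he : ∀ᶠ y in 𝓝 (curveY α θ : ℂ), (1 + ψ y) ^ 2 * (1 + α * ψ y) = y * ψ y) :
    (deriv ψ (curveY α θ) / curveZ α θ).im * deriv (curveY α) θ = 1 := by
  have hZ := hasDerivAt_curveZ hα hα1 θ
  have hY := (hasDerivAt_curveY hα hα1 θ).ofReal_comp
  have hcomp : HasDerivAt (fun θ' => ψ (curveY α θ'))
      (deriv ψ (curveY α θ) * (deriv (curveY α) θ : ℝ)) θ := hd.hasDerivAt.comp θ hY
  have hcY : Tendsto (fun θ' => (curveY α θ' : ℂ)) (𝓝 θ) (𝓝 (curveY α θ : ℂ)) :=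
    hY.continuousAt
  have him : ∀ᶠ θ' in 𝓝 θ, 0 < (ψ (curveY α θ')).im := by
    have h1 : Tendsto (fun θ' => (ψ (curveY α θ')).im) (𝓝 θ) (𝓝 (curveZ α θ).im) := by
      rw [← hv]
      exact (Complex.continuous_im.tendsto _).comp hcomp.continuousAt
    exact h1.eventually (lt_mem_nhds (norm_curveZ_lt hα hα1 hθ).2.2)
  have heq : (fun θ' => ψ (curveY α θ')) =ᶠ[𝓝 θ] curveZ α := by
    filter_upwards [him, hcY.eventually he, Ioo_mem_nhds hθ.1 hθ.2] with θ' h1 h2 h3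
    rcases (cubicFactors_curve hα hα1 θ').root_cases hα h2 with h | h | h
    · exact h
    · have := (norm_curveZ_lt hα hα1 h3).2.2
      rw [h, Complex.conj_im] at h1
      linarith
    · rw [h, Complex.ofReal_im] at h1
      exact absurd h1 (lt_irrefl _)
  have h5 := (hcomp.congr_of_eventuallyEq heq.symm).unique hZ
  have h6 : (curveW α θ).im = 1 := by simp [curveW]
  rw [← h6, ← Complex.im_mul_ofReal, ← mul_div_right_comm, h5,
    mul_div_cancel_left₀ _ (curveZ_ne_zero hα hα1 θ)]

/-- The branch of the roots near a support point. -/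
lemma exists_ball_branch {α b : ℝ} (hα : 0 < α) (hα1 : α < 1) (hb : 0 < b) {θ x₀ : ℝ}
    (hθ : θ ∈ Ioo 0 Real.pi) (hx : x₀ ^ 2 = b * curveY α θ) :
    ∃ (ζ : ℂ → ℂ) (r : ℝ), 0 < r ∧ DifferentiableOn ℂ ζ (Metric.ball (x₀ : ℂ) r) ∧
      ζ x₀ = curveZ α θ ∧
      (∀ w ∈ Metric.ball (x₀ : ℂ) r, (1 + ζ w) ^ 2 * (1 + α * ζ w) = w ^ 2 / b * ζ w ∧
        0 < (ζ w).im ∧ ‖ζ w‖ < 1) ∧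
      (deriv ζ x₀ / ζ x₀).im * deriv (curveY α) θ = 2 * x₀ / b := by
  obtain ⟨ψ, hc, hv, he⟩ := exists_local_branch hα hα1 hθ
  obtain ⟨hn1, -, him⟩ := norm_curveZ_lt hα hα1 hθ
  have hy0 : (x₀ : ℂ) ^ 2 / b = curveY α θ := by
    rw [div_eq_iff (by exact_mod_cast hb.ne')]
    exact_mod_cast hx.trans (mul_comm _ _)
  have hder : HasDerivAt (fun w : ℂ => w ^ 2 / b) (2 * x₀ / b) x₀ := by
    simpa using ((hasDerivAt_id (x₀ : ℂ)).pow 2).div_const (b : ℂ)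
  have hcont : Tendsto (fun w : ℂ => w ^ 2 / (b : ℂ)) (𝓝 x₀) (𝓝 (curveY α θ : ℂ)) := by
    rw [← hy0]; exact hder.continuousAt
  have hd : ∀ᶠ y in 𝓝 (curveY α θ : ℂ), DifferentiableAt ℂ ψ y := by
    filter_upwards [hc.eventually (by simp)] with y hy using hy.differentiableAt one_ne_zero
  have hψ : Tendsto ψ (𝓝 (curveY α θ : ℂ)) (𝓝 (curveZ α θ)) := by
    rw [← hv]; exact hc.continuousAt
  have h1 : ∀ᶠ y in 𝓝 (curveY α θ : ℂ), 0 < (ψ y).im :=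
    ((Complex.continuous_im.tendsto _).comp hψ).eventually (lt_mem_nhds him)
  have h2 : ∀ᶠ y in 𝓝 (curveY α θ : ℂ), ‖ψ y‖ < 1 :=
    ((continuous_norm.tendsto _).comp hψ).eventually (gt_mem_nhds hn1)
  obtain ⟨r, hr, hball⟩ := Metric.eventually_nhds_iff_ball.1
    (hcont.eventually (hd.and (he.and (h1.and h2))))
  refine ⟨fun w => ψ (w ^ 2 / b), r, hr, fun w hw => ?_, ?_, fun w hw => (hball w hw).2, ?_⟩
  · refine DifferentiableAt.differentiableWithinAt ?_
    exact DifferentiableAt.comp (g := ψ) w (hball w hw).1 (by fun_prop)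
  · simp only [hy0, hv]
  · have hd0 : DifferentiableAt ℂ ψ (curveY α θ) := hc.differentiableAt one_ne_zero
    have h3 := im_deriv_branch hα hα1 hθ hd0 hv he
    have h4 : HasDerivAt (fun w : ℂ => ψ (w ^ 2 / b)) (deriv ψ (curveY α θ) * (2 * x₀ / b)) x₀ := by
      refine HasDerivAt.comp (h₂ := ψ) (x₀ : ℂ) ?_ hder
      rw [hy0]; exact hd0.hasDerivAt
    rw [h4.deriv]
    simp only [hy0, hv]
    rw [mul_div_right_comm, show (2 * (x₀ : ℂ) / b) = ((2 * x₀ / b : ℝ) : ℂ) by push_cast; rfl,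
      Complex.im_mul_ofReal]
    linear_combination (2 * x₀ / b) * h3

/-- The density at a support point. -/
lemma densityOne_of_theta {t s : ℝ} (ht : t ∈ Ioo 0 (Real.pi / 2)) (hs : 0 < s) {x₀ θ : ℝ}
    (hθ : θ ∈ Ioo 0 Real.pi) (hx : x₀ ^ 2 = coeffB t s * curveY (Real.sin t ^ 2) θ) :
    DensityOneExists t s x₀ ∧
      (densityOne t s x₀).re * |deriv (curveY (Real.sin t ^ 2)) θ| =
        |x₀| / (Real.pi * coeffB t s) := by
  obtain ⟨hα, hα1⟩ := sin_sq_mem ht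
  have hb := coeffB_pos t hs
  set α := Real.sin t ^ 2 with hαdef
  set b := coeffB t s with hbdef
  have hb' : (b : ℂ) ≠ 0 := by exact_mod_cast hb.ne'
  obtain ⟨ζ, r, hr, hdiff, hζ0, hζ, hder⟩ := exists_ball_branch hα hα1 hb hθ hx
  have hne : ∀ w ∈ Metric.ball (x₀ : ℂ) r, ζ w ≠ conj (ζ (conj w)) := fun w hw h => by
    have h1 := (hζ w hw).2.1
    have h2 := (hζ _ (conj_mem_ball hw)).2.1
    rw [h, Complex.conj_im] at h1
    linarith
  have hz0 : ∀ w ∈ Metric.ball (x₀ : ℂ) r, ζ w ≠ 0 := fun w hw h => by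
    have h1 := (hζ w hw).2.1
    simp [h] at h1
  have hfac : ∀ w ∈ Metric.ball (x₀ : ℂ) r, ∃ q, CubicFactors α (w ^ 2 / b) (ζ w)
      (conj (ζ (conj w))) q ∧ 1 < ‖q‖ := fun w hw => by
    have h0 := hz0 w hw
    have h0' := hz0 _ (conj_mem_ball hw)
    refine ⟨_, cubicFactors_of_roots hα (hne w hw) h0 (by simpa using h0') (hζ w hw).1 ?_, ?_⟩
    · have := congrArg conj (hζ _ (conj_mem_ball hw)).1
      simpa using this
    · have h1 := (hζ w hw).2.2
      have h2 := (hζ _ (conj_mem_ball hw)).2.2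
      have h3 := norm_pos_iff.2 h0
      have h4 := norm_pos_iff.2 h0'
      rw [norm_div, norm_mul, norm_mul, norm_neg, norm_one, RCLike.norm_conj, Complex.norm_real,
        Real.norm_of_nonneg hα.le, one_lt_div (by positivity)]
      calc α * ‖ζ w‖ * ‖ζ (conj w)‖ < 1 * 1 * 1 := by gcongr
        _ = 1 := by norm_num
  have hlab : ∀ w ∈ Metric.ball (x₀ : ℂ) r,
      (b * zOne t s w = ζ w ∧ ‖ζ w‖ ≤ ‖ζ (conj w)‖ ∨
        b * zOne t s w = conj (ζ (conj w)) ∧ ‖ζ (conj w)‖ ≤ ‖ζ w‖) ∧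
      (w.im ≠ 0 → ‖ζ w‖ ≠ ‖ζ (conj w)‖) := fun w hw => by
    obtain ⟨q, hq, hq1⟩ := hfac w hw
    have hl := (isLabeling_rootZ ht hs w).2
    have hn1 := norm_coeffB_mul_le t s hl.1
    have hmem := mem_gammaOne_iff (t := t) hs w
    have hreal := fun h => gammaOne_subset_real ht hs (x := w) h
    obtain ⟨-, ⟨e0, e1⟩ | ⟨e0, e1⟩⟩ := (cubicFactors_rootZ ht hs w).labeled_eq hα hq hn1
      (norm_coeffB_mul_le t s hl.2) (hne w hw) ((hζ w hw).2.2.trans hq1)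
      (by rw [RCLike.norm_conj]; exact (hζ _ (conj_mem_ball hw)).2.2.trans hq1)
    · rw [e0, e1, RCLike.norm_conj] at hn1 hmem
      exact ⟨Or.inl ⟨e0, hn1⟩, fun h h' => h (hreal (hmem.2 h'))⟩
    · rw [e0, e1, RCLike.norm_conj] at hn1 hmem
      exact ⟨Or.inr ⟨e0, hn1⟩, fun h h' => h (hreal (hmem.2 h'.symm))⟩
  have hball_conj : MapsTo (fun w : ℂ => conj w) (Metric.ball (x₀ : ℂ) r)
      (Metric.ball (x₀ : ℂ) r) := fun w hw => conj_mem_ball hw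
  have hdiff' : DifferentiableOn ℂ (fun w => conj (ζ (conj w))) (Metric.ball (x₀ : ℂ) r) := by
    intro w hw
    have h1 := hdiff.differentiableAt (Metric.isOpen_ball.mem_nhds (conj_mem_ball hw))
    have h2 := h1.conj_conj
    rw [Complex.conj_conj] at h2
    exact h2.differentiableWithinAt
  have hsign : (∀ w ∈ Metric.ball (x₀ : ℂ) r, 0 < w.im → ‖ζ w‖ < ‖ζ (conj w)‖) ∨
      (∀ w ∈ Metric.ball (x₀ : ℂ) r, 0 < w.im → ‖ζ (conj w)‖ < ‖ζ w‖) := by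
    have hpre : IsPreconnected (Metric.ball (x₀ : ℂ) r ∩ {w | 0 < w.im}) :=
      ((convex_ball _ _).inter (convex_halfSpace_im_gt 0)).isPreconnected
    have hcont : ContinuousOn (fun w => ‖ζ w‖ - ‖ζ (conj w)‖)
        (Metric.ball (x₀ : ℂ) r ∩ {w | 0 < w.im}) :=
      ((hdiff.continuousOn.norm).sub
        ((hdiff.continuousOn.comp Complex.continuous_conj.continuousOn hball_conj).norm)).mono
        inter_subset_left
    by_contra! hcon
    obtain ⟨⟨w₁, hw₁, hi₁, h₁⟩, w₂, hw₂, hi₂, h₂⟩ := hcon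
    obtain ⟨w, hw, h0⟩ := hpre.intermediate_value (a := w₂) (b := w₁) ⟨hw₂, hi₂⟩ ⟨hw₁, hi₁⟩ hcont
      (show (0 : ℝ) ∈ Icc _ _ from ⟨sub_nonpos.2 h₂, sub_nonneg.2 h₁⟩)
    exact (hlab w hw.1).2 hw.2.ne' (sub_eq_zero.1 h0)
  have hx0 : x₀ ∈ {x : ℝ | (x : ℂ) ∈ Metric.ball (x₀ : ℂ) r} := by simp [hr]
  have hfinal : ∀ u : ℂ → ℂ, ReflectedBranch (zOne t s) u x₀ r → u x₀ ≠ 0 →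
      (∀ w ∈ Metric.ball (x₀ : ℂ) r, 0 < w.im → ‖u w‖ ≤ ‖u (conj w)‖) →
      |(deriv u x₀ / u x₀).im| = |(deriv ζ x₀ / ζ x₀).im| →
      DensityOneExists t s x₀ ∧ (densityOne t s x₀).re * |deriv (curveY α) θ| =
        |x₀| / (Real.pi * b) := fun u hu hu0 hle habs => by
    refine ⟨hu.densityOneExists hu0 hle, ?_⟩
    have h1 := hu.im_nonneg hle
    rw [hu.density_eq, Complex.ofReal_re]
    rw [abs_of_nonneg h1] at habs
    have h2 := congrArg abs hder
    rw [abs_mul, ← habs, abs_div, abs_mul, abs_two, abs_of_pos hb] at h2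
    have hpi := Real.pi_pos
    rw [div_mul_eq_mul_div, h2]
    field_simp
  rcases hsign with hsg | hsg
  · refine hfinal (fun w => ζ w / b) ⟨hr, hdiff.div_const _, fun w hw hi => ?_, fun w hw hi => ?_⟩
      (div_ne_zero (hz0 _ hx0) hb') (fun w hw hi => ?_) ?_
    · have h1 := hsg w hw hi
      rw [eq_div_iff hb', mul_comm]
      rcases (hlab w hw).1 with h | h
      · exact h.1
      · exact absurd h.2 (not_le.2 h1)
    · have h1 := hsg _ (conj_mem_ball hw) (by simpa using hi)
      rw [Complex.conj_conj] at h1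
      rw [map_div₀, Complex.conj_ofReal, eq_div_iff hb', mul_comm]
      rcases (hlab w hw).1 with h | h
      · exact absurd h.2 (not_le.2 h1)
      · exact h.1
    · rw [norm_div, norm_div]
      exact div_le_div_of_nonneg_right (hsg w hw hi).le (norm_nonneg _)
    · rw [deriv_div_const, div_div_div_cancel_right₀ hb']
  · refine hfinal (fun w => conj (ζ (conj w)) / b)
      ⟨hr, hdiff'.div_const _, fun w hw hi => ?_, fun w hw hi => ?_⟩
      (div_ne_zero (by simpa using hz0 _ hx0) hb') (fun w hw hi => ?_) ?_
    · have h1 := hsg w hw hi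
      rw [eq_div_iff hb', mul_comm]
      rcases (hlab w hw).1 with h | h
      · exact absurd h.2 (not_le.2 h1)
      · exact h.1
    · have h1 := hsg _ (conj_mem_ball hw) (by simpa using hi)
      rw [Complex.conj_conj] at h1
      rw [map_div₀, Complex.conj_ofReal, Complex.conj_conj, Complex.conj_conj, eq_div_iff hb',
        mul_comm]
      rcases (hlab w hw).1 with h | h
      · exact h.1
      · exact absurd h.2 (not_le.2 h1)
    · rw [norm_div, norm_div, RCLike.norm_conj, RCLike.norm_conj, Complex.conj_conj]
      exact div_le_div_of_nonneg_right (hsg w hw hi).le (norm_nonneg _)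
    · rw [deriv_div_const, div_div_div_cancel_right₀ hb']
      have : deriv (fun w => conj (ζ (conj w))) (x₀ : ℂ) = conj (deriv ζ x₀) := by
        have := congrFun (deriv_conj_conj (f := ζ)) (x₀ : ℂ)
        rw [Function.comp_apply, Function.comp_apply, Complex.conj_ofReal] at this
        exact this
      rw [this, Complex.conj_ofReal, ← map_div₀, Complex.conj_im, abs_neg]

/-! ### The measures as images of an arc -/

/-- The measure `dθ / (2π)` on `(0, π)`. -/
noncomputable def arcMeasure : Measure ℝ :=
  ENNReal.ofReal (1 / (2 * Real.pi)) • volume.restrict (Ioo 0 Real.pi)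

instance : IsFiniteMeasure arcMeasure := by
  unfold arcMeasure
  exact Measure.smul_finite _ ENNReal.ofReal_ne_top

lemma arcMeasure_univ : arcMeasure univ + arcMeasure univ = 1 := by
  have hpi := Real.pi_pos
  rw [arcMeasure, Measure.smul_apply, Measure.restrict_apply_univ, Real.volume_Ioo, sub_zero,
    smul_eq_mul, ← ENNReal.ofReal_mul (by positivity), ← ENNReal.ofReal_add (by positivity)
    (by positivity), ← ENNReal.ofReal_one]
  congr 1
  field_simp
  norm_num

lemma continuous_curveY {α : ℝ} (hα : 0 < α) (hα1 : α < 1) : Continuous (curveY α) :=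
  continuous_iff_continuousAt.2 fun θ => (hasDerivAt_curveY hα hα1 θ).continuousAt

lemma continuous_curveX {t : ℝ} (ht : t ∈ Ioo 0 (Real.pi / 2)) (s : ℝ) :
    Continuous (curveX t s) := by
  obtain ⟨hα, hα1⟩ := sin_sq_mem ht
  exact Real.continuous_sqrt.comp (continuous_const.mul (continuous_curveY hα hα1))

lemma curveX_eq_mul (t : ℝ) {s : ℝ} (hs : 0 ≤ s) (θ : ℝ) : curveX t s θ = s * curveX t 1 θ := by
  rw [curveX, curveX, show coeffB t s * curveY (Real.sin t ^ 2) θ =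
    s ^ 2 * (coeffB t 1 * curveY (Real.sin t ^ 2) θ) by rw [coeffB, coeffB]; ring,
    Real.sqrt_mul (sq_nonneg s), Real.sqrt_sq hs]

lemma curveX_injOn {t s : ℝ} (ht : t ∈ Ioo 0 (Real.pi / 2)) (hs : 0 < s) :
    InjOn (curveX t s) (Ioo 0 Real.pi) := by
  obtain ⟨hα, hα1⟩ := sin_sq_mem ht
  intro θ hθ θ' hθ' h
  have h2 := congrArg (· ^ 2) h
  simp only [curveX_sq ht hs hθ, curveX_sq ht hs hθ'] at h2
  exact curveY_injOn hα hα1 hθ hθ' (mul_left_cancel₀ (coeffB_pos t hs).ne' h2)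

lemma hasDerivAt_curveX {t s : ℝ} (ht : t ∈ Ioo 0 (Real.pi / 2)) (hs : 0 < s) {θ : ℝ}
    (hθ : θ ∈ Ioo 0 Real.pi) : HasDerivAt (curveX t s)
      (coeffB t s * deriv (curveY (Real.sin t ^ 2)) θ / (2 * curveX t s θ)) θ := by
  obtain ⟨hα, hα1⟩ := sin_sq_mem ht
  exact ((hasDerivAt_curveY hα hα1 θ).const_mul (coeffB t s)).sqrt
    (mul_pos (coeffB_pos t hs) (curveY_pos hα hα1 hθ)).ne'

/-- The density integrates to arc length along a signed branch of the support. -/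
lemma lintegral_density {t s : ℝ} (ht : t ∈ Ioo 0 (Real.pi / 2)) (hs : 0 < s) {σ : ℝ}
    (hσ : |σ| = 1) {B : Set ℝ} (hB : MeasurableSet B) :
    ∫⁻ x in B ∩ (fun θ => σ * curveX t s θ) '' Ioo 0 Real.pi,
      ENNReal.ofReal (densityOne t s x).re = arcMeasure.map (fun θ => σ * curveX t s θ) B := by
  have hσ0 : σ ≠ 0 := fun h => by simp [h] at hσ
  have hσ2 : σ ^ 2 = 1 := by rw [← sq_abs, hσ, one_pow]
  have hmeas : Measurable fun θ => σ * curveX t s θ :=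
    (continuous_const.mul (continuous_curveX ht s)).measurable
  set E := (fun θ => σ * curveX t s θ) ⁻¹' B ∩ Ioo 0 Real.pi with hE
  have hEm : MeasurableSet E := (hmeas hB).inter measurableSet_Ioo
  have himg : B ∩ (fun θ => σ * curveX t s θ) '' Ioo 0 Real.pi =
      (fun θ => σ * curveX t s θ) '' E := (image_preimage_inter _ _ _).symm
  rw [himg, lintegral_image_eq_lintegral_abs_deriv_mul hEm
    (fun θ hθ => ((hasDerivAt_curveX ht hs hθ.2).const_mul σ).hasDerivWithinAt)
    (fun θ hθ θ' hθ' h => curveX_injOn ht hs hθ.2 hθ'.2 (mul_left_cancel₀ hσ0 h))]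
  rw [setLIntegral_congr_fun (g := fun _ => ENNReal.ofReal (1 / (2 * Real.pi))) hEm]
  · rw [setLIntegral_const, Measure.map_apply hmeas hB, arcMeasure, Measure.smul_apply,
      Measure.restrict_apply (hmeas hB), smul_eq_mul]
  · intro θ hθ
    have hb := coeffB_pos t hs
    have hx := curveX_pos ht hs hθ.2
    have h1 : (σ * curveX t s θ) ^ 2 = coeffB t s * curveY (Real.sin t ^ 2) θ := by
      rw [mul_pow, hσ2, one_mul, curveX_sq ht hs hθ.2]
    have h2 := (densityOne_of_theta ht hs hθ.2 h1).2
    rw [abs_mul, hσ, one_mul, abs_of_pos hx] at h2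
    simp only
    rw [← ENNReal.ofReal_mul (abs_nonneg _), abs_mul, hσ, one_mul, abs_div, abs_mul, abs_mul,
      abs_two, abs_of_pos hb, abs_of_pos hx]
    congr 1
    have hpi := Real.pi_pos
    calc _ = coeffB t s * ((densityOne t s (σ * curveX t s θ)).re *
          |deriv (curveY (Real.sin t ^ 2)) θ|) / (2 * curveX t s θ) := by ring
      _ = _ := by rw [h2]; field_simp

lemma muOne_eq {t s : ℝ} (ht : t ∈ Ioo 0 (Real.pi / 2)) (hs : 0 < s) :
    muOne t s = arcMeasure.map (fun θ => 1 * curveX t s θ) +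
      arcMeasure.map (fun θ => -1 * curveX t s θ) := by
  have hae : ({x : ℝ | (x : ℂ) ∈ gammaOne t s} : Set ℝ) =ᵐ[volume]
      (((fun θ => 1 * curveX t s θ) '' Ioo 0 Real.pi) ∪
        ((fun θ => -1 * curveX t s θ) '' Ioo 0 Real.pi) : Set ℝ) := by
    have hF : (exceptionalSet t s)ᶜ ∈ ae volume :=
      compl_mem_ae_iff.2 ((finite_exceptionalSet s).measure_zero _)
    filter_upwards [hF] with x hx
    refine propext ⟨fun h => ?_, fun h => ?_⟩
    · obtain ⟨θ, hθ, he⟩ := exists_theta_of_mem_gammaOne ht hs h hx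
      rw [← curveX_sq ht hs hθ] at he
      rcases sq_eq_sq_iff_eq_or_eq_neg.1 he with he | he
      · exact Or.inl ⟨θ, hθ, by simp only; rw [he, one_mul]⟩
      · exact Or.inr ⟨θ, hθ, by simp only; rw [he, neg_one_mul]⟩
    · rcases h with ⟨θ, hθ, rfl⟩ | ⟨θ, hθ, rfl⟩
      · exact mem_gammaOne_of_theta ht hs hθ (by rw [← curveX_sq ht hs hθ]; ring)
      · exact mem_gammaOne_of_theta ht hs hθ (by rw [← curveX_sq ht hs hθ]; ring)
  have hmeas : ∀ σ : ℝ, σ ≠ 0 →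
      MeasurableSet ((fun θ => σ * curveX t s θ) '' Ioo 0 Real.pi) := fun σ hσ =>
    measurableSet_Ioo.image_of_continuousOn_injOn
      (continuous_const.mul (continuous_curveX ht s)).continuousOn
      (fun θ hθ θ' hθ' h => curveX_injOn ht hs hθ hθ' (mul_left_cancel₀ hσ h))
  ext B hB
  rw [muOne, withDensity_apply _ hB, Measure.restrict_congr_set hae, Measure.restrict_restrict hB,
    inter_union_distrib_left, lintegral_union (hB.inter (hmeas _ (by norm_num))),
    lintegral_density ht hs (by norm_num) hB, lintegral_density ht hs (by norm_num) hB,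
    Measure.add_apply]
  refine Disjoint.mono inter_subset_right inter_subset_right (Set.disjoint_left.2 ?_)
  rintro _ ⟨θ, hθ, rfl⟩ ⟨θ', hθ', h⟩
  simp only at h
  linarith [curveX_pos ht hs hθ, curveX_pos ht hs hθ']

lemma measurable_signed_curveX {t : ℝ} (ht : t ∈ Ioo 0 (Real.pi / 2)) (σ s : ℝ) :
    Measurable fun θ => σ * curveX t s θ :=
  (continuous_const.mul (continuous_curveX ht s)).measurable

lemma isProbabilityMeasure_muOne {t s : ℝ} (ht : t ∈ Ioo 0 (Real.pi / 2)) (hs : 0 < s) :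
    IsProbabilityMeasure (muOne t s) := by
  refine ⟨?_⟩
  rw [muOne_eq ht hs, Measure.add_apply, Measure.map_apply (measurable_signed_curveX ht _ _) .univ,
    Measure.map_apply (measurable_signed_curveX ht _ _) .univ, preimage_univ, preimage_univ,
    arcMeasure_univ]

/-- The parametrization of the support of `nuOne`. -/
noncomputable def sheet (t σ : ℝ) (p : ℝ × ℝ) : ℝ := σ * (p.1 * curveX t 1 p.2)

lemma continuous_sheet {t : ℝ} (ht : t ∈ Ioo 0 (Real.pi / 2)) (σ : ℝ) :
    Continuous (sheet t σ) :=
  continuous_const.mul (continuous_fst.mul ((continuous_curveX ht 1).comp continuous_snd))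

lemma muOne_apply {t s : ℝ} (ht : t ∈ Ioo 0 (Real.pi / 2)) (hs : 0 < s) {B : Set ℝ}
    (hB : MeasurableSet B) : muOne t s B =
      arcMeasure (Prod.mk s ⁻¹' (sheet t 1 ⁻¹' B)) +
        arcMeasure (Prod.mk s ⁻¹' (sheet t (-1) ⁻¹' B)) := by
  rw [muOne_eq ht hs, Measure.add_apply, Measure.map_apply (measurable_signed_curveX ht _ _) hB,
    Measure.map_apply (measurable_signed_curveX ht _ _) hB]
  simp only [curveX_eq_mul t hs.le]
  rfl

lemma aemeasurable_muOne {t : ℝ} (ht : t ∈ Ioo 0 (Real.pi / 2)) :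
    AEMeasurable (muOne t) (volume.restrict (Ioc (0 : ℝ) 1)) := by
  have hmeas : ∀ σ : ℝ, Measurable fun s : ℝ =>
      arcMeasure.map (fun θ => sheet t σ (s, θ)) := fun σ => by
    refine Measure.measurable_of_measurable_coe _ fun B hB => ?_
    have h1 : ∀ s : ℝ, arcMeasure.map (fun θ => sheet t σ (s, θ)) B =
        arcMeasure (Prod.mk s ⁻¹' (sheet t σ ⁻¹' B)) := fun s =>
      Measure.map_apply ((continuous_sheet ht σ).measurable.comp measurable_prodMk_left) hB
    simp only [h1]
    exact measurable_measure_prodMk_left ((continuous_sheet ht σ).measurable hB)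
  have hsum : Measurable fun s : ℝ => arcMeasure.map (fun θ => sheet t 1 (s, θ)) +
      arcMeasure.map (fun θ => sheet t (-1) (s, θ)) := by
    refine Measure.measurable_of_measurable_coe _ fun B hB => ?_
    simp only [Measure.add_apply]
    exact ((Measure.measurable_coe hB).comp (hmeas 1)).add
      ((Measure.measurable_coe hB).comp (hmeas (-1)))
  refine ⟨_, hsum, ?_⟩
  filter_upwards [ae_restrict_mem measurableSet_Ioc] with s hs
  rw [muOne_eq ht hs.1]
  simp only [curveX_eq_mul t hs.1.le]
  rfl

/-- The parameter space of `nuOne`. -/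
noncomputable def sheetMeasure : Measure (ℝ × ℝ) :=
  (volume.restrict (Ioc (0 : ℝ) 1)).prod arcMeasure

instance : IsFiniteMeasure sheetMeasure := by
  unfold sheetMeasure; infer_instance

lemma nuOne_eq {t : ℝ} (ht : t ∈ Ioo 0 (Real.pi / 2)) :
    nuOne t = sheetMeasure.map (sheet t 1) + sheetMeasure.map (sheet t (-1)) := by
  ext B hB
  have h1 := (continuous_sheet ht 1).measurable
  have h2 := (continuous_sheet ht (-1)).measurable
  have hae : ∀ᵐ s ∂(volume.restrict (Ioc (0 : ℝ) 1)), muOne t s B =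
      arcMeasure (Prod.mk s ⁻¹' (sheet t 1 ⁻¹' B)) +
        arcMeasure (Prod.mk s ⁻¹' (sheet t (-1) ⁻¹' B)) := by
    filter_upwards [ae_restrict_mem measurableSet_Ioc] with s hs using muOne_apply ht hs.1 hB
  rw [nuOne, Measure.bind_apply hB (aemeasurable_muOne ht), lintegral_congr_ae hae,
    lintegral_add_left (measurable_measure_prodMk_left (h1 hB)), Measure.add_apply,
    Measure.map_apply h1 hB, Measure.map_apply h2 hB, sheetMeasure, Measure.prod_apply (h1 hB),
    Measure.prod_apply (h2 hB)]

lemma isProbabilityMeasure_nuOne {t : ℝ} (ht : t ∈ Ioo 0 (Real.pi / 2)) :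
    IsProbabilityMeasure (nuOne t) := by
  refine ⟨?_⟩
  rw [nuOne_eq ht, Measure.add_apply, Measure.map_apply (continuous_sheet ht _).measurable .univ,
    Measure.map_apply (continuous_sheet ht _).measurable .univ, preimage_univ, preimage_univ,
    sheetMeasure, Measure.prod_apply .univ]
  simp [arcMeasure_univ]

lemma integral_nuOne {t : ℝ} (ht : t ∈ Ioo 0 (Real.pi / 2)) {g : ℝ → ℝ} (hg : Continuous g)
    (hi : ∀ σ : ℝ, Integrable (fun p => g (sheet t σ p)) sheetMeasure) :
    ∫ x, g x ∂nuOne t = (∫ p, g (sheet t 1 p) ∂sheetMeasure) +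
      ∫ p, g (sheet t (-1) p) ∂sheetMeasure := by
  have h : ∀ σ, AEMeasurable (sheet t σ) sheetMeasure := fun σ =>
    (continuous_sheet ht σ).measurable.aemeasurable
  have hint : ∀ σ, Integrable g (sheetMeasure.map (sheet t σ)) := fun σ =>
    (integrable_map_measure hg.aestronglyMeasurable (h σ)).2 (hi σ)
  rw [nuOne_eq ht, integral_add_measure (hint 1) (hint (-1)),
    integral_map (h 1) hg.aestronglyMeasurable, integral_map (h (-1)) hg.aestronglyMeasurable]

/-! ### Moments -/

lemma curveY_mul_curveZ {α : ℝ} (hα : 0 < α) (hα1 : α < 1) (θ : ℝ) :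
    (curveY α θ : ℂ) * curveZ α θ = (1 + curveZ α θ) ^ 2 * (1 + α * curveZ α θ) :=
  (cubicFactors_curve hα hα1 θ).eq₀.symm

/-- The imaginary part of `Z ^ l Z' / Z` along the curve. -/
noncomputable def curveG (α : ℝ) (l : ℤ) (θ : ℝ) : ℝ := (curveZ α θ ^ l * curveW α θ).im

lemma continuous_curveG {α : ℝ} (hα : 0 < α) (hα1 : α < 1) (l : ℤ) : Continuous (curveG α l) := by
  have h1 : Continuous (curveZ α) :=
    continuous_iff_continuousAt.2 fun θ => (hasDerivAt_curveZ hα hα1 θ).continuousAt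
  have h2 : Continuous (curveW α) := by
    unfold curveW
    have h3 := (contDiff_eta hα hα1).continuous_deriv le_rfl
    exact continuous_const.sub (Complex.continuous_ofReal.comp
      (h3.div (contDiff_eta hα hα1).continuous (eta_ne_zero hα hα1)))
  exact Complex.continuous_im.comp
    ((h1.zpow₀ l fun θ => Or.inl (curveZ_ne_zero hα hα1 θ)).mul h2)

lemma curveG_zero (α θ : ℝ) : curveG α 0 θ = 1 := by simp [curveG, curveW]

lemma curveY_mul_curveG {α : ℝ} (hα : 0 < α) (hα1 : α < 1) (l : ℤ) (θ : ℝ) :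
    curveY α θ * curveG α l θ = curveG α (l - 1) θ + (2 + α) * curveG α l θ +
      (1 + 2 * α) * curveG α (l + 1) θ + α * curveG α (l + 2) θ := by
  have h0 := curveZ_ne_zero hα hα1 θ
  have h : (curveY α θ : ℂ) * (curveZ α θ ^ l * curveW α θ) =
      curveZ α θ ^ (l - 1) * curveW α θ + ((2 + α : ℝ) : ℂ) * (curveZ α θ ^ l * curveW α θ) +
      ((1 + 2 * α : ℝ) : ℂ) * (curveZ α θ ^ (l + 1) * curveW α θ) +
      (α : ℂ) * (curveZ α θ ^ (l + 2) * curveW α θ) := by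
    have e := curveY_mul_curveZ hα hα1 θ
    rw [zpow_sub_one₀ h0, zpow_add_one₀ h0, zpow_add₀ h0, zpow_ofNat]
    push_cast
    field_simp
    linear_combination curveW α θ * e
  have h' := congrArg Complex.im h
  simp only [Complex.add_im, Complex.im_ofReal_mul] at h'
  exact h'

lemma integral_curveG {α : ℝ} (hα : 0 < α) (hα1 : α < 1) (l : ℤ) :
    ∫ θ in (0 : ℝ)..Real.pi, curveG α l θ = if l = 0 then Real.pi else 0 := by
  split_ifs with hl
  · simp [hl, curveG_zero]
  · have hl' : (l : ℂ) ≠ 0 := by exact_mod_cast hl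
    have hd : ∀ θ, HasDerivAt (fun θ => (curveZ α θ ^ l / l).im) (curveG α l θ) θ := fun θ => by
      have h0 := curveZ_ne_zero hα hα1 θ
      have h1 : HasDerivAt (fun θ => curveZ α θ ^ l / l) (curveZ α θ ^ l * curveW α θ) θ := by
        refine (((hasDerivAt_zpow l _ (Or.inl h0)).comp θ
          (hasDerivAt_curveZ hα hα1 θ)).div_const (l : ℂ)).congr_deriv ?_
        rw [zpow_sub_one₀ h0]
        field_simp
      exact Complex.imCLM.hasFDerivAt.comp_hasDerivAt θ h1
    rw [intervalIntegral.integral_eq_sub_of_hasDerivAt (fun θ _ => hd θ)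
      ((continuous_curveG hα hα1 l).intervalIntegrable _ _)]
    have hreal : ∀ θ, Real.sin θ = 0 → (curveZ α θ ^ l / l).im = 0 := fun θ h => by
      have h1 : curveZ α θ = ((curveZ α θ).re : ℂ) :=
        Complex.ext rfl (by rw [curveZ_im, h, zero_div, Complex.ofReal_im])
      rw [h1]
      have : (((curveZ α θ).re : ℂ) ^ l / l).im = ((((curveZ α θ).re ^ l / l : ℝ)) : ℂ).im := by
        push_cast; rfl
      rw [this, Complex.ofReal_im]
    rw [hreal _ Real.sin_pi, hreal _ Real.sin_zero, sub_zero]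

/-- The trigonometric moments along the curve satisfy the recurrence of `limCoeff`. -/
lemma integral_curveY_pow_mul {α c τ : ℝ} (hα : 0 < α) (hα1 : α < 1) (hc : c = 1 + τ ^ 2)
    (hτ : τ ^ 2 = α * c) (j : ℕ) (l : ℤ) :
    ∫ θ in (0 : ℝ)..Real.pi, (c * curveY α θ) ^ j * curveG α l θ =
      c ^ l * (Real.pi * limCoeff τ (2 * j) 0 (2 * l)) := by
  have hc0 : c ≠ 0 := by rw [hc]; positivity
  induction j generalizing l with
  | zero =>
    simp only [pow_zero, one_mul, integral_curveG hα hα1, limCoeff]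
    rcases eq_or_ne l 0 with rfl | hl
    · simp
    · simp [hl]
  | succ j ih =>
    have hint : ∀ l, IntervalIntegrable (fun θ => (c * curveY α θ) ^ j * curveG α l θ) volume 0
        Real.pi := fun l =>
      (((continuous_const.mul (continuous_curveY hα hα1)).pow j).mul
        (continuous_curveG hα hα1 l)).intervalIntegrable _ _
    have hexp : ∀ θ, (c * curveY α θ) ^ (j + 1) * curveG α l θ =
        c * ((c * curveY α θ) ^ j * curveG α (l - 1) θ) +
        c * (2 + α) * ((c * curveY α θ) ^ j * curveG α l θ) +
        c * (1 + 2 * α) * ((c * curveY α θ) ^ j * curveG α (l + 1) θ) +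
        c * α * ((c * curveY α θ) ^ j * curveG α (l + 2) θ) := fun θ => by
      have := curveY_mul_curveG hα hα1 l θ
      rw [pow_succ]
      linear_combination c * (c * curveY α θ) ^ j * this
    simp only [hexp]
    rw [intervalIntegral.integral_add (((((hint _).const_mul _).add ((hint _).const_mul _)).add
        ((hint _).const_mul _))) ((hint _).const_mul _),
      intervalIntegral.integral_add ((((hint _).const_mul _).add ((hint _).const_mul _)))
        ((hint _).const_mul _),
      intervalIntegral.integral_add ((hint _).const_mul _) ((hint _).const_mul _)]
    simp only [intervalIntegral.integral_const_mul, ih]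
    rw [show 2 * (j + 1) = 2 * j + 2 by ring, limCoeff_add_two, ← hc, hτ,
      show 2 * (l - 1) = 2 * l - 2 by ring, show 2 * (l + 1) = 2 * l + 2 by ring,
      show 2 * (l + 2) = 2 * l + 4 by ring, zpow_sub_one₀ hc0, zpow_add_one₀ hc0, zpow_add₀ hc0,
      zpow_ofNat]
    field_simp

lemma integral_arcMeasure (g : ℝ → ℝ) :
    ∫ θ, g θ ∂arcMeasure = 1 / (2 * Real.pi) * ∫ θ in (0 : ℝ)..Real.pi, g θ := by
  rw [arcMeasure, integral_smul_measure, ENNReal.toReal_ofReal (by positivity), smul_eq_mul,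
    intervalIntegral.integral_of_le Real.pi_pos.le, integral_Ioc_eq_integral_Ioo]

lemma integral_curveX_pow {t : ℝ} (ht : t ∈ Ioo 0 (Real.pi / 2)) (j : ℕ) :
    ∫ θ, curveX t 1 θ ^ (2 * j) ∂arcMeasure =
      limCoeff (Real.tan t) (2 * j) 0 0 / (2 * 4 ^ j) := by
  obtain ⟨hα, hα1⟩ := sin_sq_mem ht
  have h := integral_curveY_pow_mul hα hα1 rfl (one_add_tan_sq ht) j 0
  simp only [curveG_zero, mul_one, zpow_zero, one_mul, mul_zero] at h
  rw [integral_arcMeasure, intervalIntegral.integral_congr (g := fun θ => (1 / 4 ^ j : ℝ) *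
    ((1 + Real.tan t ^ 2) * curveY (Real.sin t ^ 2) θ) ^ j), intervalIntegral.integral_const_mul, h]
  · have := Real.pi_ne_zero
    field_simp
  · intro θ _
    have h0 : 0 ≤ curveY (Real.sin t ^ 2) θ := by
      have := one_le_eta hα hα1 θ
      have : 0 ≤ eta (Real.sin t ^ 2) θ ^ 2 - 1 := by nlinarith
      rw [curveY]; positivity
    simp only
    rw [curveX, pow_mul, Real.sq_sqrt (mul_nonneg (coeffB_pos t one_pos).le h0), coeffB,
      one_div, ← inv_pow, ← mul_pow]
    congr 1
    ring

lemma ae_sheetMeasure : ∀ᵐ p ∂sheetMeasure, p ∈ Icc (0 : ℝ) 1 ×ˢ Icc (0 : ℝ) Real.pi := by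
  have h : sheetMeasure = ENNReal.ofReal (1 / (2 * Real.pi)) •
      (volume.prod volume).restrict (Ioc (0 : ℝ) 1 ×ˢ Ioo 0 Real.pi) := by
    rw [sheetMeasure, arcMeasure, Measure.prod_smul_right, Measure.prod_restrict]
  rw [h]
  refine Measure.ae_smul_measure ?_ _
  filter_upwards [ae_restrict_mem (measurableSet_Ioc.prod measurableSet_Ioo)] with p hp
  exact ⟨Ioc_subset_Icc_self hp.1, Ioo_subset_Icc_self hp.2⟩

lemma integrable_sheetMeasure {g : ℝ × ℝ → ℝ} (hg : Continuous g) : Integrable g sheetMeasure := by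
  obtain ⟨M, hM⟩ := (isCompact_Icc.prod isCompact_Icc :
    IsCompact (Icc (0 : ℝ) 1 ×ˢ Icc (0 : ℝ) Real.pi)).exists_bound_of_continuousOn hg.continuousOn
  exact Integrable.of_bound hg.aestronglyMeasurable M (ae_sheetMeasure.mono hM)

lemma exists_bound_nuOne {t : ℝ} (ht : t ∈ Ioo 0 (Real.pi / 2)) :
    ∃ M, ∀ᵐ x ∂nuOne t, |x| ≤ M := by
  have h : ∀ σ, ∃ M, ∀ᵐ x ∂sheetMeasure.map (sheet t σ), |x| ≤ M := fun σ => by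
    obtain ⟨M, hM⟩ := (isCompact_Icc.prod isCompact_Icc :
      IsCompact (Icc (0 : ℝ) 1 ×ˢ Icc (0 : ℝ) Real.pi)).exists_bound_of_continuousOn
      (continuous_sheet ht σ).continuousOn
    refine ⟨M, (ae_map_iff (continuous_sheet ht σ).measurable.aemeasurable
      (measurableSet_le continuous_abs.measurable measurable_const)).2 (ae_sheetMeasure.mono hM)⟩
  obtain ⟨M, hM⟩ := h 1
  obtain ⟨M', hM'⟩ := h (-1)
  refine ⟨max M M', ?_⟩
  rw [nuOne_eq ht]
  exact ae_add_measure_iff.2 ⟨hM.mono fun x hx => hx.trans (le_max_left _ _),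
    hM'.mono fun x hx => hx.trans (le_max_right _ _)⟩

lemma integral_pow_nuOne {t : ℝ} (ht : t ∈ Ioo 0 (Real.pi / 2)) (m : ℕ) :
    ∫ x, x ^ m ∂nuOne t =
      (1 + (-1) ^ m) * (1 / (m + 1)) * ∫ θ, curveX t 1 θ ^ m ∂arcMeasure := by
  have h : ∀ σ : ℝ, ∫ p, sheet t σ p ^ m ∂sheetMeasure =
      σ ^ m * (1 / (m + 1)) * ∫ θ, curveX t 1 θ ^ m ∂arcMeasure := fun σ => by
    have hp : ∀ p, sheet t σ p ^ m = σ ^ m * (p.1 ^ m * curveX t 1 p.2 ^ m) := fun p => by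
      rw [sheet, mul_pow, mul_pow]
    simp only [hp]
    rw [integral_const_mul, sheetMeasure,
      integral_prod_mul (fun s : ℝ => s ^ m) (fun θ => curveX t 1 θ ^ m),
      ← intervalIntegral.integral_of_le zero_le_one, integral_pow, one_pow,
      zero_pow (Nat.succ_ne_zero m), sub_zero, mul_assoc]
  rw [integral_nuOne ht (continuous_pow m) fun σ =>
    integrable_sheetMeasure ((continuous_sheet ht σ).pow m), h, h, one_pow]
  ring

/-- The moments of `nuOne` in the form of the limits of the power sums of the zeros. -/
lemma integral_pow_nuOne_eq {t : ℝ} (ht : t ∈ Ioo 0 (Real.pi / 2)) (m : ℕ) :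
    ∫ x, x ^ m ∂nuOne t = (limCoeff (Real.tan t) m 0 0 + limCoeff (Real.tan t) m 1 0) /
      (2 ^ (m + 1) * (m + 1)) := by
  rw [integral_pow_nuOne ht]
  rcases Nat.even_or_odd' m with ⟨j, rfl | rfl⟩
  · rw [integral_curveX_pow ht, limCoeff_even_eq _ _ 1, pow_mul, pow_succ 2, pow_mul 2]
    norm_num
    field_simp
    ring
  · rw [limCoeff_odd_sum, pow_succ, pow_mul]
    norm_num

/-! ### Weak convergence from moments -/

lemma integrable_of_ae_abs_le {μ : Measure ℝ} [IsFiniteMeasure μ] {M : ℝ}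
    (hM : ∀ᵐ x ∂μ, |x| ≤ M) {g : ℝ → ℝ} (hg : Continuous g) : Integrable g μ := by
  obtain ⟨C, hC⟩ := (isCompact_Icc (a := -M) (b := M)).exists_bound_of_continuousOn hg.continuousOn
  exact Integrable.of_bound hg.aestronglyMeasurable C (hM.mono fun x hx => hC x (abs_le.1 hx))

lemma abs_integral_sub_le {μ : Measure ℝ} [IsProbabilityMeasure μ] {M ε : ℝ}
    (hM : ∀ᵐ x ∂μ, |x| ≤ M) {f g : ℝ → ℝ} (hf : Continuous f) (hg : Continuous g)
    (h : ∀ x ∈ Icc (-M) M, |f x - g x| ≤ ε) : |(∫ x, f x ∂μ) - ∫ x, g x ∂μ| ≤ ε := by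
  rw [← integral_sub (integrable_of_ae_abs_le hM hf) (integrable_of_ae_abs_le hM hg)]
  have := norm_integral_le_of_norm_le_const (μ := μ) (f := fun x => f x - g x) (C := ε)
    (hM.mono fun x hx => h x (abs_le.1 hx))
  simpa using this

/-- Convergence of the moments of uniformly compactly supported probability measures implies weak
convergence. -/
lemma tendsto_integral_of_moments {μ : ℕ → Measure ℝ} {ν : Measure ℝ} [IsProbabilityMeasure ν]
    {M : ℝ} (hμ : ∀ᶠ n in atTop, IsProbabilityMeasure (μ n)) (hμM : ∀ᶠ n in atTop,
      ∀ᵐ x ∂μ n, |x| ≤ M) (hνM : ∀ᵐ x ∂ν, |x| ≤ M)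
    (hmom : ∀ m : ℕ, Tendsto (fun n => ∫ x, x ^ m ∂μ n) atTop (𝓝 (∫ x, x ^ m ∂ν)))
    {f : ℝ → ℝ} (hf : Continuous f) :
    Tendsto (fun n => ∫ x, f x ∂μ n) atTop (𝓝 (∫ x, f x ∂ν)) := by
  have hexp : ∀ (p : ℝ[X]) (ρ : Measure ℝ) [IsProbabilityMeasure ρ], (∀ᵐ x ∂ρ, |x| ≤ M) →
      ∫ x, p.eval x ∂ρ = ∑ i ∈ Finset.range (p.natDegree + 1), p.coeff i * ∫ x, x ^ i ∂ρ := by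
    intro p ρ _ hρ
    simp only [eval_eq_sum_range]
    rw [integral_finsetSum _ fun i _ =>
      (integrable_of_ae_abs_le hρ (continuous_pow i)).const_mul _]
    simp only [integral_const_mul]
  have hpoly : ∀ p : ℝ[X], Tendsto (fun n => ∫ x, p.eval x ∂μ n) atTop
      (𝓝 (∫ x, p.eval x ∂ν)) := fun p => by
    rw [hexp p ν hνM]
    refine (tendsto_finsetSum _ fun i _ => (hmom i).const_mul (p.coeff i)).congr' ?_
    filter_upwards [hμ, hμM] with n h1 h2 using (hexp p (μ n) h2).symm
  refine Metric.tendsto_atTop'.2 fun ε hε => ?_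
  obtain ⟨p, hp⟩ := exists_polynomial_near_of_continuousOn (-M) M f hf.continuousOn (ε / 3)
    (by positivity)
  have hp' : ∀ x ∈ Icc (-M) M, |f x - p.eval x| ≤ ε / 3 := fun x hx => by
    rw [abs_sub_comm]; exact (hp x hx).le
  have h3 := (Metric.tendsto_nhds.1 (hpoly p)) (ε / 3) (by positivity)
  obtain ⟨N, hN⟩ := eventually_atTop.1 (hμ.and (hμM.and h3))
  refine ⟨N, fun n hn => ?_⟩
  obtain ⟨h1, h2, h3⟩ := hN n hn.le
  have h4 := abs_integral_sub_le h2 hf p.continuous hp'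
  have h5 := abs_integral_sub_le hνM hf p.continuous hp'
  rw [Real.dist_eq] at h3 ⊢
  rw [abs_lt] at h3 ⊢
  rw [abs_le] at h4 h5
  constructor <;> linarith [h3.1, h3.2, h4.1, h4.2, h5.1, h5.2]

/-! ### The zero counting measures -/

lemma sum_dirac_apply_univ (m : Multiset ℝ) :
    (m.map fun x => Measure.dirac x).sum univ = m.card := by
  induction m using Multiset.induction_on with
  | empty => simp
  | cons a m ih => simp [ih, add_comm]

lemma ae_sum_dirac {p : ℝ → Prop} (hp : MeasurableSet {x | p x}) (m : Multiset ℝ)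
    (h : ∀ x ∈ m, p x) : ∀ᵐ x ∂(m.map fun x => Measure.dirac x).sum, p x := by
  induction m using Multiset.induction_on with
  | empty => simp
  | cons a m ih =>
    rw [Multiset.map_cons, Multiset.sum_cons, ae_add_measure_iff]
    exact ⟨(ae_dirac_iff hp).2 (h a (Multiset.mem_cons_self a m)),
      ih fun x hx => h x (Multiset.mem_cons_of_mem hx)⟩

lemma integrable_sum_dirac {g : ℝ → ℝ} (m : Multiset ℝ) :
    Integrable g (m.map fun x => Measure.dirac x).sum := by
  induction m using Multiset.induction_on with
  | empty => simp
  | cons a m ih =>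
    rw [Multiset.map_cons, Multiset.sum_cons]
    exact (integrable_dirac (by simp)).add_measure ih

lemma integral_sum_dirac {g : ℝ → ℝ} (m : Multiset ℝ) :
    ∫ x, g x ∂(m.map fun x => Measure.dirac x).sum = (m.map g).sum := by
  induction m using Multiset.induction_on with
  | empty => simp
  | cons a m ih =>
    rw [Multiset.map_cons, Multiset.sum_cons, integral_add_measure (integrable_dirac (by simp))
      (integrable_sum_dirac m), ih, integral_dirac, Multiset.map_cons, Multiset.sum_cons]

lemma integral_zeroCounting (n : ℕ) (P : ℝ[X]) (g : ℝ → ℝ) :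
    ∫ x, g x ∂zeroCounting n P = (P.roots.map g).sum / n := by
  rw [zeroCounting, integral_smul_measure, integral_sum_dirac]
  simp [div_eq_inv_mul]

lemma isProbabilityMeasure_zeroCounting {n : ℕ} (hn : n ≠ 0) {P : ℝ[X]} (h : P.roots.card = n) :
    IsProbabilityMeasure (zeroCounting n P) := by
  refine ⟨?_⟩
  rw [zeroCounting, Measure.smul_apply, sum_dirac_apply_univ, h, smul_eq_mul]
  exact ENNReal.inv_mul_cancel (by exact_mod_cast hn) (ENNReal.natCast_ne_top n)

lemma ae_zeroCounting {n : ℕ} {P : ℝ[X]} {M : ℝ} (h : ∀ x ∈ P.roots, |x| ≤ M) :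
    ∀ᵐ x ∂zeroCounting n P, |x| ≤ M :=
  Measure.ae_smul_measure
    (ae_sum_dirac (measurableSet_le continuous_abs.measurable measurable_const) _ h) _

/-! ### The scaled polynomials -/

lemma scaledMP_roots_card_nodup {lam t : ℝ} (hlam : 0 < lam) (ht : |t| < Real.pi / 2)
    (h0 : Real.tan t ≠ 0) (n : ℕ) :
    (scaledMP lam t (-t) n n).roots.card = n ∧ (scaledMP lam t (-t) n n).roots.Nodup := by
  rcases eq_or_ne n 0 with rfl | hn
  · have : scaledMP lam t (-t) 0 0 = C (mpLead lam 0) * 1 := by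
      rw [scaledMP, stepMP_eq hlam ht h0, mpPoly_zero hlam]
      simp
    rw [this, mul_one, roots_C]
    simp
  · have hn' : (n : ℝ) ≠ 0 := by exact_mod_cast hn
    obtain ⟨h1, h2⟩ := mpPoly_roots hlam (Real.tan t) n
    rw [scaledMP_roots hlam ht h0 hn, Multiset.card_map]
    exact ⟨h1, h2.map fun x y h => (div_left_inj' hn').1 h⟩

lemma tendsto_zeroCounting {lam t : ℝ} (hlam : 0 < lam) (ht : t ∈ Ioo 0 (Real.pi / 2))
    {f : ℝ → ℝ} (hf : Continuous f) :
    Tendsto (fun n : ℕ => ∫ x, f x ∂zeroCounting n (scaledMP lam t (-t) n n)) atTop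
      (𝓝 (∫ x, f x ∂nuOne t)) := by
  have ht' : |t| < Real.pi / 2 := by rw [abs_of_pos ht.1]; exact ht.2
  have h0 : Real.tan t ≠ 0 := (Real.tan_pos_of_pos_of_lt_pi_div_two ht.1 ht.2).ne'
  have := isProbabilityMeasure_nuOne ht
  obtain ⟨K, hK0, hK⟩ := exists_rec_bound hlam (Real.tan t)
  obtain ⟨M, hM⟩ := exists_bound_nuOne ht
  refine tendsto_integral_of_moments (M := max K M) ?_ ?_
    (hM.mono fun x hx => hx.trans (le_max_right _ _)) (fun m => ?_) hf
  · filter_upwards [eventually_ne_atTop 0] with n hn using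
      isProbabilityMeasure_zeroCounting hn (scaledMP_roots_card_nodup hlam ht' h0 n).1
  · filter_upwards [eventually_ne_atTop 0] with n hn
    refine ae_zeroCounting fun x hx => (le_max_left K M).trans' ?_
    rw [scaledMP_roots hlam ht' h0 hn, Multiset.mem_map] at hx
    obtain ⟨y, hy, rfl⟩ := hx
    have hn' : (0 : ℝ) < n := by positivity
    rw [abs_div, abs_of_pos hn', div_le_iff₀ hn']
    exact abs_root_le hlam hK (isRoot_of_mem_roots hy)
  · rw [integral_pow_nuOne_eq ht]
    refine (tendsto_powerSum hlam (Real.tan t) m).congr' ?_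
    filter_upwards [eventually_ne_atTop 0] with n hn
    rw [integral_zeroCounting, scaledMP_roots hlam ht' h0 hn, Multiset.map_map]
    simp only [Function.comp_def, div_eq_mul_inv, mul_pow]
    rw [Multiset.sum_map_mul_right, mul_assoc, inv_pow, ← mul_inv, ← pow_succ]

end MeixnerPollaczek

theorem proposition2p4 (lam t : ℝ) (hlam : 0 < lam) (ht : t ∈ Ioo (0 : ℝ) (Real.pi / 2)) :
    -- the polynomials are well defined, with simple real zeros
    (∀ k : ℕ, ∃! P : ℝ[X],
      MeixnerPollaczek.IsMultipleMP lam t (-t) ((k + 1) / 2) (k / 2) P) ∧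
    (∀ n : ℕ, (MeixnerPollaczek.scaledMP lam t (-t) n n).roots.card = n ∧
      (MeixnerPollaczek.scaledMP lam t (-t) n n).roots.Nodup) ∧
    -- the measures are well defined
    (∀ s : ℝ, 0 < s →
      MeixnerPollaczek.gammaOne t s ⊆ Set.range ((↑) : ℝ → ℂ) ∧
      (∃ F : Set ℝ, F.Finite ∧ ∀ x : ℝ, (x : ℂ) ∈ MeixnerPollaczek.gammaOne t s → x ∉ F →
        MeixnerPollaczek.DensityOneExists t s x) ∧
      IsProbabilityMeasure (MeixnerPollaczek.muOne t s)) ∧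
    (AEMeasurable (MeixnerPollaczek.muOne t) (volume.restrict (Ioc (0 : ℝ) 1)) ∧
      IsProbabilityMeasure (MeixnerPollaczek.nuOne t)) ∧
    -- weak convergence of the normalized zero counting measures
    (∀ f : ℝ →ᵇ ℝ,
      Tendsto
        (fun n : ℕ => ∫ x, f x ∂(MeixnerPollaczek.zeroCounting n
          (MeixnerPollaczek.scaledMP lam t (-t) n n)))
        atTop (𝓝 (∫ x, f x ∂(MeixnerPollaczek.nuOne t)))) := by
  have ht' : |t| < Real.pi / 2 := by rw [abs_of_pos ht.1]; exact ht.2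
  have h0 : Real.tan t ≠ 0 := (Real.tan_pos_of_pos_of_lt_pi_div_two ht.1 ht.2).ne'
  refine ⟨MeixnerPollaczek.existsUnique_multipleMP hlam ht' h0,
    MeixnerPollaczek.scaledMP_roots_card_nodup hlam ht' h0, fun s hs => ⟨fun x hx => ?_,
      ⟨_, MeixnerPollaczek.finite_exceptionalSet (t := t) s, fun x hx hF => ?_⟩,
      MeixnerPollaczek.isProbabilityMeasure_muOne ht hs⟩,
    ⟨MeixnerPollaczek.aemeasurable_muOne ht, MeixnerPollaczek.isProbabilityMeasure_nuOne ht⟩,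
    fun f => MeixnerPollaczek.tendsto_zeroCounting hlam ht f.continuous⟩
  · exact ⟨x.re, Complex.ext rfl (MeixnerPollaczek.gammaOne_subset_real ht hs hx).symm⟩
  · obtain ⟨θ, hθ, he⟩ := MeixnerPollaczek.exists_theta_of_mem_gammaOne ht hs hx hF
    exact (MeixnerPollaczek.densityOne_of_theta ht hs hθ he).1
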